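/- Let $l>0$, $\nu>0$, $C_1\in\mathbb{R}$ and $s\ge 0$, let $\mathbb{T}_l=\mathbb{R}/l\mathbb{Z}$, and let $H^s$ denote the Sobolev spaces of real-valued functions, with norm $\|f\|_{H^s}^2=\sum_k (1+|\kappa|^2)^{s}|\widehat f(k)|^2$, $\kappa=2\pi k/l$. For a function (or distribution) $f$ on $\mathbb{T}_l^2$ write $\overline f(y)=\frac1l\int_0^l f(x,y)\,dx$, and let $\nabla^{-2}$ be the Fourier multiplier $-1/|\kappa|^2$ for $k\ne0$ and $0$ for $k=0$. Consider, for unknowns $\overline u=\overline u(t,y)$ and $\zeta'=\zeta'(t,x,y)$, the initial value problem $$\partial_t\zeta'+C_1\partial_x\nabla^{-2}\zeta'-\nu\nabla^2\zeta'=F(\overline u,\zeta'),\qquad \partial_t\overline u-\nu\partial_{yy}\overline u=G(\zeta'),\qquad \zeta'(0)=\zeta'_0,\quad \overline u(0)=\overline u_0,$$ where $$F(\overline u,\zeta')=(\partial_y\nabla^{-2}\zeta')\,\partial_x\zeta'-(\partial_x\nabla^{-2}\zeta')\,\partial_y\zeta'-\overline u\,\partial_x\zeta'+\partial_y\overline{(\partial_x\nabla^{-2}\zeta')\,\zeta'},\qquad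 G(\zeta')=\partial_y\overline{(\partial_x\nabla^{-2}\zeta')(\partial_y\nabla^{-2}\zeta')},$$ the products being understood through convolution of Fourier coefficients. A global (mild) solution in $L^\infty((0,\infty);H^s(\mathbb{T}_l)\times H^s(\mathbb{T}_l^2))$ is a pair $(\overline u,\zeta')$ in this space such that, for almost every $t>0$ and for every Fourier coefficient, $$\overline u(t)=e^{\nu t\partial_{yy}}\overline u_0+\int_0^t e^{\nu(t-\tau)\partial_{yy}}G(\zeta'(\tau))\,d\tau,\qquad \zeta'(t)=e^{tA}\zeta'_0+\int_0^t e^{(t-\tau)A}F(\overline u(\tau),\zeta'(\tau))\,d\tau,\qquad A=\nu\nabla^2-C_1\partial_x\nabla^{-2}.$$ Theorem. For all $\overline u_0\in H^s(\mathbb{T}_l)$ and $\zeta'_0\in H^s(\mathbb{T}_l^2)$ there is exactly one global mild solution $(\overline u,\zeta')\in L^\infty((0,\infty);H^s(\mathbb{T}_l)\times H^s(\mathbb{T}_l^2))$, where solutions that agree for almost every $t>0$ are identified; moreover it has a representative that satisfies the two integral identities for every $t\ge0$ (so that it takes the values $\overline u_0,\zeta'_0$ at $t=0$). -/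

import Mathlib

open MeasureTheory Set

noncomputable section

namespace EddyMean

/-! ### Function spaces on the circle and the two-torus of side length `l`

`AddCircle l` is `ℝ / lℤ`; the first coordinate of `AddCircle l × AddCircle l` is `x`,
the second one is `y`. The Lebesgue measure is normalised to total mass one. -/

/-- Real-valued square integrable functions of `y`. -/
abbrev L2y (l : ℝ) [Fact (0 < l)] : Type :=
  Lp ℝ 2 (AddCircle.haarAddCircle : Measure (AddCircle l))

/-- Real-valued square integrable functions of `(x, y)`. -/
abbrev L2xy (l : ℝ) [Fact (0 < l)] : Type :=
  Lp ℝ 2 ((AddCircle.haarAddCircle : Measure (AddCircle l)).prod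
    (AddCircle.haarAddCircle : Measure (AddCircle l)))

/-- Fourier coefficients `(1/l) ∫ f(y) exp(-2πi n y / l) dy`. -/
def hat1 {l : ℝ} [Fact (0 < l)] (f : L2y l) (n : ℤ) : ℂ :=
  fourierCoeff (fun y : AddCircle l => ((f y : ℝ) : ℂ)) n

/-- Fourier coefficients `(1/l²) ∫∫ f(x,y) exp(-2πi (k₁ x + k₂ y) / l) dx dy`. -/
def hat2 {l : ℝ} [Fact (0 < l)] (f : L2xy l) (k : ℤ × ℤ) : ℂ :=
  ∫ p : AddCircle l × AddCircle l,
    fourier (-k.1) p.1 * fourier (-k.2) p.2 * ((f p : ℝ) : ℂ)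
      ∂((AddCircle.haarAddCircle : Measure (AddCircle l)).prod
        (AddCircle.haarAddCircle : Measure (AddCircle l)))

/-- The frequency `2π n / l`. -/
def freq (l : ℝ) (n : ℤ) : ℝ := 2 * Real.pi * n / l

/-- `|κ|²` for the frequency vector `κ = (2π k₁ / l, 2π k₂ / l)`. -/
def freqSq (l : ℝ) (k : ℤ × ℤ) : ℝ := freq l k.1 ^ 2 + freq l k.2 ^ 2

/-- Square of the `H^s` norm of a function of `y`, with value `∞` outside `H^s`. -/
def sobolevSq1 {l : ℝ} [Fact (0 < l)] (s : ℝ) (f : L2y l) : ENNReal :=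
  ∑' n : ℤ, ENNReal.ofReal ((1 + freq l n ^ 2) ^ s * ‖hat1 f n‖ ^ 2)

/-- Square of the `H^s` norm of a function of `(x, y)`, with value `∞` outside `H^s`. -/
def sobolevSq2 {l : ℝ} [Fact (0 < l)] (s : ℝ) (f : L2xy l) : ENNReal :=
  ∑' k : ℤ × ℤ, ENNReal.ofReal ((1 + freqSq l k) ^ s * ‖hat2 f k‖ ^ 2)

/-- `f ∈ H^s` on the circle, for `s ≥ 0`. -/
def MemHs1 {l : ℝ} [Fact (0 < l)] (s : ℝ) (f : L2y l) : Prop := sobolevSq1 s f < ⊤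

/-- `f ∈ H^s` on the two-torus, for `s ≥ 0`. -/
def MemHs2 {l : ℝ} [Fact (0 < l)] (s : ℝ) (f : L2xy l) : Prop := sobolevSq2 s f < ⊤

/-! ### Operations on periodic distributions, acting on Fourier coefficients

A periodic distribution in `y` is given by its coefficients `ℤ → ℂ`, one in `(x, y)` by its
coefficients `ℤ × ℤ → ℂ`. -/

/-- `∂_y` for a distribution in `y`. -/
def dy1 (l : ℝ) (a : ℤ → ℂ) : ℤ → ℂ := fun n => Complex.I * (freq l n : ℂ) * a n

/-- `∂_x`. -/
def dx (l : ℝ) (a : ℤ × ℤ → ℂ) : ℤ × ℤ → ℂ := fun k => Complex.I * (freq l k.1 : ℂ) * a k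

/-- `∂_y`. -/
def dy (l : ℝ) (a : ℤ × ℤ → ℂ) : ℤ × ℤ → ℂ := fun k => Complex.I * (freq l k.2 : ℂ) * a k

/-- `∇⁻²`: the inverse Laplacian with values of mean zero, the multiplier `-1/|κ|²` for `k ≠ 0`
and `0` for `k = 0`. -/
def invLap (l : ℝ) (a : ℤ × ℤ → ℂ) : ℤ × ℤ → ℂ :=
  fun k => if k = 0 then 0 else -(a k / (freqSq l k : ℂ))

/-- The product of two distributions in `(x, y)`: convolution of the coefficients. In all the
products below the series converges absolutely when the factors come from functions in `L²`. -/
def mul2 (a b : ℤ × ℤ → ℂ) : ℤ × ℤ → ℂ := fun k => ∑' h : ℤ × ℤ, a h * b (k - h)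

/-- The zonal average `(1/l) ∫ f(x, y) dx`, a distribution in `y`. -/
def zonalMean (a : ℤ × ℤ → ℂ) : ℤ → ℂ := fun n => a (0, n)

/-- A distribution in `y` regarded as a distribution in `(x, y)` that does not depend on `x`. -/
def lift (a : ℤ → ℂ) : ℤ × ℤ → ℂ := fun k => if k.1 = 0 then a k.2 else 0

/-- The nonlinearity
`(∂_y ∇⁻² ζ) ζ_x - (∂_x ∇⁻² ζ) ζ_y - u ζ_x + ∂_y (zonal mean of (∂_x ∇⁻² ζ) ζ)`
of the eddy equation. -/
def nonlinF (l : ℝ) (u : ℤ → ℂ) (ζ : ℤ × ℤ → ℂ) : ℤ × ℤ → ℂ :=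
  mul2 (dy l (invLap l ζ)) (dx l ζ) - mul2 (dx l (invLap l ζ)) (dy l ζ)
    - mul2 (lift u) (dx l ζ)
    + lift (dy1 l (zonalMean (mul2 (dx l (invLap l ζ)) ζ)))

/-- The nonlinearity `∂_y (zonal mean of (∂_x ∇⁻² ζ) (∂_y ∇⁻² ζ))` of the mean equation. -/
def nonlinG (l : ℝ) (ζ : ℤ × ℤ → ℂ) : ℤ → ℂ :=
  dy1 l (zonalMean (mul2 (dx l (invLap l ζ)) (dy l (invLap l ζ))))

/-- The semigroup `exp(t ν ∂_yy)`. -/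
def semigroup1 (l ν t : ℝ) (a : ℤ → ℂ) : ℤ → ℂ :=
  fun n => Complex.exp ((t * (-ν * freq l n ^ 2) : ℝ) : ℂ) * a n

/-- The symbol of `ν ∇² - C₁ ∂_x ∇⁻²`. -/
def symbol2 (l ν C₁ : ℝ) (k : ℤ × ℤ) : ℂ :=
  -(ν : ℂ) * (freqSq l k : ℂ) - (C₁ : ℂ) * dx l (invLap l (fun _ => 1)) k

/-- The semigroup `exp(t (ν ∇² - C₁ ∂_x ∇⁻²))`. -/
def semigroup2 (l ν C₁ t : ℝ) (a : ℤ × ℤ → ℂ) : ℤ × ℤ → ℂ :=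
  fun k => Complex.exp ((t : ℂ) * symbol2 l ν C₁ k) * a k

/-! ### Mild solutions -/

/-- The Duhamel formula at time `t`, for every Fourier coefficient:
`u(t) = exp(tν∂_yy) u₀ + ∫₀ᵗ exp((t-τ)ν∂_yy) G(ζ(τ)) dτ` and
`ζ(t) = exp(tA) ζ₀ + ∫₀ᵗ exp((t-τ)A) F(u(τ), ζ(τ)) dτ` with `A = ν∇² - C₁∂_x∇⁻²`. -/
def DuhamelAt {l : ℝ} [Fact (0 < l)] (ν C₁ : ℝ) (u₀ : L2y l) (ζ₀ : L2xy l)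
    (u : ℝ → L2y l) (ζ : ℝ → L2xy l) (t : ℝ) : Prop :=
  (∀ n : ℤ, hat1 (u t) n = semigroup1 l ν t (hat1 u₀) n
      + ∫ τ in (0 : ℝ)..t, semigroup1 l ν (t - τ) (nonlinG l (hat2 (ζ τ))) n) ∧
  (∀ k : ℤ × ℤ, hat2 (ζ t) k = semigroup2 l ν C₁ t (hat2 ζ₀) k
      + ∫ τ in (0 : ℝ)..t,
          semigroup2 l ν C₁ (t - τ) (nonlinF l (hat1 (u τ)) (hat2 (ζ τ))) k)

/-- `(u, ζ) ∈ L^∞((0,∞); H^s × H^s)`. For `s ≥ 0` strong measurability of a map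
taking values in `H^s` is the same whether it is understood in `H^s` or in `L²`. -/
structure MemLinftyHs {l : ℝ} [Fact (0 < l)] (s : ℝ)
    (u : ℝ → L2y l) (ζ : ℝ → L2xy l) : Prop where
  meas_u : AEStronglyMeasurable u (volume.restrict (Ioi (0 : ℝ)))
  meas_ζ : AEStronglyMeasurable ζ (volume.restrict (Ioi (0 : ℝ)))
  bdd_u : essSup (fun t => sobolevSq1 s (u t)) (volume.restrict (Ioi (0 : ℝ))) < ⊤
  bdd_ζ : essSup (fun t => sobolevSq2 s (ζ t)) (volume.restrict (Ioi (0 : ℝ))) < ⊤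

/-- `(u, ζ)` is a global mild solution in `L^∞((0,∞); H^s × H^s)`: it belongs to this space and
satisfies the Duhamel formula as an identity in it, that is for almost every `t > 0`. -/
structure IsMildSolution {l : ℝ} [Fact (0 < l)] (ν C₁ s : ℝ) (u₀ : L2y l) (ζ₀ : L2xy l)
    (u : ℝ → L2y l) (ζ : ℝ → L2xy l) : Prop where
  mem : MemLinftyHs s u ζ
  duhamel : ∀ᵐ t ∂(volume.restrict (Ioi (0 : ℝ))), DuhamelAt ν C₁ u₀ ζ₀ u ζ t

end EddyMean

end

noncomputable section

open MeasureTheory Set Filter Topology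
open scoped ComplexConjugate ENNReal NNReal

namespace EddyMean

/-! On the Fourier side a pair (u, ζ) is a sequence indexed by `Mode`, and (G, F) is the diagonal of
one bilinear operator `bil` (`nonlinG_eq_bil`, `nonlinF_eq_bil`). In divergence form this operator
costs one derivative on the output, while the velocity recovered from ζ gains one derivative on the
first factor (`enorm_bil_le`). Integration against the heat semigroup gives two derivatives back, so
the Duhamel formula can be closed in ℓ² with room to spare.

The global bound is an enstrophy estimate. The full transport term is orthogonal to ζ, and the
Reynolds correction in F removes exactly its zonal mean. Hence F has no zonal mean, the zonal part
of ζ solves the heat equation, and eddy enstrophy E₂ is produced only by the work of the correction.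
That work is at most C √D E₂, where 2νD is the rate of decay of the zonal enstrophy E₁
(`abs_sum_re_conj_mul_bil_le`). Since D is integrable in time, E₂ stays bounded for all times
(`add_le_of_enstrophy_inequalities`). The mean flow needs no energy estimate: its forcing is
quadratic in ζ alone, so the Duhamel formula bounds it by the enstrophy.

For existence, Galerkin truncations satisfy this bound uniformly in time and in the truncation.
Reinserting it into the Duhamel formula a few times yields a single square summable sequence that
dominates all coefficients of all approximations at all times (`exists_majorant`). The coefficients
are also equi-Lipschitz in time, so a subsequence converges coefficientwise, and domination carries
every series and integral to the limit (`exists_duhamel_of_approx`). For the H^s bound, the supremum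
over time of each coefficient satisfies a quadratic inequality which gains 1/8 of a derivative per
pass, until the regularity of the data is reached (`hsq_maj_lt_top`, `hsq_lt_top_of_le`).

Uniqueness (`duhamel_unique`) holds among all solutions bounded in ℓ². The difference of two
solutions is measured by the supremum of (1 + |κ|²)^(3/8) times the coefficient, damped by exp(-μt).
For μ large the Duhamel formula halves this quantity, which is finite to begin with, so it vanishes.
-/

/-! ### Real square integrable functions and a conjugation-symmetric Hilbert basis -/

section RealFourier

variable {X ι : Type*} [MeasurableSpace X] {μ : Measure X}

/-- A real-valued square integrable function regarded as a complex-valued one. -/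
def complexify (μ : Measure X) : Lp ℝ 2 μ →L[ℝ] Lp ℂ 2 μ :=
  Complex.ofRealCLM.compLpL 2 μ

theorem coeFn_complexify (f : Lp ℝ 2 μ) : complexify μ f =ᵐ[μ] fun x => ((f x : ℝ) : ℂ) :=
  Complex.ofRealCLM.coeFn_compLpL f

theorem complexify_injective : Function.Injective (complexify μ) := by
  intro f g h
  apply Lp.ext
  filter_upwards [coeFn_complexify f, coeFn_complexify g] with x hf hg
  rw [h, hg] at hf
  exact (Complex.ofReal_injective hf).symm

/-- The basis element `b (-k)` is the complex conjugate of `b k`. -/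
def ConjSymm [Neg ι] (b : HilbertBasis ι ℂ (Lp ℂ 2 μ)) : Prop :=
  ∀ k, (b (-k) : X → ℂ) =ᵐ[μ] fun x => conj ((b k : X → ℂ) x)

theorem repr_conj [Neg ι] {b : HilbertBasis ι ℂ (Lp ℂ 2 μ)} (hb : ConjSymm b)
    {f g : Lp ℂ 2 μ} (hfg : f =ᵐ[μ] fun x => conj (g x)) (k : ι) :
    b.repr f (-k) = conj (b.repr g k) := by
  rw [b.repr_apply_apply, b.repr_apply_apply, L2.inner_def, L2.inner_def, ← integral_conj]
  apply integral_congr_ae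
  filter_upwards [hb k, hfg] with x hx hf
  simp [hx, hf, RCLike.inner_apply]

theorem repr_complexify_neg [Neg ι] {b : HilbertBasis ι ℂ (Lp ℂ 2 μ)} (hb : ConjSymm b)
    (f : Lp ℝ 2 μ) (k : ι) :
    b.repr (complexify μ f) (-k) = conj (b.repr (complexify μ f) k) := by
  apply repr_conj hb
  filter_upwards [coeFn_complexify f] with x hx
  simp [hx]

theorem tsum_enorm_sq_repr_lt_top (b : HilbertBasis ι ℂ (Lp ℂ 2 μ)) (f : Lp ℂ 2 μ) :
    ∑' k, ‖b.repr f k‖ₑ ^ 2 < ∞ := by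
  have h := (b.repr f).2
  have h2 : Summable fun k => ‖b.repr f k‖ ^ 2 := by
    have := (memℓp_gen_iff (by norm_num : (0 : ℝ) < (2 : ℝ≥0∞).toReal)).1 h
    simpa using this
  have h3 : ∀ k, ‖b.repr f k‖ₑ ^ 2 = ENNReal.ofReal (‖b.repr f k‖ ^ 2) := by
    intro k
    rw [ENNReal.ofReal_pow (norm_nonneg _), ofReal_norm]
  simp_rw [h3]
  exact lt_top_iff_ne_top.2 h2.tsum_ofReal_ne_top

theorem memℓp_two_of_tsum_lt_top {c : ι → ℂ} (hc : ∑' k, ‖c k‖ₑ ^ 2 < ∞) : Memℓp c 2 := by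
  apply memℓp_gen
  have h : Summable fun k => (‖c k‖ₑ ^ 2).toReal := ENNReal.summable_toReal hc.ne
  simpa using h

/-- A measurable family of Hermitian square summable sequences is the family of coefficients of a
measurable family of real functions. -/
theorem exists_stronglyMeasurable_repr_eq [InvolutiveNeg ι] [Countable ι]
    {b : HilbertBasis ι ℂ (Lp ℂ 2 μ)}
    (hb : ConjSymm b) {c : ℝ → ι → ℂ} (hcont : ∀ k, Continuous fun t => c t k)
    (hc : ∀ t, ∑' k, ‖c t k‖ₑ ^ 2 < ∞) (hconj : ∀ t k, c t (-k) = conj (c t k)) :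
    ∃ f : ℝ → Lp ℝ 2 μ, StronglyMeasurable f ∧ ∀ t k, b.repr (complexify μ (f t)) k = c t k := by
  let C : ℝ → lp (fun _ : ι => ℂ) 2 := fun t => ⟨c t, memℓp_two_of_tsum_lt_top (hc t)⟩
  let F : ℝ → Lp ℂ 2 μ := fun t => b.repr.symm (C t)
  let R : Lp ℂ 2 μ →L[ℝ] Lp ℝ 2 μ := Complex.reCLM.compLpL 2 μ
  let S : Lp ℂ 2 μ →L[ℝ] Lp ℂ 2 μ := (Complex.conjCLE : ℂ →L[ℝ] ℂ).compLpL 2 μ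
  -- Finite Fourier sums are continuous in t and converge pointwise along the finite sets of
  -- indices. Countability of `ι` makes this directed limit measurable.
  have hF : StronglyMeasurable F := by
    refine stronglyMeasurable_of_tendsto (u := Filter.atTop)
      (f := fun (s : Finset ι) t => ∑ k ∈ s, c t k • (b k : Lp ℂ 2 μ)) (fun s => ?_) ?_
    · apply Continuous.stronglyMeasurable
      exact continuous_finsetSum _ fun k _ => (hcont k).smul continuous_const
    · rw [tendsto_pi_nhds]
      exact fun t => b.hasSum_repr_symm (C t)
  -- Hermitian coefficients mean that the function is fixed by conjugation, so taking its real part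
  -- loses nothing.
  have hS : ∀ t, S (F t) = F t := by
    intro t
    apply b.repr.injective
    ext k
    have h1 := repr_conj hb (f := S (F t)) (g := F t)
      (by simpa using ContinuousLinearMap.coeFn_compLpL (Complex.conjCLE : ℂ →L[ℝ] ℂ) (F t)) (-k)
    rw [neg_neg] at h1
    rw [h1]
    have h2 : ∀ j, b.repr (F t) j = c t j := fun j => by
      simp [F, C]
    rw [h2, h2, hconj, Complex.conj_conj]
  refine ⟨fun t => R (F t), R.continuous.comp_stronglyMeasurable hF, fun t k => ?_⟩
  have h3 : complexify μ (R (F t)) = F t := by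
    apply Lp.ext
    have h4 := ContinuousLinearMap.coeFn_compLpL (Complex.conjCLE : ℂ →L[ℝ] ℂ) (F t)
    filter_upwards [coeFn_complexify (R (F t)), Complex.reCLM.coeFn_compLpL (F t), h4]
      with x hx1 hx2 hx3
    rw [hx1]
    change ((Complex.reCLM.compLpL 2 μ (F t) x : ℝ) : ℂ) = _
    rw [hx2]
    change S (F t) x = _ at hx3
    rw [hS] at hx3
    exact (Complex.conj_eq_iff_re.1 (by simpa using hx3.symm))
  simp only [h3]
  simp [F, C]

end RealFourier

/-! ### The Fourier basis of the two-torus -/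

section Torus

variable {l : ℝ}

/-- The normalised Lebesgue measure of the two-torus. -/
abbrev haar2 (l : ℝ) [Fact (0 < l)] : Measure (AddCircle l × AddCircle l) :=
  (AddCircle.haarAddCircle : Measure (AddCircle l)).prod
    (AddCircle.haarAddCircle : Measure (AddCircle l))

/-- The exponential monomials on the two-torus. -/
def fourier2 (k : ℤ × ℤ) : C(AddCircle l × AddCircle l, ℂ) where
  toFun p := fourier k.1 p.1 * fourier k.2 p.2
  continuous_toFun := by fun_prop

theorem fourier2_apply (k : ℤ × ℤ) (p : AddCircle l × AddCircle l) :
    fourier2 k p = fourier k.1 p.1 * fourier k.2 p.2 := rfl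

theorem fourier2_neg (k : ℤ × ℤ) (p : AddCircle l × AddCircle l) :
    fourier2 (-k) p = conj (fourier2 k p) := by
  simp [fourier2_apply]

theorem fourier2_add (j k : ℤ × ℤ) (p : AddCircle l × AddCircle l) :
    fourier2 (j + k) p = fourier2 j p * fourier2 k p := by
  simp only [fourier2_apply, Prod.fst_add, Prod.snd_add, fourier_add]
  ring

/-- The star algebra generated by the exponential monomials. -/
def fourier2Subalgebra (l : ℝ) : StarSubalgebra ℂ C(AddCircle l × AddCircle l, ℂ) where
  toSubalgebra := Algebra.adjoin ℂ (range (fourier2 (l := l)))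
  star_mem' := by
    change Algebra.adjoin ℂ (range (fourier2 (l := l))) ≤
      star (Algebra.adjoin ℂ (range (fourier2 (l := l))))
    refine Algebra.adjoin_le ?_
    rintro _ ⟨n, rfl⟩
    refine Algebra.subset_adjoin ⟨-n, ?_⟩
    ext1 x
    simp only [fourier2_neg, starRingEnd_apply, ContinuousMap.star_apply]

theorem fourier2Subalgebra_coe :
    Subalgebra.toSubmodule (fourier2Subalgebra l).toSubalgebra =
      Submodule.span ℂ (range (fourier2 (l := l))) := by
  apply Algebra.adjoin_eq_span_of_subset
  refine .trans (fun x ↦ Submonoid.closure_induction (fun _ ↦ id) ⟨0, ?_⟩ ?_) Submodule.subset_span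
  · ext z
    simp [fourier2_apply]
  · rintro _ _ _ _ ⟨m, rfl⟩ ⟨n, rfl⟩
    refine ⟨m + n, ?_⟩
    ext z
    simp [fourier2_add]

variable [hl : Fact (0 < l)]

/-- The two characters of lowest order, one in each variable, already separate points. This is the
hypothesis of Stone–Weierstrass, which gives density of the trigonometric polynomials and thereby
completeness of the basis. -/
theorem fourier2Subalgebra_separatesPoints : (fourier2Subalgebra l).SeparatesPoints := by
  intro p r hpr
  have hl0 : l ≠ 0 := hl.out.ne'
  have hmem : ∀ k, fourier2 k ∈ (fourier2Subalgebra l) := fun k => Algebra.subset_adjoin ⟨k, rfl⟩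
  by_cases h : p.1 = r.1
  · have h2 : p.2 ≠ r.2 := fun h2 => hpr (Prod.ext h h2)
    refine ⟨fourier2 (0, 1), ⟨fourier2 (0, 1), hmem _, rfl⟩, ?_⟩
    intro h3
    apply h2
    simp only [fourier2_apply, fourier_zero, one_mul, fourier_one] at h3
    exact AddCircle.injective_toCircle hl0 (Subtype.coe_injective h3)
  · refine ⟨fourier2 (1, 0), ⟨fourier2 (1, 0), hmem _, rfl⟩, ?_⟩
    intro h3
    apply h
    simp only [fourier2_apply, fourier_zero, mul_one, fourier_one] at h3
    exact AddCircle.injective_toCircle hl0 (Subtype.coe_injective h3)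

theorem span_fourier2_closure_eq_top :
    (Submodule.span ℂ (range (fourier2 (l := l)))).topologicalClosure = ⊤ := by
  rw [← fourier2Subalgebra_coe]
  exact congr_arg (Subalgebra.toSubmodule <| StarSubalgebra.toSubalgebra ·)
    (ContinuousMap.starSubalgebra_topologicalClosure_eq_top_of_separatesPoints _
      (fourier2Subalgebra_separatesPoints (l := l)))

/-- The exponential monomials as elements of `L²`. -/
abbrev fourier2Lp (k : ℤ × ℤ) : Lp ℂ 2 (haar2 l) :=
  ContinuousMap.toLp (E := ℂ) 2 (haar2 l) ℂ (fourier2 k)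

theorem span_fourier2Lp_closure_eq_top :
    (Submodule.span ℂ (range (fourier2Lp (l := l)))).topologicalClosure = ⊤ := by
  simpa only [Submodule.map_span, ContinuousLinearMap.coe_coe, ← range_comp, Function.comp_def]
    using (ContinuousMap.toLp_denseRange ℂ (haar2 l) ℂ (by simp)).topologicalClosure_map_submodule
      span_fourier2_closure_eq_top

theorem orthonormal_fourier2 : Orthonormal ℂ (fourier2Lp (l := l)) := by
  rw [orthonormal_iff_ite]
  intro m n
  have h1 := fun i j => (orthonormal_iff_ite.mp (orthonormal_fourier (T := l))) i j
  simp only [ContinuousMap.inner_toLp, ← fourier_neg, ← fourier_add] at h1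
  rw [ContinuousMap.inner_toLp]
  simp only [← fourier2_neg, ← fourier2_add]
  simp only [fourier2_apply, Prod.fst_add, Prod.snd_add, Prod.fst_neg, Prod.snd_neg]
  rw [integral_prod_mul (fun x : AddCircle l => (fourier (n.1 + -m.1) x : ℂ))
    (fun y : AddCircle l => (fourier (n.2 + -m.2) y : ℂ)), h1, h1]
  by_cases h : m = n
  · simp [h]
  · have : m.1 ≠ n.1 ∨ m.2 ≠ n.2 := by
      by_contra! h'
      exact h (Prod.ext h'.1 h'.2)
    rcases this with hne | hne <;> simp [h, hne]

/-- The Hilbert basis of exponential monomials. -/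
def fourier2Basis (l : ℝ) [Fact (0 < l)] : HilbertBasis (ℤ × ℤ) ℂ (Lp ℂ 2 (haar2 l)) :=
  HilbertBasis.mk orthonormal_fourier2 span_fourier2Lp_closure_eq_top.ge

theorem coeFn_fourier2Basis (k : ℤ × ℤ) :
    (fourier2Basis l k : AddCircle l × AddCircle l → ℂ) =ᵐ[haar2 l] fourier2 k := by
  rw [fourier2Basis, HilbertBasis.coe_mk]
  exact ContinuousMap.coeFn_toLp _ _

theorem coeFn_fourierBasis (k : ℤ) :
    (fourierBasis k : AddCircle l → ℂ) =ᵐ[AddCircle.haarAddCircle] fourier k := by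
  rw [coe_fourierBasis]
  exact coeFn_fourierLp 2 k

theorem conjSymm_fourierBasis : ConjSymm (fourierBasis (T := l)) := by
  intro k
  filter_upwards [coeFn_fourierBasis (l := l) k, coeFn_fourierBasis (l := l) (-k)] with x h1 h2
  rw [h1, h2, fourier_neg]

theorem conjSymm_fourier2Basis : ConjSymm (fourier2Basis l) := by
  intro k
  filter_upwards [coeFn_fourier2Basis (l := l) k, coeFn_fourier2Basis (l := l) (-k)] with x h1 h2
  rw [h1, h2, fourier2_neg]

theorem hat1_eq_repr (f : L2y l) (n : ℤ) :
    hat1 f n = fourierBasis.repr (complexify _ f) n := by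
  rw [fourierBasis_repr, hat1]
  rw [fourierCoeff_congr_ae (coeFn_complexify f).symm]

theorem hat2_eq_repr (f : L2xy l) (k : ℤ × ℤ) :
    hat2 f k = (fourier2Basis l).repr (complexify _ f) k := by
  rw [HilbertBasis.repr_apply_apply, L2.inner_def, hat2]
  apply integral_congr_ae
  filter_upwards [coeFn_complexify f, coeFn_fourier2Basis (l := l) k] with p h1 h2
  rw [h1, h2, RCLike.inner_apply', ← fourier2_neg]
  rfl

theorem hat1_neg (f : L2y l) (n : ℤ) : hat1 f (-n) = conj (hat1 f n) := by
  rw [hat1_eq_repr, hat1_eq_repr, repr_complexify_neg conjSymm_fourierBasis]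

theorem hat2_neg (f : L2xy l) (k : ℤ × ℤ) : hat2 f (-k) = conj (hat2 f k) := by
  rw [hat2_eq_repr, hat2_eq_repr, repr_complexify_neg conjSymm_fourier2Basis]

theorem hat1_injective {f g : L2y l} (h : ∀ n, hat1 f n = hat1 g n) : f = g := by
  apply complexify_injective
  apply fourierBasis.repr.injective
  ext n
  rw [← hat1_eq_repr, ← hat1_eq_repr, h]

theorem hat2_injective {f g : L2xy l} (h : ∀ k, hat2 f k = hat2 g k) : f = g := by
  apply complexify_injective
  apply (fourier2Basis l).repr.injective
  ext n
  rw [← hat2_eq_repr, ← hat2_eq_repr, h]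

theorem tsum_enorm_sq_hat2_lt_top (f : L2xy l) : ∑' k, ‖hat2 f k‖ₑ ^ 2 < ∞ := by
  simp_rw [hat2_eq_repr]
  exact tsum_enorm_sq_repr_lt_top _ _

theorem continuous_hat1 (n : ℤ) : Continuous fun f : L2y l => hat1 f n := by
  simp_rw [hat1_eq_repr, HilbertBasis.repr_apply_apply]
  exact continuous_const.inner (complexify _).continuous

theorem continuous_hat2 (k : ℤ × ℤ) : Continuous fun f : L2xy l => hat2 f k := by
  simp_rw [hat2_eq_repr, HilbertBasis.repr_apply_apply]
  exact continuous_const.inner (complexify _).continuous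

end Torus

/-! ### Sums over the frequency lattice with values in `[0, ∞]` -/

section Sums

/-- The Cauchy–Schwarz inequality for sums in `[0, ∞]`. -/
theorem sq_tsum_mul_le {ι : Type*} (f g : ι → ℝ≥0∞) :
    (∑' i, f i * g i) ^ 2 ≤ (∑' i, f i ^ 2) * ∑' i, g i ^ 2 := by
  have h : ∑' i, f i * g i ≤ ((∑' i, f i ^ 2) * ∑' i, g i ^ 2) ^ (1 / 2 : ℝ) := by
    rw [ENNReal.tsum_eq_iSup_sum]
    refine iSup_le fun s => ?_
    refine (ENNReal.inner_le_Lp_mul_Lq s f g (Real.HolderConjugate.two_two)).trans ?_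
    rw [ENNReal.mul_rpow_of_nonneg _ _ (by norm_num)]
    gcongr <;> simp only [ENNReal.rpow_two] <;> exact ENNReal.sum_le_tsum s
  calc (∑' i, f i * g i) ^ 2
      ≤ (((∑' i, f i ^ 2) * ∑' i, g i ^ 2) ^ (1 / 2 : ℝ)) ^ 2 := by gcongr
    _ = _ := by rw [← ENNReal.rpow_natCast, ← ENNReal.rpow_mul]; norm_num

theorem enorm_add_sq_le (a b : ℝ≥0∞) : (a + b) ^ 2 ≤ 2 * (a ^ 2 + b ^ 2) := by
  have h := ENNReal.rpow_add_le_mul_rpow_add_rpow a b (one_le_two)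
  norm_num at h
  exact h

theorem rpow_neg_anti {x y : ℝ≥0∞} {a : ℝ} (ha : 0 ≤ a) (h : x ≤ y) : y ^ (-a) ≤ x ^ (-a) := by
  rw [ENNReal.rpow_neg, ENNReal.rpow_neg, ENNReal.inv_le_inv]
  gcongr

/-- Products of negative powers are bounded by sums. -/
theorem rpow_neg_mul_rpow_neg_le {x y : ℝ≥0∞} (hx : x ≠ 0) (hy : y ≠ 0) (hx' : x ≠ ∞)
    (hy' : y ≠ ∞) {a b : ℝ} (ha : 0 ≤ a) (hb : 0 ≤ b) :
    x ^ (-a) * y ^ (-b) ≤ x ^ (-(a + b)) + y ^ (-(a + b)) := by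
  rcases le_total x y with h | h
  · refine le_trans ?_ le_self_add
    rw [neg_add, ENNReal.rpow_add _ _ hx hx']
    gcongr x ^ (-a) * ?_
    exact rpow_neg_anti (by assumption) h
  · refine le_trans ?_ le_add_self
    rw [neg_add, ENNReal.rpow_add _ _ hy hy']
    gcongr ?_ * y ^ (-b)
    exact rpow_neg_anti (by assumption) h

end Sums

/-! ### Lattice weights and weighted convolution sums -/

section Weights

variable (l : ℝ)

/-- The weight `1 + κ²` in one dimension. -/
def wt1 (n : ℤ) : ℝ≥0∞ := ENNReal.ofReal (1 + freq l n ^ 2)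

/-- The weight `1 + |κ|²` in two dimensions. -/
def wt2 (k : ℤ × ℤ) : ℝ≥0∞ := ENNReal.ofReal (1 + freqSq l k)

theorem freqSq_nonneg (k : ℤ × ℤ) : 0 ≤ freqSq l k := by unfold freqSq; positivity

theorem freq_zero : freq l 0 = 0 := by simp [freq]

theorem freq_neg (n : ℤ) : freq l (-n) = -freq l n := by simp [freq, neg_div]

theorem freq_sub (m n : ℤ) : freq l (m - n) = freq l m - freq l n := by
  simp only [freq, Int.cast_sub]; ring

theorem freqSq_zonal (n : ℤ) : freqSq l (0, n) = freq l n ^ 2 := by simp [freqSq, freq_zero]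

theorem wt2_zonal (n : ℤ) : wt2 l (0, n) = wt1 l n := by simp [wt1, wt2, freqSq_zonal]

theorem one_le_wt1 (n : ℤ) : 1 ≤ wt1 l n := by
  rw [wt1, ENNReal.one_le_ofReal]; nlinarith [sq_nonneg (freq l n)]

theorem one_le_wt2 (k : ℤ × ℤ) : 1 ≤ wt2 l k := by
  rw [wt2, ENNReal.one_le_ofReal]; linarith [freqSq_nonneg l k]

theorem wt1_ne_zero (n : ℤ) : wt1 l n ≠ 0 := (zero_lt_one.trans_le (one_le_wt1 l n)).ne'

theorem wt2_ne_zero (k : ℤ × ℤ) : wt2 l k ≠ 0 := (zero_lt_one.trans_le (one_le_wt2 l k)).ne'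

theorem wt1_ne_top (n : ℤ) : wt1 l n ≠ ∞ := ENNReal.ofReal_ne_top

theorem wt2_ne_top (k : ℤ × ℤ) : wt2 l k ≠ ∞ := ENNReal.ofReal_ne_top

theorem wt1_fst_le (k : ℤ × ℤ) : wt1 l k.1 ≤ wt2 l k := by
  apply ENNReal.ofReal_le_ofReal
  rw [freqSq]; nlinarith [sq_nonneg (freq l k.2)]

theorem wt1_snd_le (k : ℤ × ℤ) : wt1 l k.2 ≤ wt2 l k := by
  apply ENNReal.ofReal_le_ofReal
  rw [freqSq]; nlinarith [sq_nonneg (freq l k.1)]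

theorem wt2_neg (k : ℤ × ℤ) : wt2 l (-k) = wt2 l k := by
  simp [wt2, freqSq, freq_neg]

theorem wt2_rpow_add (k : ℤ × ℤ) (a b : ℝ) : wt2 l k ^ (a + b) = wt2 l k ^ a * wt2 l k ^ b :=
  ENNReal.rpow_add _ _ (wt2_ne_zero l k) (wt2_ne_top l k)

theorem wt1_rpow_add (n : ℤ) (a b : ℝ) : wt1 l n ^ (a + b) = wt1 l n ^ a * wt1 l n ^ b :=
  ENNReal.rpow_add _ _ (wt1_ne_zero l n) (wt1_ne_top l n)

theorem freqSq_le_two_mul (k h : ℤ × ℤ) :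
    freqSq l k ≤ 2 * (freqSq l h + freqSq l (k - h)) := by
  simp only [freqSq, Prod.fst_sub, Prod.snd_sub, freq_sub]
  nlinarith [sq_nonneg (2 * freq l h.1 - freq l k.1), sq_nonneg (2 * freq l h.2 - freq l k.2)]

theorem wt2_le_two_mul_add (k h : ℤ × ℤ) : wt2 l k ≤ 2 * (wt2 l h + wt2 l (k - h)) := by
  have h2 : (2 : ℝ≥0∞) = ENNReal.ofReal 2 := by simp
  have a := freqSq_nonneg l h
  have b := freqSq_nonneg l (k - h)
  rw [wt2, wt2, wt2, h2, ← ENNReal.ofReal_add (by linarith) (by linarith),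
    ← ENNReal.ofReal_mul (by norm_num)]
  apply ENNReal.ofReal_le_ofReal
  linarith [freqSq_le_two_mul l k h]

/-- Peetre's inequality. Decay in `m + h` and in `h` can be traded for decay in `m`, which is how a
convolution passes decay on to its second factor. -/
theorem wt2_le_two_mul_mul (m h : ℤ × ℤ) : wt2 l m ≤ 2 * (wt2 l (m + h) * wt2 l h) := by
  have h2 : (2 : ℝ≥0∞) = ENNReal.ofReal 2 := by simp
  have a := freqSq_nonneg l h
  have b := freqSq_nonneg l (m + h)
  rw [wt2, wt2, wt2, h2, ← ENNReal.ofReal_mul (by linarith), ← ENNReal.ofReal_mul (by norm_num)]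
  apply ENNReal.ofReal_le_ofReal
  have c := freqSq_le_two_mul l m (m + h)
  have d : freqSq l (m - (m + h)) = freqSq l h := by
    simp [freqSq, freq_neg]
  rw [d] at c
  nlinarith [mul_nonneg a b]

/-- One of the two interacting frequencies carries at least a quarter of the weight of their sum.
This replaces the Leibniz rule for fractional derivatives. -/
theorem wt2_rpow_le (k h : ℤ × ℤ) {r : ℝ} (hr : 0 ≤ r) :
    wt2 l k ^ r ≤ 4 ^ r * (wt2 l h ^ r + wt2 l (k - h) ^ r) := by
  have h1 := wt2_le_two_mul_add l k h
  rcases le_total (wt2 l h) (wt2 l (k - h)) with hle | hle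
  · have h3 : wt2 l k ≤ 4 * wt2 l (k - h) := by
      refine h1.trans ?_
      calc 2 * (wt2 l h + wt2 l (k - h)) ≤ 2 * (wt2 l (k - h) + wt2 l (k - h)) := by gcongr
        _ = _ := by ring
    calc wt2 l k ^ r ≤ (4 * wt2 l (k - h)) ^ r := by gcongr
      _ = 4 ^ r * wt2 l (k - h) ^ r := ENNReal.mul_rpow_of_nonneg _ _ hr
      _ ≤ _ := by gcongr; exact le_add_self
  · have h3 : wt2 l k ≤ 4 * wt2 l h := by
      refine h1.trans ?_
      calc 2 * (wt2 l h + wt2 l (k - h)) ≤ 2 * (wt2 l h + wt2 l h) := by gcongr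
        _ = _ := by ring
    calc wt2 l k ^ r ≤ (4 * wt2 l h) ^ r := by gcongr
      _ = 4 ^ r * wt2 l h ^ r := ENNReal.mul_rpow_of_nonneg _ _ hr
      _ ≤ _ := by gcongr; exact le_self_add

theorem wt2_rpow_neg_le (k : ℤ × ℤ) {a b : ℝ} (ha : 0 ≤ a) (hb : 0 ≤ b) :
    wt2 l k ^ (-(a + b)) ≤ wt1 l k.1 ^ (-a) * wt1 l k.2 ^ (-b) := by
  rw [neg_add, wt2_rpow_add]
  gcongr ?_ * ?_
  · exact rpow_neg_anti (by assumption) (wt1_fst_le l k)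
  · exact rpow_neg_anti (by assumption) (wt1_snd_le l k)

/-- The lattice sums `∑ (1 + κ²)^(-p)`. -/
def sum1 (p : ℝ) : ℝ≥0∞ := ∑' n, wt1 l n ^ (-p)

/-- The lattice sums `∑ (1 + |κ|²)^(-p)`. -/
def sum2 (p : ℝ) : ℝ≥0∞ := ∑' k, wt2 l k ^ (-p)

variable {l}

theorem sum1_lt_top (hl : 0 < l) {p : ℝ} (hp : 1 / 2 < p) : sum1 l p < ∞ := by
  have hs : Summable fun n : ℤ => (1 + freq l n ^ 2) ^ (-p) := by
    have hc : 0 < 2 * Real.pi / l := by positivity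
    have h1 := (Real.summable_abs_int_rpow (b := 2 * p) (by linarith)).mul_left
      ((2 * Real.pi / l) ^ (-(2 * p)))
    refine Summable.of_norm_bounded_eventually h1 ?_
    have h0 : ∀ᶠ n : ℤ in Filter.cofinite, n ≠ 0 := by
      simpa using (Set.finite_singleton (0 : ℤ)).compl_mem_cofinite
    filter_upwards [h0] with n hn
    have hn' : 0 < |(n : ℝ)| := abs_pos.2 (by exact_mod_cast hn)
    rw [Real.norm_of_nonneg (by positivity), ← Real.mul_rpow hc.le hn'.le]
    have h3 : (2 * Real.pi / l * |(n : ℝ)|) ^ (-(2 * p)) =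
        ((2 * Real.pi / l * |(n : ℝ)|) ^ 2) ^ (-p) := by
      rw [← Real.rpow_natCast, ← Real.rpow_mul (by positivity)]
      congr 1; push_cast; ring
    rw [h3]
    apply Real.rpow_le_rpow_of_nonpos (by positivity) _ (by linarith)
    have : freq l n ^ 2 = (2 * Real.pi / l * |(n : ℝ)|) ^ 2 := by
      rw [mul_pow, sq_abs, ← mul_pow]; congr 1; rw [freq]; ring
    linarith
  have h : ∀ n, wt1 l n ^ (-p) = ENNReal.ofReal ((1 + freq l n ^ 2) ^ (-p)) := by
    intro n
    rw [wt1, ENNReal.ofReal_rpow_of_pos (by positivity)]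
  simp_rw [sum1, h]
  exact lt_top_iff_ne_top.2 hs.tsum_ofReal_ne_top

theorem tsum_mul_prod (f g : ℤ → ℝ≥0∞) :
    ∑' k : ℤ × ℤ, f k.1 * g k.2 = (∑' n, f n) * ∑' n, g n := by
  rw [ENNReal.tsum_prod (f := fun a b => f a * g b)]
  simp_rw [ENNReal.tsum_mul_left, ENNReal.tsum_mul_right]

/-- Splitting the exponent evenly over the two coordinates reduces to the one-dimensional threshold
1/2. -/
theorem sum2_lt_top (hl : 0 < l) {p : ℝ} (hp : 1 < p) : sum2 l p < ∞ := by
  have h : sum2 l p ≤ sum1 l (p / 2) * sum1 l (p / 2) := by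
    rw [sum1, ← tsum_mul_prod, sum2]
    refine ENNReal.tsum_le_tsum fun k => ?_
    refine le_trans (le_of_eq ?_) (wt2_rpow_neg_le l k (a := p / 2) (b := p / 2)
      (by linarith) (by linarith))
    congr 1; ring
  have h1 := sum1_lt_top hl (p := p / 2) (by linarith)
  exact h.trans_lt (ENNReal.mul_lt_top h1 h1)

variable (l)

theorem tsum_wt2_mul_wt2_le (m : ℤ × ℤ) {a b : ℝ} (ha : 0 ≤ a) (hb : 0 ≤ b) :
    ∑' h, wt2 l (m + h) ^ (-a) * wt2 l h ^ (-b) ≤ 2 * sum2 l (a + b) := by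
  calc ∑' h, wt2 l (m + h) ^ (-a) * wt2 l h ^ (-b)
      ≤ ∑' h, (wt2 l (m + h) ^ (-(a + b)) + wt2 l h ^ (-(a + b))) :=
        ENNReal.tsum_le_tsum fun h => rpow_neg_mul_rpow_neg_le (wt2_ne_zero _ _) (wt2_ne_zero _ _)
          (wt2_ne_top _ _) (wt2_ne_top _ _) ha hb
    _ = 2 * sum2 l (a + b) := by
        have e := (Equiv.addLeft m).tsum_eq (fun h => wt2 l h ^ (-(a + b)))
        simp only [Equiv.coe_addLeft] at e
        rw [ENNReal.tsum_add, e, two_mul, sum2]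

theorem tsum_wt2_mul_wt2_sub_le (m : ℤ × ℤ) {a b : ℝ} (ha : 0 ≤ a) (hb : 0 ≤ b) :
    ∑' h, wt2 l h ^ (-a) * wt2 l (m - h) ^ (-b) ≤ 2 * sum2 l (a + b) := by
  have h1 := tsum_wt2_mul_wt2_le l (-m) hb ha
  rw [add_comm b a] at h1
  refine le_trans (le_of_eq (tsum_congr fun h => ?_)) h1
  have : -m + h = -(m - h) := by abel
  rw [this, wt2_neg, mul_comm]

/-- After exchanging the sums, 1/8 of each of the two exponents is moved to `m.1` by Peetre's
inequality. At least 3/4 + 3/4 = 3/2 > 1 remains, which is summable over the plane lattice. The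
point is that f enters only through a norm that discounts large wavenumbers in x. -/
theorem tsum_wt2_mul_conv_le (f : ℤ × ℤ → ℝ≥0∞) :
    ∑' k, wt2 l k ^ (-(7 / 8) : ℝ) * ∑' h, wt2 l h ^ (-1 : ℝ) * f (k - h) ≤
      4 * sum2 l (3 / 2) * ∑' m : ℤ × ℤ, wt1 l m.1 ^ (-(1 / 8) : ℝ) * f m := by
  have hinner : ∀ m, ∑' h, wt2 l (m + h) ^ (-(7 / 8) : ℝ) * wt2 l h ^ (-1 : ℝ) ≤
      4 * sum2 l (3 / 2) * wt1 l m.1 ^ (-(1 / 8) : ℝ) := by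
    intro m
    have hterm : ∀ h, wt2 l (m + h) ^ (-(7 / 8) : ℝ) * wt2 l h ^ (-1 : ℝ) ≤
        2 * wt1 l m.1 ^ (-(1 / 8) : ℝ) *
          (wt2 l (m + h) ^ (-(3 / 4) : ℝ) * wt2 l h ^ (-(3 / 4) : ℝ)) := by
      intro h
      have e1 : wt2 l (m + h) ^ (-(7 / 8) : ℝ) =
          wt2 l (m + h) ^ (-(1 / 8) : ℝ) * wt2 l (m + h) ^ (-(3 / 4) : ℝ) := by
        rw [← wt2_rpow_add]; norm_num
      have e2 : wt2 l h ^ (-1 : ℝ) ≤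
          wt2 l h ^ (-(1 / 8) : ℝ) * wt2 l h ^ (-(3 / 4) : ℝ) := by
        rw [← wt2_rpow_add]
        exact ENNReal.rpow_le_rpow_of_exponent_le (one_le_wt2 l h) (by norm_num)
      have e3 : wt2 l (m + h) ^ (-(1 / 8) : ℝ) * wt2 l h ^ (-(1 / 8) : ℝ) ≤
          2 * wt1 l m.1 ^ (-(1 / 8) : ℝ) := by
        have e4 : wt1 l m.1 ^ (1 / 8 : ℝ) ≤
            2 * (wt2 l (m + h) ^ (1 / 8 : ℝ) * wt2 l h ^ (1 / 8 : ℝ)) := by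
          calc wt1 l m.1 ^ (1 / 8 : ℝ) ≤ (2 * (wt2 l (m + h) * wt2 l h)) ^ (1 / 8 : ℝ) := by
                gcongr
                exact (wt1_fst_le l m).trans (wt2_le_two_mul_mul l m h)
            _ = 2 ^ (1 / 8 : ℝ) * (wt2 l (m + h) ^ (1 / 8 : ℝ) * wt2 l h ^ (1 / 8 : ℝ)) := by
                rw [ENNReal.mul_rpow_of_nonneg _ _ (by norm_num),
                  ENNReal.mul_rpow_of_nonneg _ _ (by norm_num)]
            _ ≤ _ := by
                gcongr
                calc (2 : ℝ≥0∞) ^ (1 / 8 : ℝ) ≤ 2 ^ (1 : ℝ) :=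
                      ENNReal.rpow_le_rpow_of_exponent_le (by norm_num) (by norm_num)
                  _ = 2 := by simp
        have e5 : wt1 l m.1 ^ (1 / 8 : ℝ) * wt1 l m.1 ^ (-(1 / 8) : ℝ) = 1 := by
          rw [← wt1_rpow_add]; norm_num
        have e6 : wt2 l h ^ (1 / 8 : ℝ) * wt2 l h ^ (-(1 / 8) : ℝ) = 1 := by
          rw [← wt2_rpow_add]; norm_num
        have e7 : wt2 l (m + h) ^ (1 / 8 : ℝ) * wt2 l (m + h) ^ (-(1 / 8) : ℝ) = 1 := by
          rw [← wt2_rpow_add]; norm_num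
        calc wt2 l (m + h) ^ (-(1 / 8) : ℝ) * wt2 l h ^ (-(1 / 8) : ℝ)
            = (wt1 l m.1 ^ (1 / 8 : ℝ) * wt1 l m.1 ^ (-(1 / 8) : ℝ)) *
              (wt2 l (m + h) ^ (-(1 / 8) : ℝ) * wt2 l h ^ (-(1 / 8) : ℝ)) := by rw [e5, one_mul]
          _ ≤ ((2 * (wt2 l (m + h) ^ (1 / 8 : ℝ) * wt2 l h ^ (1 / 8 : ℝ))) *
              wt1 l m.1 ^ (-(1 / 8) : ℝ)) *
              (wt2 l (m + h) ^ (-(1 / 8) : ℝ) * wt2 l h ^ (-(1 / 8) : ℝ)) := by gcongr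
          _ = 2 * wt1 l m.1 ^ (-(1 / 8) : ℝ) *
              (wt2 l h ^ (1 / 8 : ℝ) * wt2 l h ^ (-(1 / 8) : ℝ)) *
              (wt2 l (m + h) ^ (1 / 8 : ℝ) * wt2 l (m + h) ^ (-(1 / 8) : ℝ)) := by ring
          _ = _ := by rw [e6, e7, mul_one, mul_one]
      calc wt2 l (m + h) ^ (-(7 / 8) : ℝ) * wt2 l h ^ (-1 : ℝ)
          ≤ (wt2 l (m + h) ^ (-(1 / 8) : ℝ) * wt2 l (m + h) ^ (-(3 / 4) : ℝ)) *
            (wt2 l h ^ (-(1 / 8) : ℝ) * wt2 l h ^ (-(3 / 4) : ℝ)) := by rw [e1]; gcongr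
        _ = (wt2 l (m + h) ^ (-(1 / 8) : ℝ) * wt2 l h ^ (-(1 / 8) : ℝ)) *
            (wt2 l (m + h) ^ (-(3 / 4) : ℝ) * wt2 l h ^ (-(3 / 4) : ℝ)) := by ring
        _ ≤ _ := by gcongr
    refine (ENNReal.tsum_le_tsum hterm).trans ?_
    rw [ENNReal.tsum_mul_left]
    calc _ ≤ 2 * wt1 l m.1 ^ (-(1 / 8) : ℝ) * (2 * sum2 l (3 / 4 + 3 / 4)) := by
          gcongr
          exact tsum_wt2_mul_wt2_le l m (by norm_num) (by norm_num)
      _ = _ := by norm_num; ring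
  calc ∑' k, wt2 l k ^ (-(7 / 8) : ℝ) * ∑' h, wt2 l h ^ (-1 : ℝ) * f (k - h)
      = ∑' h, ∑' k, wt2 l k ^ (-(7 / 8) : ℝ) * (wt2 l h ^ (-1 : ℝ) * f (k - h)) := by
        simp_rw [← ENNReal.tsum_mul_left]
        rw [ENNReal.tsum_comm]
    _ = ∑' h, ∑' m, wt2 l (m + h) ^ (-(7 / 8) : ℝ) * (wt2 l h ^ (-1 : ℝ) * f m) := by
        refine tsum_congr fun h => ?_
        rw [← (Equiv.addRight h).tsum_eq]
        simp
    _ = ∑' m, f m * ∑' h, wt2 l (m + h) ^ (-(7 / 8) : ℝ) * wt2 l h ^ (-1 : ℝ) := by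
        rw [ENNReal.tsum_comm]
        refine tsum_congr fun m => ?_
        rw [← ENNReal.tsum_mul_left]
        exact tsum_congr fun h => by ring
    _ ≤ ∑' m, f m * (4 * sum2 l (3 / 2) * wt1 l m.1 ^ (-(1 / 8) : ℝ)) := by
        gcongr with m
        exact hinner m
    _ = _ := by
        rw [← ENNReal.tsum_mul_left]
        exact tsum_congr fun m => by ring

/-- The fibre sum depends on `k.1` only. So 3/4 of the exponent is spent on summing over `k.2` and
the other 1/8 stays on `k.1`. -/
theorem tsum_wt2_mul_fiber_le (f : ℤ × ℤ → ℝ≥0∞) :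
    ∑' k : ℤ × ℤ, wt2 l k ^ (-(7 / 8) : ℝ) * ∑' n, f (k.1, n) ≤
      sum1 l (3 / 4) * ∑' m : ℤ × ℤ, wt1 l m.1 ^ (-(1 / 8) : ℝ) * f m := by
  calc ∑' k : ℤ × ℤ, wt2 l k ^ (-(7 / 8) : ℝ) * ∑' n, f (k.1, n)
      ≤ ∑' k : ℤ × ℤ, (wt1 l k.1 ^ (-(1 / 8) : ℝ) * ∑' n, f (k.1, n)) *
          wt1 l k.2 ^ (-(3 / 4) : ℝ) := by
        refine ENNReal.tsum_le_tsum fun k => ?_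
        have := wt2_rpow_neg_le l k (a := 1 / 8) (b := 3 / 4) (by norm_num) (by norm_num)
        norm_num at this ⊢
        calc _ ≤ (wt1 l k.1 ^ (-(1 / 8) : ℝ) * wt1 l k.2 ^ (-(3 / 4) : ℝ)) * ∑' n, f (k.1, n) := by
              gcongr
          _ = _ := by ring
    _ = (∑' j, wt1 l j ^ (-(1 / 8) : ℝ) * ∑' n, f (j, n)) * sum1 l (3 / 4) := by
        rw [tsum_mul_prod (fun j => wt1 l j ^ (-(1 / 8) : ℝ) * ∑' n, f (j, n))
          (fun n => wt1 l n ^ (-(3 / 4) : ℝ)), sum1]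
    _ = _ := by
        rw [mul_comm]
        congr 1
        rw [ENNReal.tsum_prod (f := fun j n => wt1 l j ^ (-(1 / 8) : ℝ) * f (j, n))]
        simp_rw [ENNReal.tsum_mul_left]

end Weights

/-! ### The nonlinearity as one bilinear operator on the coefficients -/

/-- Indices of the coefficients of the pair `(u, ζ)`. -/
abbrev Mode : Type := ℤ ⊕ (ℤ × ℤ)

/-- The weight `1 + |κ|²` of a mode. -/
def wt (l : ℝ) : Mode → ℝ≥0∞ := Sum.elim (wt1 l) (wt2 l)

/-- The square of the `ℓ²` norm. -/
def l2sq (a : Mode → ℝ≥0∞) : ℝ≥0∞ := (∑' n, a (.inl n) ^ 2) + ∑' k, a (.inr k) ^ 2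

/-- Kernel of the transport term in divergence form. -/
def kerF (l : ℝ) (k h : ℤ × ℤ) : ℝ :=
  (freq l h.2 * freq l k.1 - freq l h.1 * freq l k.2) / freqSq l h

/-- Kernel of the Reynolds stress. -/
def kerG (l : ℝ) (n : ℤ) (h : ℤ × ℤ) : ℝ :=
  freq l h.1 * freq l (n - h.2) / (freqSq l h * freqSq l ((0, n) - h))

/-- The bilinear operator whose diagonal is the nonlinearity `(G, F)`. -/
def bil (l : ℝ) (z w : Mode → ℂ) : Mode → ℂ
  | .inl n => -(Complex.I * freq l n) *
      ∑' h, (kerG l n h : ℂ) * (z (.inr h) * w (.inr ((0, n) - h)))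
  | .inr k => if k.1 = 0 then 0 else
      ∑' h, (kerF l k h : ℂ) * (z (.inr h) * w (.inr (k - h))) -
        Complex.I * freq l k.1 * ∑' n, z (.inl n) * w (.inr (k - (0, n)))

/-- The majorant of `bil`, up to a constant and the square root of the weight. -/
def maj (l : ℝ) (a b : Mode → ℝ≥0∞) : Mode → ℝ≥0∞
  | .inl n => ∑' h, a (.inr h) * wt2 l h ^ (-(1 / 2) : ℝ) * b (.inr ((0, n) - h))
  | .inr k => (∑' h, a (.inr h) * wt2 l h ^ (-(1 / 2) : ℝ) * b (.inr (k - h))) +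
      ∑' n, a (.inl n) * b (.inr (k - (0, n)))

/-- The constant `1 + (l / 2π)²`, which compares `|κ|²` with `1 + |κ|²`. -/
def gapConst (l : ℝ) : ℝ := 1 + (l / (2 * Real.pi)) ^ 2

theorem one_le_gapConst (l : ℝ) : 1 ≤ gapConst l := by
  unfold gapConst; nlinarith [sq_nonneg (l / (2 * Real.pi))]

/-! ### Bounds for the interaction kernels -/

section Kernel

variable {l : ℝ}

theorem one_add_freq_sq_le (hl : 0 < l) {n : ℤ} (hn : n ≠ 0) :
    1 + freq l n ^ 2 ≤ gapConst l * freq l n ^ 2 := by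
  have h1 : (1 : ℝ) ≤ (n : ℝ) ^ 2 := by
    have : (1 : ℤ) ≤ n ^ 2 := by
      have := sq_nonneg n
      have h2 : n ^ 2 ≠ 0 := pow_ne_zero 2 hn
      omega
    exact_mod_cast this
  have h2 : (l / (2 * Real.pi)) ^ 2 * freq l n ^ 2 = (n : ℝ) ^ 2 := by
    have := Real.pi_pos
    rw [freq]; field_simp
  unfold gapConst
  nlinarith

/-- Spectral gap of the torus: a nonzero lattice frequency has length at least 2π / l. -/
theorem one_add_freqSq_le (hl : 0 < l) {k : ℤ × ℤ} (hk : k ≠ 0) :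
    1 + freqSq l k ≤ gapConst l * freqSq l k := by
  have h1 := one_le_gapConst l
  rw [freqSq]
  by_cases h : k.1 = 0
  · have h2 : k.2 ≠ 0 := fun h2 => hk (Prod.ext h h2)
    have := one_add_freq_sq_le hl h2
    nlinarith [sq_nonneg (freq l k.1)]
  · have := one_add_freq_sq_le hl h
    nlinarith [sq_nonneg (freq l k.2)]

theorem freqSq_pos (hl : 0 < l) {k : ℤ × ℤ} (hk : k ≠ 0) : 0 < freqSq l k := by
  have h := one_add_freqSq_le hl hk
  have h1 := one_le_gapConst l
  have h2 := freqSq_nonneg l k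
  rcases h2.eq_or_lt with h3 | h3
  · rw [← h3] at h; linarith
  · exact h3

theorem freqSq_zero : freqSq l 0 = 0 := by simp [freqSq, freq_zero]

theorem enorm_ofReal_le_wt2 {x : ℝ} {c : ℝ} (hc : 0 ≤ c) {k h : ℤ × ℤ}
    (hx : x ^ 2 * (1 + freqSq l h) ≤ c ^ 2 * (1 + freqSq l k)) :
    ‖(x : ℂ)‖ₑ ≤ ENNReal.ofReal c * wt2 l k ^ (1 / 2 : ℝ) * wt2 l h ^ (-(1 / 2) : ℝ) := by
  have hk := freqSq_nonneg l k
  have hh := freqSq_nonneg l h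
  have hk' : 0 < 1 + freqSq l k := by linarith
  have hh' : 0 < 1 + freqSq l h := by linarith
  rw [wt2, wt2, ENNReal.ofReal_rpow_of_pos hk', ENNReal.ofReal_rpow_of_pos hh',
    ← ENNReal.ofReal_mul hc, ← ENNReal.ofReal_mul (by positivity), ← ofReal_norm,
    Complex.norm_real, Real.norm_eq_abs]
  apply ENNReal.ofReal_le_ofReal
  apply abs_le_of_sq_le_sq _ (by positivity)
  have e1 : ((1 + freqSq l k) ^ (1 / 2 : ℝ)) ^ 2 = 1 + freqSq l k := by
    rw [← Real.rpow_natCast, ← Real.rpow_mul hk'.le]; norm_num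
  have e2 : ((1 + freqSq l h) ^ (-(1 / 2) : ℝ)) ^ 2 = (1 + freqSq l h)⁻¹ := by
    rw [← Real.rpow_natCast, ← Real.rpow_mul hh'.le]; norm_num [Real.rpow_neg_one]
  rw [mul_pow, mul_pow, e1, e2, ← div_eq_mul_inv, le_div_iff₀ hh']
  exact hx

/-- The numerator is the cross product of the frequencies of h and k, hence at most the product of
their lengths. Division by |κ_h|² leaves |κ_k| / |κ_h|: one derivative on the output, one derivative
gained on the first factor. -/
theorem enorm_kerF_le (hl : 0 < l) (k h : ℤ × ℤ) :
    ‖(kerF l k h : ℂ)‖ₑ ≤ ENNReal.ofReal (gapConst l ^ 2) * wt2 l k ^ (1 / 2 : ℝ) *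
      wt2 l h ^ (-(1 / 2) : ℝ) := by
  have hg := one_le_gapConst l
  apply enorm_ofReal_le_wt2 (by positivity)
  have hk := freqSq_nonneg l k
  -- At h = 0 the convention x / 0 = 0 makes the kernel vanish, in agreement with the multiplier of
  -- ∇⁻² at the zero mode.
  by_cases h0 : h = 0
  · subst h0
    simp only [kerF, freqSq_zero, div_zero]
    have : 0 ≤ (gapConst l ^ 2) ^ 2 * (1 + freqSq l k) := by positivity
    simpa using this
  have hp := freqSq_pos hl h0
  have h1 := one_add_freqSq_le hl h0
  rw [kerF, div_pow, div_mul_eq_mul_div, div_le_iff₀ (by positivity)]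
  have h2 : (freq l h.2 * freq l k.1 - freq l h.1 * freq l k.2) ^ 2 ≤
      freqSq l h * freqSq l k := by
    unfold freqSq
    nlinarith [sq_nonneg (freq l h.2 * freq l k.2 + freq l h.1 * freq l k.1)]
  calc (freq l h.2 * freq l k.1 - freq l h.1 * freq l k.2) ^ 2 * (1 + freqSq l h)
      ≤ (freqSq l h * freqSq l k) * (gapConst l * freqSq l h) := by gcongr
    _ = gapConst l * (freqSq l k * freqSq l h ^ 2) := by ring
    _ ≤ gapConst l ^ 4 * ((1 + freqSq l k) * freqSq l h ^ 2) := by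
        gcongr
        · exact le_self_pow₀ hg (by norm_num)
        · linarith
    _ = _ := by ring

/-- Both velocity factors are one derivative smoother than ζ, but only the gain at h is kept. At the
other frequency, boundedness is enough. -/
theorem enorm_kerG_le (hl : 0 < l) (n : ℤ) (h : ℤ × ℤ) :
    ‖(kerG l n h : ℂ)‖ₑ ≤ ENNReal.ofReal (gapConst l ^ 2) * wt2 l h ^ (-(1 / 2) : ℝ) := by
  have hg := one_le_gapConst l
  have key := enorm_ofReal_le_wt2 (l := l) (x := kerG l n h) (c := gapConst l ^ 2)
    (by positivity) (k := 0) (h := h)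
  have hw : wt2 l 0 = 1 := by simp [wt2, freqSq_zero]
  rw [hw, ENNReal.one_rpow, mul_one] at key
  apply key
  rw [freqSq_zero]
  by_cases h0 : h = 0
  · subst h0
    simp only [kerG, freqSq_zero, zero_mul, div_zero]
    simp; positivity
  by_cases hm : (0, n) - h = 0
  · simp only [kerG, hm, freqSq_zero, mul_zero, div_zero]
    simp; positivity
  have hp := freqSq_pos hl h0
  have h1 := one_add_freqSq_le hl h0
  have hp' := freqSq_pos hl hm
  have h1' := one_add_freqSq_le hl hm
  have e1 : freq l h.1 ^ 2 ≤ freqSq l h := by unfold freqSq; nlinarith [sq_nonneg (freq l h.2)]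
  have e2 : freq l (n - h.2) ^ 2 ≤ freqSq l ((0, n) - h) := by
    unfold freqSq; simp only [Prod.snd_sub]; nlinarith [sq_nonneg (freq l (((0, n) - h).1))]
  rw [kerG, div_pow, div_mul_eq_mul_div, div_le_iff₀ (by positivity)]
  set f := freqSq l h
  set g := freqSq l ((0, n) - h)
  have e3 : 1 ≤ gapConst l * g := by linarith
  calc (freq l h.1 * freq l (n - h.2)) ^ 2 * (1 + f)
      = freq l h.1 ^ 2 * freq l (n - h.2) ^ 2 * (1 + f) := by ring
    _ ≤ f * g * (gapConst l * f) := by gcongr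
    _ = gapConst l * f ^ 2 * g * 1 := by ring
    _ ≤ gapConst l * f ^ 2 * g * (gapConst l * g) := by gcongr
    _ = gapConst l ^ 2 * (f * g) ^ 2 := by ring
    _ ≤ gapConst l ^ 4 * (f * g) ^ 2 := by gcongr; norm_num
    _ = _ := by ring

theorem enorm_freq_le (n : ℤ) : ‖Complex.I * (freq l n : ℂ)‖ₑ ≤ wt1 l n ^ (1 / 2 : ℝ) := by
  rw [enorm_mul]
  have h1 : ‖Complex.I‖ₑ = 1 := by simp [← ofReal_norm]
  rw [h1, one_mul, wt1, ENNReal.ofReal_rpow_of_pos (by positivity), ← ofReal_norm,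
    Complex.norm_real, Real.norm_eq_abs]
  apply ENNReal.ofReal_le_ofReal
  rw [← Real.sqrt_eq_rpow]
  apply Real.abs_le_sqrt
  linarith

/-- The constant in the bilinear estimate. -/
def bilConst (l : ℝ) : ℝ≥0∞ := ENNReal.ofReal (gapConst l ^ 2)

theorem one_le_bilConst (l : ℝ) : 1 ≤ bilConst l := by
  rw [bilConst, ENNReal.one_le_ofReal]
  exact one_le_pow₀ (one_le_gapConst l)

theorem bilConst_ne_top (l : ℝ) : bilConst l ≠ ∞ := ENNReal.ofReal_ne_top

theorem enorm_bil_le (hl : 0 < l) (z w : Mode → ℂ) (i : Mode) :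
    ‖bil l z w i‖ₑ ≤ bilConst l * wt l i ^ (1 / 2 : ℝ) *
      maj l (fun j => ‖z j‖ₑ) (fun j => ‖w j‖ₑ) i := by
  rcases i with n | k
  · simp only [bil, wt, maj, Sum.elim_inl]
    rw [enorm_mul, enorm_neg]
    calc _ ≤ wt1 l n ^ (1 / 2 : ℝ) *
          ∑' h, ‖(kerG l n h : ℂ) * (z (.inr h) * w (.inr ((0, n) - h)))‖ₑ := by
          gcongr
          · exact enorm_freq_le n
          · exact enorm_tsum_le_tsum_enorm
      _ ≤ wt1 l n ^ (1 / 2 : ℝ) * ∑' h, bilConst l *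
          (‖z (.inr h)‖ₑ * wt2 l h ^ (-(1 / 2) : ℝ) * ‖w (.inr ((0, n) - h))‖ₑ) := by
          gcongr with h
          rw [enorm_mul, enorm_mul]
          calc _ ≤ (bilConst l * wt2 l h ^ (-(1 / 2) : ℝ)) *
                (‖z (.inr h)‖ₑ * ‖w (.inr ((0, n) - h))‖ₑ) := by
                gcongr; exact enorm_kerG_le hl n h
            _ = _ := by ring
      _ = _ := by rw [ENNReal.tsum_mul_left]; ring
  · simp only [bil, wt, maj, Sum.elim_inr]
    split_ifs with hk
    · simp
    calc _ ≤ ‖∑' h, (kerF l k h : ℂ) * (z (.inr h) * w (.inr (k - h)))‖ₑ +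
          ‖Complex.I * freq l k.1 * ∑' n, z (.inl n) * w (.inr (k - (0, n)))‖ₑ := enorm_sub_le
      _ ≤ ∑' h, ‖(kerF l k h : ℂ) * (z (.inr h) * w (.inr (k - h)))‖ₑ +
          wt1 l k.1 ^ (1 / 2 : ℝ) * ∑' n, ‖z (.inl n) * w (.inr (k - (0, n)))‖ₑ := by
          rw [enorm_mul (Complex.I * _)]
          gcongr
          · exact enorm_tsum_le_tsum_enorm
          · exact enorm_freq_le k.1
          · exact enorm_tsum_le_tsum_enorm
      _ ≤ ∑' h, bilConst l * wt2 l k ^ (1 / 2 : ℝ) *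
            (‖z (.inr h)‖ₑ * wt2 l h ^ (-(1 / 2) : ℝ) * ‖w (.inr (k - h))‖ₑ) +
          bilConst l * wt2 l k ^ (1 / 2 : ℝ) *
            ∑' n, ‖z (.inl n)‖ₑ * ‖w (.inr (k - (0, n)))‖ₑ := by
          gcongr with h n
          · rw [enorm_mul, enorm_mul]
            calc _ ≤ (bilConst l * wt2 l k ^ (1 / 2 : ℝ) * wt2 l h ^ (-(1 / 2) : ℝ)) *
                  (‖z (.inr h)‖ₑ * ‖w (.inr (k - h))‖ₑ) := by
                  gcongr; exact enorm_kerF_le hl k h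
              _ = _ := by ring
          · calc wt1 l k.1 ^ (1 / 2 : ℝ) = 1 * wt1 l k.1 ^ (1 / 2 : ℝ) := (one_mul _).symm
              _ ≤ _ := by
                  gcongr
                  · exact one_le_bilConst l
                  · exact wt1_fst_le l k
          · rw [enorm_mul]
      _ = _ := by rw [ENNReal.tsum_mul_left]; ring

end Kernel

/-! ### Cauchy–Schwarz bounds for the majorant -/

section Majorant

variable (l : ℝ)

theorem wt2_rpow_le_one (k : ℤ × ℤ) {a : ℝ} (ha : 0 < a) : wt2 l k ^ (-a) ≤ 1 := by
  rw [ENNReal.rpow_neg, ENNReal.inv_le_one]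
  exact ENNReal.one_le_rpow (one_le_wt2 l k) ha

theorem maj_mono {a a' b b' : Mode → ℝ≥0∞} (ha : ∀ i, a i ≤ a' i) (hb : ∀ i, b i ≤ b' i)
    (i : Mode) : maj l a b i ≤ maj l a' b' i := by
  rcases i with n | k <;> simp only [maj]
  · gcongr <;> first | exact ha _ | exact hb _
  · gcongr <;> first | exact ha _ | exact hb _

theorem tsum_sub_left (b : ℤ × ℤ → ℝ≥0∞) (k : ℤ × ℤ) : ∑' h, b (k - h) = ∑' h, b h := by
  have := (Equiv.subLeft k).tsum_eq b
  simpa using this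

theorem tsum_fiber_sub (b : ℤ × ℤ → ℝ≥0∞) (k : ℤ × ℤ) :
    ∑' n, b (k - (0, n)) = ∑' n, b (k.1, n) := by
  have := (Equiv.subLeft k.2).tsum_eq (fun n => b (k.1, n))
  rw [← this]
  refine tsum_congr fun n => ?_
  congr 1
  ext <;> simp

theorem tsum_fiber_le (b : ℤ × ℤ → ℝ≥0∞) (j : ℤ) : ∑' n, b (j, n) ≤ ∑' k, b k :=
  ENNReal.tsum_comp_le_tsum_of_injective (Prod.mk_right_injective j) b

/-- The smoothing weight may be left with either factor. Here it goes to the second one;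
`sq_conv_le'` makes the opposite choice, for use when the first factor decays pointwise. -/
theorem sq_conv_le (a b : ℤ × ℤ → ℝ≥0∞) (k : ℤ × ℤ) :
    (∑' h, a h * wt2 l h ^ (-(1 / 2) : ℝ) * b (k - h)) ^ 2 ≤
      (∑' h, a h ^ 2) * ∑' h, wt2 l h ^ (-1 : ℝ) * b (k - h) ^ 2 := by
  calc _ = (∑' h, a h * (wt2 l h ^ (-(1 / 2) : ℝ) * b (k - h))) ^ 2 := by
        simp_rw [mul_assoc]
    _ ≤ _ := sq_tsum_mul_le _ _
    _ = _ := by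
        congr 1
        refine tsum_congr fun h => ?_
        rw [mul_pow, ← ENNReal.rpow_natCast, ← ENNReal.rpow_mul]
        norm_num

theorem sq_conv_le' (a b : ℤ × ℤ → ℝ≥0∞) (k : ℤ × ℤ) :
    (∑' h, a h * wt2 l h ^ (-(1 / 2) : ℝ) * b (k - h)) ^ 2 ≤
      (∑' h, wt2 l h ^ (-1 : ℝ) * a h ^ 2) * ∑' h, b h ^ 2 := by
  refine (sq_tsum_mul_le _ _).trans ?_
  rw [tsum_sub_left (fun h => b h ^ 2)]
  gcongr with h
  rw [mul_pow, ← ENNReal.rpow_natCast (wt2 l h ^ _), ← ENNReal.rpow_mul, mul_comm]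
  norm_num

/-- Interaction with the mean flow changes only the wavenumber in y, so only the fibre over `k.1` is
involved. -/
theorem sq_fiber_conv_le (a : ℤ → ℝ≥0∞) (b : ℤ × ℤ → ℝ≥0∞) (k : ℤ × ℤ) :
    (∑' n, a n * b (k - (0, n))) ^ 2 ≤ (∑' n, a n ^ 2) * ∑' n, b (k.1, n) ^ 2 := by
  refine (sq_tsum_mul_le _ _).trans ?_
  rw [tsum_fiber_sub (fun h => b h ^ 2)]

/-- The majorant is bounded on `ℓ² × ℓ²`. -/
theorem sq_maj_le (a b : Mode → ℝ≥0∞) (i : Mode) :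
    maj l a b i ^ 2 ≤ 4 * (l2sq a * l2sq b) := by
  have key : ∀ k, (∑' h, a (.inr h) * wt2 l h ^ (-(1 / 2) : ℝ) * b (.inr (k - h))) ^ 2 ≤
      l2sq a * l2sq b := by
    intro k
    refine (sq_conv_le l (fun h => a (.inr h)) (fun h => b (.inr h)) k).trans ?_
    gcongr
    · exact le_add_self
    · calc _ ≤ ∑' h, 1 * b (.inr (k - h)) ^ 2 := by
            gcongr with h; exact wt2_rpow_le_one l h zero_lt_one
        _ = ∑' h, b (.inr h) ^ 2 := by
            simp_rw [one_mul]; exact tsum_sub_left (fun h => b (.inr h) ^ 2) k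
        _ ≤ _ := le_add_self
  rcases i with n | k
  · simp only [maj]
    refine (key (0, n)).trans ?_
    calc l2sq a * l2sq b = 1 * (l2sq a * l2sq b) := (one_mul _).symm
      _ ≤ _ := by gcongr; norm_num
  · simp only [maj]
    have h2 : (∑' n, a (.inl n) * b (.inr (k - (0, n)))) ^ 2 ≤ l2sq a * l2sq b := by
      refine (sq_fiber_conv_le (fun n => a (.inl n)) (fun h => b (.inr h)) k).trans ?_
      gcongr
      · exact le_self_add
      · exact (tsum_fiber_le (fun h => b (.inr h) ^ 2) k.1).trans le_add_self
    calc _ ≤ 2 * (l2sq a * l2sq b + l2sq a * l2sq b) :=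
          (enorm_add_sq_le _ _).trans (by gcongr; exact key k)
      _ = _ := by ring

theorem maj_lt_top {a b : Mode → ℝ≥0∞} (ha : l2sq a < ∞) (hb : l2sq b < ∞) (i : Mode) :
    maj l a b i < ∞ := by
  have h := (sq_maj_le l a b i).trans_lt
    (ENNReal.mul_lt_top (by norm_num) (ENNReal.mul_lt_top ha hb))
  by_contra h'
  rw [not_lt_top_iff] at h'
  simp [h'] at h

end Majorant

/-! ### Identification of the nonlinearities with the bilinear operator -/

section Bridge

variable {l : ℝ}

theorem summable_of_enorm {ι : Type*} {f : ι → ℂ} (h : ∑' i, ‖f i‖ₑ < ∞) : Summable f := by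
  apply Summable.of_norm
  have := ENNReal.summable_toReal h.ne
  simpa using this

theorem summable_conv {a b : ℤ × ℤ → ℂ} (ha : ∑' k, ‖a k‖ₑ ^ 2 < ∞) (hb : ∑' k, ‖b k‖ₑ ^ 2 < ∞)
    (k : ℤ × ℤ) : ∑' h, ‖a h * b (k - h)‖ₑ < ∞ := by
  simp_rw [enorm_mul]
  have h := sq_tsum_mul_le (fun h => ‖a h‖ₑ) (fun h => ‖b (k - h)‖ₑ)
  rw [tsum_sub_left (fun h => ‖b h‖ₑ ^ 2)] at h
  have h2 := h.trans_lt (ENNReal.mul_lt_top ha hb)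
  by_contra h'
  rw [not_lt_top_iff] at h'
  simp [h'] at h2

theorem summable_bdd_mul {ι : Type*} {f : ι → ℂ} {c : ι → ℝ} {C : ℝ} (hc : ∀ i, |c i| ≤ C)
    (hf : ∑' i, ‖f i‖ₑ < ∞) : Summable fun i => (c i : ℂ) * f i := by
  apply summable_of_enorm
  calc ∑' i, ‖(c i : ℂ) * f i‖ₑ ≤ ∑' i, ENNReal.ofReal C * ‖f i‖ₑ := by
        gcongr with i
        rw [enorm_mul, ← ofReal_norm (c i : ℂ), Complex.norm_real, Real.norm_eq_abs]
        gcongr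
        exact hc i
    _ < ∞ := by
        rw [ENNReal.tsum_mul_left]
        exact ENNReal.mul_lt_top ENNReal.ofReal_lt_top hf

theorem invLap_eq (ζ : ℤ × ℤ → ℂ) (h : ℤ × ℤ) :
    invLap l ζ h = -(((freqSq l h)⁻¹ : ℝ) : ℂ) * ζ h := by
  unfold invLap
  split_ifs with h0
  · simp [h0, freqSq_zero]
  · push_cast
    rw [div_eq_mul_inv]; ring

/-- At a fixed output frequency the multiplier of each transport product is bounded in h. Hence both
series converge absolutely on ℓ² and may be subtracted term by term, which produces the divergence
form. -/
theorem abs_freq_mul_freq_div_le (hl : 0 < l) (h : ℤ × ℤ) {x y c : ℝ} (hx : x ^ 2 ≤ freqSq l h)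
    (hy : y ^ 2 ≤ freqSq l h) : |x * (c - y) * (freqSq l h)⁻¹| ≤ gapConst l * |c| + 1 := by
  have hg := one_le_gapConst l
  by_cases h0 : h = 0
  · subst h0
    simp only [freqSq_zero, inv_zero, mul_zero, abs_zero]
    positivity
  have hp := freqSq_pos hl h0
  have h1 := one_add_freqSq_le hl h0
  rw [abs_mul, abs_inv, abs_of_pos hp, ← div_eq_mul_inv, div_le_iff₀ hp, abs_mul]
  have e1 : |x| ≤ gapConst l * freqSq l h := by
    nlinarith [sq_nonneg (|x| - 1), sq_abs x]
  have e2 : |x| * |y| ≤ freqSq l h := by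
    nlinarith [sq_nonneg (|x| - |y|), sq_abs x, sq_abs y]
  calc |x| * |c - y| ≤ |x| * (|c| + |y|) := by gcongr; exact abs_sub _ _
    _ = |x| * |c| + |x| * |y| := by ring
    _ ≤ gapConst l * freqSq l h * |c| + freqSq l h := by gcongr
    _ = _ := by ring

theorem nonlinG_eq_bil (u : ℤ → ℂ) (ζ : ℤ × ℤ → ℂ) (n : ℤ) :
    nonlinG l ζ n = bil l (Sum.elim u ζ) (Sum.elim u ζ) (.inl n) := by
  simp only [nonlinG, dy1, zonalMean, mul2, bil, Sum.elim_inr, dx, dy, invLap_eq]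
  rw [neg_mul, ← mul_neg, ← tsum_neg]
  congr 1
  refine tsum_congr fun h => ?_
  simp only [kerG, Prod.snd_sub]
  push_cast
  linear_combination (freq l h.1 * freq l (n - h.2) * (freqSq l h : ℂ)⁻¹ *
    (freqSq l ((0, n) - h) : ℂ)⁻¹ * ζ h * ζ ((0, n) - h)) * Complex.I_sq

/-- In the difference of the two transport products the terms with both components of h cancel,
leaving `kerF`. On zonal modes the advection by u carries the factor `freq l k.1` = 0 and the
Reynolds correction is the exact negative of the remaining transport, so the value is 0. On other
modes the correction is absent. -/
theorem nonlinF_eq_bil (hl : 0 < l) {u : ℤ → ℂ} {ζ : ℤ × ℤ → ℂ} (hζ : ∑' k, ‖ζ k‖ₑ ^ 2 < ∞)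
    (k : ℤ × ℤ) :
    nonlinF l u ζ k = bil l (Sum.elim u ζ) (Sum.elim u ζ) (.inr k) := by
  have hconv := summable_conv hζ hζ k
  have hx : ∀ h : ℤ × ℤ, freq l h.1 ^ 2 ≤ freqSq l h := fun h => by
    unfold freqSq; nlinarith [sq_nonneg (freq l h.2)]
  have hy : ∀ h : ℤ × ℤ, freq l h.2 ^ 2 ≤ freqSq l h := fun h => by
    unfold freqSq; nlinarith [sq_nonneg (freq l h.1)]
  have hA : mul2 (dy l (invLap l ζ)) (dx l ζ) k =
      ∑' h, ((freq l h.2 * (freq l k.1 - freq l h.1) * (freqSq l h)⁻¹ : ℝ) : ℂ) *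
        (ζ h * ζ (k - h)) := by
    refine tsum_congr fun h => ?_
    simp only [dy, dx, invLap_eq, Prod.fst_sub, freq_sub]
    push_cast
    linear_combination (-freq l h.2 * (freq l k.1 - freq l h.1) * (freqSq l h : ℂ)⁻¹ *
      ζ h * ζ (k - h)) * Complex.I_sq
  have hB : mul2 (dx l (invLap l ζ)) (dy l ζ) k =
      ∑' h, ((freq l h.1 * (freq l k.2 - freq l h.2) * (freqSq l h)⁻¹ : ℝ) : ℂ) *
        (ζ h * ζ (k - h)) := by
    refine tsum_congr fun h => ?_
    simp only [dy, dx, invLap_eq, Prod.snd_sub, freq_sub]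
    push_cast
    linear_combination (-freq l h.1 * (freq l k.2 - freq l h.2) * (freqSq l h : ℂ)⁻¹ *
      ζ h * ζ (k - h)) * Complex.I_sq
  have sA := summable_bdd_mul
    (fun h : ℤ × ℤ => abs_freq_mul_freq_div_le hl h (c := freq l k.1) (hy h) (hx h)) hconv
  have sB := summable_bdd_mul
    (fun h : ℤ × ℤ => abs_freq_mul_freq_div_le hl h (c := freq l k.2) (hx h) (hy h)) hconv
  have hAB : mul2 (dy l (invLap l ζ)) (dx l ζ) k - mul2 (dx l (invLap l ζ)) (dy l ζ) k =
      ∑' h, (kerF l k h : ℂ) * (ζ h * ζ (k - h)) := by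
    rw [hA, hB, ← sA.tsum_sub sB]
    refine tsum_congr fun h => ?_
    rw [← sub_mul]
    congr 1
    rw [← Complex.ofReal_sub, kerF]
    congr 1
    ring
  have hC : mul2 (lift u) (dx l ζ) k =
      Complex.I * freq l k.1 * ∑' n, u n * ζ (k - (0, n)) := by
    rw [mul2, ← tsum_mul_left]
    have hinj : Function.Injective (fun n : ℤ => ((0 : ℤ), n)) := Prod.mk_right_injective 0
    rw [← hinj.tsum_eq]
    · refine tsum_congr fun n => ?_
      simp only [lift, dx, Prod.fst_sub, sub_zero, if_true]
      ring
    · intro h hh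
      refine ⟨h.2, Prod.ext ?_ rfl⟩
      by_contra hne
      apply hh
      simp only [lift, if_neg (Ne.symm hne), zero_mul]
  simp only [nonlinF, Pi.add_apply, Pi.sub_apply, hAB, hC, bil, Sum.elim_inl, Sum.elim_inr]
  split_ifs with hk
  · simp only [lift, hk, freq_zero, Complex.ofReal_zero, mul_zero, zero_mul, sub_zero]
    have hk2 : ((0 : ℤ), k.2) = k := Prod.ext hk.symm rfl
    simp only [dy1, zonalMean, mul2, hk2]
    rw [← tsum_mul_left]
    rw [← neg_eq_iff_add_eq_zero, ← tsum_neg]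
    refine tsum_congr fun h => ?_
    simp only [dx, invLap_eq, kerF, hk, freq_zero]
    push_cast
    linear_combination (freq l k.2 * freq l h.1 * (freqSq l h : ℂ)⁻¹ *
      ζ h * ζ (k - h)) * Complex.I_sq
  · simp [lift, hk]

end Bridge

/-! ### Continuity and measurability of the bilinear operator -/

section Bilinear

variable {l : ℝ}

theorem l2sq_mono {a b : Mode → ℝ≥0∞} (h : ∀ i, a i ≤ b i) : l2sq a ≤ l2sq b := by
  unfold l2sq
  gcongr <;> exact h _

theorem tsum_kerF_lt_top (hl : 0 < l) {a b : Mode → ℝ≥0∞} (ha : l2sq a < ∞) (hb : l2sq b < ∞)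
    (k : ℤ × ℤ) : ∑' h, ‖(kerF l k h : ℂ)‖ₑ * (a (.inr h) * b (.inr (k - h))) < ∞ := by
  have hm : maj l a b (.inr k) < ∞ := maj_lt_top l ha hb _
  have h1 : ∑' h, ‖(kerF l k h : ℂ)‖ₑ * (a (.inr h) * b (.inr (k - h))) ≤
      (bilConst l * wt2 l k ^ (1 / 2 : ℝ)) * maj l a b (.inr k) := by
    simp only [maj]
    rw [mul_add, ← ENNReal.tsum_mul_left]
    refine le_trans (ENNReal.tsum_le_tsum fun h => ?_) le_self_add
    calc _ ≤ (bilConst l * wt2 l k ^ (1 / 2 : ℝ) * wt2 l h ^ (-(1 / 2) : ℝ)) *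
          (a (.inr h) * b (.inr (k - h))) := by gcongr; exact enorm_kerF_le hl k h
      _ = _ := by ring
  refine h1.trans_lt (ENNReal.mul_lt_top (ENNReal.mul_lt_top (bilConst_ne_top l).lt_top ?_) hm)
  exact ENNReal.rpow_lt_top_of_nonneg (by norm_num) (wt2_ne_top l k)

theorem tsum_kerG_lt_top (hl : 0 < l) {a b : Mode → ℝ≥0∞} (ha : l2sq a < ∞) (hb : l2sq b < ∞)
    (n : ℤ) : ∑' h, ‖(kerG l n h : ℂ)‖ₑ * (a (.inr h) * b (.inr ((0, n) - h))) < ∞ := by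
  have hm : maj l a b (.inl n) < ∞ := maj_lt_top l ha hb _
  have h1 : ∑' h, ‖(kerG l n h : ℂ)‖ₑ * (a (.inr h) * b (.inr ((0, n) - h))) ≤
      bilConst l * maj l a b (.inl n) := by
    simp only [maj]
    rw [← ENNReal.tsum_mul_left]
    refine ENNReal.tsum_le_tsum fun h => ?_
    calc _ ≤ (bilConst l * wt2 l h ^ (-(1 / 2) : ℝ)) *
          (a (.inr h) * b (.inr ((0, n) - h))) := by gcongr; exact enorm_kerG_le hl n h
      _ = _ := by ring
  exact h1.trans_lt (ENNReal.mul_lt_top (bilConst_ne_top l).lt_top hm)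

theorem tsum_fiber_lt_top {a b : Mode → ℝ≥0∞} (ha : l2sq a < ∞) (hb : l2sq b < ∞)
    (k : ℤ × ℤ) : ∑' n, a (.inl n) * b (.inr (k - (0, n))) < ∞ :=
  -- The fibre sum in `maj` does not involve `l`, so any value, here 0, may be inserted.
  lt_of_le_of_lt le_add_self (maj_lt_top (l := 0) ha hb (.inr k))

theorem summable_kerF (hl : 0 < l) {z w : Mode → ℂ} (hz : l2sq (fun i => ‖z i‖ₑ) < ∞)
    (hw : l2sq (fun i => ‖w i‖ₑ) < ∞) (k : ℤ × ℤ) :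
    Summable fun h => (kerF l k h : ℂ) * (z (.inr h) * w (.inr (k - h))) := by
  apply summable_of_enorm
  simp_rw [enorm_mul]
  exact tsum_kerF_lt_top hl hz hw k

theorem summable_kerG (hl : 0 < l) {z w : Mode → ℂ} (hz : l2sq (fun i => ‖z i‖ₑ) < ∞)
    (hw : l2sq (fun i => ‖w i‖ₑ) < ∞) (n : ℤ) :
    Summable fun h => (kerG l n h : ℂ) * (z (.inr h) * w (.inr ((0, n) - h))) := by
  apply summable_of_enorm
  simp_rw [enorm_mul]
  exact tsum_kerG_lt_top hl hz hw n

theorem summable_fiber {z w : Mode → ℂ} (hz : l2sq (fun i => ‖z i‖ₑ) < ∞)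
    (hw : l2sq (fun i => ‖w i‖ₑ) < ∞) (k : ℤ × ℤ) :
    Summable fun n => z (.inl n) * w (.inr (k - (0, n))) := by
  apply summable_of_enorm
  simp_rw [enorm_mul]
  exact tsum_fiber_lt_top hz hw k

theorem bil_sub_left (hl : 0 < l) {z z' w : Mode → ℂ} (hz : l2sq (fun i => ‖z i‖ₑ) < ∞)
    (hz' : l2sq (fun i => ‖z' i‖ₑ) < ∞) (hw : l2sq (fun i => ‖w i‖ₑ) < ∞) (i : Mode) :
    bil l (z - z') w i = bil l z w i - bil l z' w i := by
  rcases i with n | k <;> simp only [bil, Pi.sub_apply, sub_mul, mul_sub]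
  · rw [(summable_kerG hl hz hw n).tsum_sub (summable_kerG hl hz' hw n)]
    ring
  · split_ifs
    · simp
    · rw [(summable_kerF hl hz hw k).tsum_sub (summable_kerF hl hz' hw k),
        (summable_fiber hz hw k).tsum_sub (summable_fiber hz' hw k)]
      ring

theorem bil_sub_right (hl : 0 < l) {z w w' : Mode → ℂ} (hz : l2sq (fun i => ‖z i‖ₑ) < ∞)
    (hw : l2sq (fun i => ‖w i‖ₑ) < ∞) (hw' : l2sq (fun i => ‖w' i‖ₑ) < ∞) (i : Mode) :
    bil l z (w - w') i = bil l z w i - bil l z w' i := by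
  rcases i with n | k <;> simp only [bil, Pi.sub_apply, mul_sub]
  · rw [(summable_kerG hl hz hw n).tsum_sub (summable_kerG hl hz hw' n)]
    ring
  · split_ifs
    · simp
    · rw [(summable_kerF hl hz hw k).tsum_sub (summable_kerF hl hz hw' k),
        (summable_fiber hz hw k).tsum_sub (summable_fiber hz hw' k)]
      ring

theorem tendsto_tsum_of_enorm_le {α β : Type*} {F : Filter α} {f : α → β → ℂ} {g : β → ℂ}
    {b : β → ℝ≥0∞} (hb : ∑' k, b k < ∞) (hf : ∀ k, Tendsto (f · k) F (𝓝 (g k)))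
    (hfb : ∀ a k, ‖f a k‖ₑ ≤ b k) : Tendsto (fun a => ∑' k, f a k) F (𝓝 (∑' k, g k)) := by
  refine tendsto_tsum_of_dominated_convergence (bound := fun k => (b k).toReal)
    (ENNReal.summable_toReal hb.ne) hf (Eventually.of_forall fun a k => ?_)
  have := ENNReal.toReal_mono (ENNReal.ne_top_of_tsum_ne_top hb.ne k) (hfb a k)
  simpa using this

/-- The quadratic operator is continuous for dominated coefficientwise convergence. -/
theorem tendsto_bil (hl : 0 < l) {α : Type*} {F : Filter α} {z : α → Mode → ℂ} {w : Mode → ℂ}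
    {Z : Mode → ℝ≥0∞} (hZ : l2sq Z < ∞) (hz : ∀ i, Tendsto (z · i) F (𝓝 (w i)))
    (hzZ : ∀ a i, ‖z a i‖ₑ ≤ Z i) (i : Mode) :
    Tendsto (fun a => bil l (z a) (z a) i) F (𝓝 (bil l w w i)) := by
  rcases i with n | k <;> simp only [bil]
  · refine tendsto_const_nhds.mul (tendsto_tsum_of_enorm_le (tsum_kerG_lt_top hl hZ hZ n)
      (fun h => tendsto_const_nhds.mul ((hz _).mul (hz _))) fun a h => ?_)
    rw [enorm_mul, enorm_mul]
    gcongr <;> exact hzZ _ _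
  · split_ifs
    · exact tendsto_const_nhds
    refine (tendsto_tsum_of_enorm_le (tsum_kerF_lt_top hl hZ hZ k)
      (fun h => tendsto_const_nhds.mul ((hz _).mul (hz _))) fun a h => ?_).sub
      (tendsto_const_nhds.mul (tendsto_tsum_of_enorm_le (tsum_fiber_lt_top hZ hZ k)
      (fun h => (hz _).mul (hz _)) fun a h => ?_))
    · rw [enorm_mul, enorm_mul]
      gcongr <;> exact hzZ _ _
    · rw [enorm_mul]
      gcongr <;> exact hzZ _ _

theorem continuous_bil (hl : 0 < l) {z : ℝ → Mode → ℂ} {Z : Mode → ℝ≥0∞} (hZ : l2sq Z < ∞)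
    (hz : ∀ i, Continuous fun t => z t i) (hzZ : ∀ t i, ‖z t i‖ₑ ≤ Z i) (i : Mode) :
    Continuous fun t => bil l (z t) (z t) i :=
  continuous_iff_continuousAt.2 fun t =>
    tendsto_bil hl hZ (fun j => (hz j).tendsto t) (fun s j => hzZ s j) i

theorem aestronglyMeasurable_tsum {α β : Type*} [MeasurableSpace α] {μ : Measure α} [Countable β]
    {f : β → α → ℂ} (hf : ∀ i, AEStronglyMeasurable (f i) μ)
    (hs : ∀ᵐ x ∂μ, Summable fun i => f i x) :
    AEStronglyMeasurable (fun x => ∑' i, f i x) μ := by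
  refine aestronglyMeasurable_of_tendsto_ae (atTop : Filter (Finset β))
    (f := fun s x => ∑ i ∈ s, f i x) (fun s => ?_) ?_
  · exact Finset.aestronglyMeasurable_fun_sum s fun i _ => hf i
  · filter_upwards [hs] with x hx using hx.hasSum

theorem aestronglyMeasurable_bil (hl : 0 < l) {μ : Measure ℝ} {z : ℝ → Mode → ℂ}
    (hz : ∀ i, AEStronglyMeasurable (fun t => z t i) μ)
    (hb : ∀ᵐ t ∂μ, l2sq (fun i => ‖z t i‖ₑ) < ∞) (i : Mode) :
    AEStronglyMeasurable (fun t => bil l (z t) (z t) i) μ := by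
  rcases i with n | k <;> simp only [bil]
  · refine AEStronglyMeasurable.const_mul (aestronglyMeasurable_tsum
      (fun h => ((hz _).mul (hz _)).const_mul _) ?_) _
    filter_upwards [hb] with t ht using summable_kerG hl ht ht n
  · split_ifs
    · exact aestronglyMeasurable_const
    refine AEStronglyMeasurable.sub (aestronglyMeasurable_tsum
      (fun h => ((hz _).mul (hz _)).const_mul _) ?_) (AEStronglyMeasurable.const_mul
      (aestronglyMeasurable_tsum (fun h => (hz _).mul (hz _)) ?_) _)
    · filter_upwards [hb] with t ht using summable_kerF hl ht ht k
    · filter_upwards [hb] with t ht using summable_fiber ht ht k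

end Bilinear

/-! ### The linear part and the Duhamel formula -/

section Duhamel

/-- `|κ|²` of a mode. -/
def modeSq (l : ℝ) : Mode → ℝ := Sum.elim (fun n => freq l n ^ 2) (freqSq l)

/-- The symbol of the linear part. -/
def sym (l ν C₁ : ℝ) : Mode → ℂ :=
  Sum.elim (fun n => ((-ν * freq l n ^ 2 : ℝ) : ℂ)) (symbol2 l ν C₁)

/-- The coefficients of a pair of functions. -/
def coef {l : ℝ} [Fact (0 < l)] (u : L2y l) (ζ : L2xy l) : Mode → ℂ :=
  Sum.elim (hat1 u) (hat2 ζ)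

/-- The Duhamel formula for the coefficients. -/
def Duhamel (l ν C₁ : ℝ) (z₀ : Mode → ℂ) (z : ℝ → Mode → ℂ) (t : ℝ) : Prop :=
  ∀ i, z t i = Complex.exp (t * sym l ν C₁ i) * z₀ i +
    ∫ τ in (0 : ℝ)..t, Complex.exp ((t - τ : ℝ) * sym l ν C₁ i) * bil l (z τ) (z τ) i

variable {l : ℝ}

theorem modeSq_nonneg (i : Mode) : 0 ≤ modeSq l i := by
  rcases i with n | k
  · simp only [modeSq, Sum.elim_inl]; positivity
  · exact freqSq_nonneg l k

theorem wt_eq_ofReal (i : Mode) : wt l i = ENNReal.ofReal (1 + modeSq l i) := by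
  rcases i with n | k <;> rfl

theorem one_le_wt (i : Mode) : 1 ≤ wt l i := by
  rcases i with n | k
  · exact one_le_wt1 l n
  · exact one_le_wt2 l k

theorem wt_ne_zero (i : Mode) : wt l i ≠ 0 := (zero_lt_one.trans_le (one_le_wt i)).ne'

theorem wt_ne_top (i : Mode) : wt l i ≠ ∞ := by
  rw [wt_eq_ofReal]; exact ENNReal.ofReal_ne_top

theorem wt_rpow_add (i : Mode) (a b : ℝ) : wt l i ^ (a + b) = wt l i ^ a * wt l i ^ b :=
  ENNReal.rpow_add _ _ (wt_ne_zero i) (wt_ne_top i)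

/-- The term with C₁ is dispersive: its symbol is purely imaginary and drops out of every estimate.
-/
theorem re_sym (ν C₁ : ℝ) (i : Mode) : (sym l ν C₁ i).re = -(ν * modeSq l i) := by
  rcases i with n | k
  · simp only [sym, modeSq, Sum.elim_inl, Complex.ofReal_re]; ring
  · simp only [sym, modeSq, Sum.elim_inr, symbol2, dx, invLap_eq]
    simp

theorem duhamelAt_iff [Fact (0 < l)] {ν C₁ : ℝ} {u₀ : L2y l} {ζ₀ : L2xy l} {u : ℝ → L2y l}
    {ζ : ℝ → L2xy l} {t : ℝ} :
    DuhamelAt ν C₁ u₀ ζ₀ u ζ t ↔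
      Duhamel l ν C₁ (coef u₀ ζ₀) (fun τ => coef (u τ) (ζ τ)) t := by
  have hl : 0 < l := Fact.out
  unfold DuhamelAt Duhamel
  rw [Sum.forall]
  simp only [coef, sym, Sum.elim_inl, Sum.elim_inr, semigroup1, semigroup2,
    nonlinF_eq_bil hl (tsum_enorm_sq_hat2_lt_top _)]
  have h : ∀ τ n, nonlinG l (hat2 (ζ τ)) n =
      bil l (Sum.elim (hat1 (u τ)) (hat2 (ζ τ))) (Sum.elim (hat1 (u τ)) (hat2 (ζ τ))) (.inl n) :=
    fun τ n => nonlinG_eq_bil _ _ _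
  simp only [h, Complex.ofReal_mul]

theorem norm_exp_mul_sym (ν C₁ t : ℝ) (i : Mode) :
    ‖Complex.exp (t * sym l ν C₁ i)‖ = Real.exp (-(t * (ν * modeSq l i))) := by
  rw [Complex.norm_exp, Complex.re_ofReal_mul, re_sym]
  congr 1; ring

/-- Integrating exp((μ + r)τ) produces the denominator μ + r. With μ = 0 this gives bounds uniform
in time on damped modes; with μ large it gives a contraction on all modes. -/
theorem norm_duhamel_le {r μ b t : ℝ} {g E : ℝ → ℂ} (ht : 0 ≤ t) (hμ : 0 < μ + r) (hb : 0 ≤ b)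
    (hE : ∀ τ, ‖E τ‖ = Real.exp (-(t - τ) * r))
    (hg : ∀ᵐ τ, τ ∈ Ioc 0 t → ‖g τ‖ ≤ b * Real.exp (μ * τ)) :
    ‖∫ τ in (0 : ℝ)..t, E τ * g τ‖ ≤ b * Real.exp (μ * t) / (μ + r) := by
  have h1 : ‖∫ τ in (0 : ℝ)..t, E τ * g τ‖ ≤
      ∫ τ in (0 : ℝ)..t, b * Real.exp (-t * r) * Real.exp ((μ + r) * τ) := by
    apply intervalIntegral.norm_integral_le_of_norm_le ht
    · filter_upwards [hg] with τ hτ hmem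
      rw [norm_mul, hE]
      calc _ ≤ Real.exp (-(t - τ) * r) * (b * Real.exp (μ * τ)) := by gcongr; exact hτ hmem
        _ = b * (Real.exp (-(t - τ) * r) * Real.exp (μ * τ)) := by ring
        _ = b * (Real.exp (-t * r) * Real.exp ((μ + r) * τ)) := by
            rw [← Real.exp_add, ← Real.exp_add]; congr 2; ring
        _ = _ := by ring
    · apply Continuous.intervalIntegrable
      fun_prop
  refine h1.trans ?_
  rw [intervalIntegral.integral_const_mul, intervalIntegral.integral_comp_mul_left _ hμ.ne',
    integral_exp]
  simp only [mul_zero, Real.exp_zero, smul_eq_mul]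
  calc b * Real.exp (-t * r) * ((μ + r)⁻¹ * (Real.exp ((μ + r) * t) - 1))
      ≤ b * Real.exp (-t * r) * ((μ + r)⁻¹ * Real.exp ((μ + r) * t)) := by
        gcongr; linarith
    _ = b * (Real.exp (-t * r) * Real.exp ((μ + r) * t)) / (μ + r) := by ring
    _ = _ := by rw [← Real.exp_add]; congr 3; ring

end Duhamel

/-! ### Uniqueness -/

section Uniqueness

variable {l : ℝ}

theorem le_rpow_half_of_sq_le {x y : ℝ≥0∞} (h : x ^ 2 ≤ y) : x ≤ y ^ (1 / 2 : ℝ) := by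
  calc x = (x ^ 2) ^ (1 / 2 : ℝ) := by
        rw [← ENNReal.rpow_natCast, ← ENNReal.rpow_mul]; norm_num
    _ ≤ _ := by gcongr

theorem norm_le_of_enorm_le_wt {x : ℂ} {c : ℝ≥0∞} (hc : c ≠ ∞) {i : Mode} {p : ℝ}
    (h : ‖x‖ₑ ≤ c * wt l i ^ p) : ‖x‖ ≤ c.toReal * (1 + modeSq l i) ^ p := by
  have hm : 0 < 1 + modeSq l i := by linarith [modeSq_nonneg (l := l) i]
  rw [wt_eq_ofReal, ENNReal.ofReal_rpow_of_pos hm] at h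
  have h2 := ENNReal.toReal_mono (ENNReal.mul_ne_top hc ENNReal.ofReal_ne_top) h
  rw [ENNReal.toReal_mul, ENNReal.toReal_ofReal (by positivity)] at h2
  simpa using h2

theorem enorm_le_wt_of_norm_le {x : ℂ} {c : ℝ} (hc : 0 ≤ c) {i : Mode} {p : ℝ}
    (h : ‖x‖ ≤ c * (1 + modeSq l i) ^ p) : ‖x‖ₑ ≤ ENNReal.ofReal c * wt l i ^ p := by
  have hm : 0 < 1 + modeSq l i := by linarith [modeSq_nonneg (l := l) i]
  rw [wt_eq_ofReal, ENNReal.ofReal_rpow_of_pos hm, ← ENNReal.ofReal_mul hc, ← ofReal_norm]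
  exact ENNReal.ofReal_le_ofReal h

theorem enorm_bil_le_l2sq (hl : 0 < l) (z w : Mode → ℂ) (i : Mode) :
    ‖bil l z w i‖ₑ ≤ bilConst l *
      (4 * (l2sq (fun j => ‖z j‖ₑ) * l2sq (fun j => ‖w j‖ₑ))) ^ (1 / 2 : ℝ) *
      wt l i ^ (1 / 2 : ℝ) := by
  refine (enorm_bil_le hl z w i).trans ?_
  rw [mul_right_comm]
  gcongr
  exact le_rpow_half_of_sq_le (sq_maj_le l _ _ i)

theorem maj_const_mul_left (c : ℝ≥0∞) (a b : Mode → ℝ≥0∞) (i : Mode) :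
    maj l (fun j => c * a j) b i = c * maj l a b i := by
  rcases i with n | k <;> simp only [maj, mul_assoc, ENNReal.tsum_mul_left, mul_add]

theorem maj_const_mul_right (c : ℝ≥0∞) (a b : Mode → ℝ≥0∞) (i : Mode) :
    maj l a (fun j => c * b j) i = c * maj l a b i := by
  rcases i with n | k <;>
    simp only [maj, mul_left_comm _ c, ENNReal.tsum_mul_left, mul_add]

/-- The constant in the bounds of the majorant on decaying sequences. -/
def decayConst (l : ℝ) : ℝ≥0∞ := 2 * (2 * sum2 l (7 / 4) + sum1 l (3 / 4))

theorem decayConst_lt_top (hl : 0 < l) : decayConst l < ∞ :=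
  ENNReal.mul_lt_top (by norm_num) (ENNReal.add_lt_top.2
    ⟨ENNReal.mul_lt_top (by norm_num) (sum2_lt_top hl (by norm_num)),
      sum1_lt_top hl (by norm_num)⟩)

theorem wt1_sq (n : ℤ) : (wt1 l n ^ (-(3 / 8) : ℝ)) ^ 2 = wt1 l n ^ (-(3 / 4) : ℝ) := by
  rw [← ENNReal.rpow_natCast, ← ENNReal.rpow_mul]; norm_num

theorem wt2_sq (k : ℤ × ℤ) : (wt2 l k ^ (-(3 / 8) : ℝ)) ^ 2 = wt2 l k ^ (-(3 / 4) : ℝ) := by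
  rw [← ENNReal.rpow_natCast, ← ENNReal.rpow_mul]; norm_num

/-- The exponent 3/8 is chosen so that its double 3/4 exceeds 1/2, the threshold on the zonal line.
On the plane lattice the smoothing weight helps, and 1 + 3/4 = 7/4 exceeds the threshold 1. The same
numbers serve in `sq_maj_decay_right_le`. -/
theorem sq_maj_decay_left_le (b : Mode → ℝ≥0∞) (i : Mode) :
    maj l (fun j => wt l j ^ (-(3 / 8) : ℝ)) b i ^ 2 ≤ decayConst l * l2sq b := by
  have key : ∀ k, (∑' h, wt2 l h ^ (-(3 / 8) : ℝ) * wt2 l h ^ (-(1 / 2) : ℝ) *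
      b (.inr (k - h))) ^ 2 ≤ 2 * sum2 l (7 / 4) * l2sq b := by
    intro k
    refine (sq_conv_le' l (fun h => wt2 l h ^ (-(3 / 8) : ℝ)) (fun h => b (.inr h)) k).trans ?_
    gcongr
    · calc ∑' h, wt2 l h ^ (-1 : ℝ) * (wt2 l h ^ (-(3 / 8) : ℝ)) ^ 2 = sum2 l (7 / 4) := by
            refine tsum_congr fun h => ?_
            rw [wt2_sq, ← wt2_rpow_add]; norm_num
        _ ≤ _ := by rw [two_mul]; exact le_self_add
    · exact le_add_self
  rcases i with n | k
  · simp only [maj, wt, Sum.elim_inr]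
    refine (key (0, n)).trans ?_
    gcongr
    rw [decayConst, mul_add, two_mul (2 * sum2 l (7 / 4)), add_assoc]
    exact le_self_add
  · simp only [maj, wt, Sum.elim_inr, Sum.elim_inl]
    have h2 : (∑' n, wt1 l n ^ (-(3 / 8) : ℝ) * b (.inr (k - (0, n)))) ^ 2 ≤
        sum1 l (3 / 4) * l2sq b := by
      refine (sq_fiber_conv_le (fun n => wt1 l n ^ (-(3 / 8) : ℝ))
        (fun h => b (.inr h)) k).trans ?_
      simp_rw [wt1_sq]
      rw [← sum1]
      gcongr
      exact (tsum_fiber_le (fun h => b (.inr h) ^ 2) k.1).trans le_add_self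
    calc _ ≤ 2 * (2 * sum2 l (7 / 4) * l2sq b + sum1 l (3 / 4) * l2sq b) :=
          (enorm_add_sq_le _ _).trans (by gcongr; exact key k)
      _ = _ := by rw [decayConst]; ring

theorem sq_maj_decay_right_le (a : Mode → ℝ≥0∞) (i : Mode) :
    maj l a (fun j => wt l j ^ (-(3 / 8) : ℝ)) i ^ 2 ≤ decayConst l * l2sq a := by
  have key : ∀ k, (∑' h, a (.inr h) * wt2 l h ^ (-(1 / 2) : ℝ) *
      wt2 l (k - h) ^ (-(3 / 8) : ℝ)) ^ 2 ≤ 2 * sum2 l (7 / 4) * l2sq a := by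
    intro k
    refine (sq_conv_le l (fun h => a (.inr h)) (fun h => wt2 l h ^ (-(3 / 8) : ℝ)) k).trans ?_
    rw [mul_comm]
    gcongr
    · simp_rw [wt2_sq]
      refine (tsum_wt2_mul_wt2_sub_le l k (a := 1) (b := 3 / 4) zero_le_one
        (by norm_num)).trans ?_
      norm_num
    · exact le_add_self
  rcases i with n | k
  · simp only [maj, wt, Sum.elim_inr]
    refine (key (0, n)).trans ?_
    gcongr
    rw [decayConst, mul_add, two_mul (2 * sum2 l (7 / 4)), add_assoc]
    exact le_self_add
  · simp only [maj, wt, Sum.elim_inr]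
    have h2 : (∑' n, a (.inl n) * wt2 l (k - (0, n)) ^ (-(3 / 8) : ℝ)) ^ 2 ≤
        sum1 l (3 / 4) * l2sq a := by
      refine (sq_fiber_conv_le (fun n => a (.inl n))
        (fun h => wt2 l h ^ (-(3 / 8) : ℝ)) k).trans ?_
      rw [mul_comm]
      gcongr
      · simp_rw [wt2_sq]
        exact ENNReal.tsum_le_tsum fun n => rpow_neg_anti (by norm_num) (wt1_snd_le l (k.1, n))
      · exact le_self_add
    calc _ ≤ 2 * (2 * sum2 l (7 / 4) * l2sq a + sum1 l (3 / 4) * l2sq a) :=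
          (enorm_add_sq_le _ _).trans (by gcongr; exact key k)
      _ = _ := by rw [decayConst]; ring

/-- The Lipschitz estimate for the nonlinearity in the norm `sup (1 + |κ|²)^(3/8) |z|`. -/
theorem enorm_bil_sub_bil_le (hl : 0 < l) {z w : Mode → ℂ} {M c : ℝ≥0∞} (hM : M < ∞)
    (hz : l2sq (fun i => ‖z i‖ₑ) ≤ M) (hw : l2sq (fun i => ‖w i‖ₑ) ≤ M)
    (hzw : ∀ i, ‖z i - w i‖ₑ ≤ c * wt l i ^ (-(3 / 8) : ℝ)) (i : Mode) :
    ‖bil l z z i - bil l w w i‖ₑ ≤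
      c * (2 * bilConst l * (decayConst l * M) ^ (1 / 2 : ℝ)) * wt l i ^ (1 / 2 : ℝ) := by
  have hz' := hz.trans_lt hM
  have hw' := hw.trans_lt hM
  have e : bil l z z i - bil l w w i = bil l (z - w) z i + bil l w (z - w) i := by
    rw [bil_sub_left hl hz' hw' hz', bil_sub_right hl hw' hz' hw']; ring
  have h1 : maj l (fun j => ‖(z - w) j‖ₑ) (fun j => ‖z j‖ₑ) i ≤
      c * (decayConst l * M) ^ (1 / 2 : ℝ) := by
    refine (maj_mono l hzw (fun _ => le_rfl) i).trans ?_
    rw [maj_const_mul_left]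
    gcongr
    refine le_rpow_half_of_sq_le ((sq_maj_decay_left_le _ i).trans ?_)
    gcongr
  have h2 : maj l (fun j => ‖w j‖ₑ) (fun j => ‖(z - w) j‖ₑ) i ≤
      c * (decayConst l * M) ^ (1 / 2 : ℝ) := by
    refine (maj_mono l (fun _ => le_rfl) hzw i).trans ?_
    rw [maj_const_mul_right]
    gcongr
    refine le_rpow_half_of_sq_le ((sq_maj_decay_right_le _ i).trans ?_)
    gcongr
  rw [e]
  calc ‖bil l (z - w) z i + bil l w (z - w) i‖ₑ
      ≤ bilConst l * wt l i ^ (1 / 2 : ℝ) * (c * (decayConst l * M) ^ (1 / 2 : ℝ)) +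
        bilConst l * wt l i ^ (1 / 2 : ℝ) * (c * (decayConst l * M) ^ (1 / 2 : ℝ)) := by
        refine (enorm_add_le _ _).trans (add_le_add ?_ ?_)
        · exact (enorm_bil_le hl _ _ i).trans (by gcongr)
        · exact (enorm_bil_le hl _ _ i).trans (by gcongr)
    _ = _ := by ring

/-- A power below one is absorbed by the linear term: beyond A the missing factor (1 + x)^(1/8) is
at least D / ν, and below A the constant μ suffices. -/
theorem exists_const_mul_rpow_le {ν D : ℝ} (hν : 0 < ν) (hD : 0 < D) :
    ∃ μ : ℝ, 0 < μ ∧ ∀ x : ℝ, 0 ≤ x → D * (1 + x) ^ (7 / 8 : ℝ) ≤ μ + ν * x := by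
  let A : ℝ := (D / ν) ^ (8 : ℝ)
  have hA : 0 < A := by positivity
  refine ⟨D * (1 + A) ^ (7 / 8 : ℝ) + ν, by positivity, fun x hx => ?_⟩
  by_cases h : x ≤ A
  · have : D * (1 + x) ^ (7 / 8 : ℝ) ≤ D * (1 + A) ^ (7 / 8 : ℝ) := by gcongr
    nlinarith [mul_nonneg hν.le hx]
  · push Not at h
    have h1 : D / ν ≤ (1 + x) ^ (1 / 8 : ℝ) := by
      calc D / ν = A ^ (1 / 8 : ℝ) := by
            rw [← Real.rpow_mul (by positivity)]; norm_num
        _ ≤ _ := by gcongr; linarith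
    have h2 : D ≤ ν * (1 + x) ^ (1 / 8 : ℝ) := by
      rw [div_le_iff₀ hν] at h1; linarith
    have h3 : (1 + x) ^ (1 / 8 : ℝ) * (1 + x) ^ (7 / 8 : ℝ) = 1 + x := by
      rw [← Real.rpow_add (by linarith)]; norm_num
    have h4 : D * (1 + x) ^ (7 / 8 : ℝ) ≤ ν * (1 + x) := by
      calc D * (1 + x) ^ (7 / 8 : ℝ) ≤ (ν * (1 + x) ^ (1 / 8 : ℝ)) * (1 + x) ^ (7 / 8 : ℝ) := by
            gcongr
        _ = _ := by rw [mul_assoc, h3]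
    have : 0 ≤ D * (1 + A) ^ (7 / 8 : ℝ) := by positivity
    linarith

theorem norm_exp_sym_eq (ν C₁ t τ : ℝ) (i : Mode) :
    ‖Complex.exp ((t - τ : ℝ) * sym l ν C₁ i)‖ = Real.exp (-(t - τ) * (ν * modeSq l i)) := by
  rw [norm_exp_mul_sym]; congr 1; ring

theorem intervalIntegrable_duhamel (hl : 0 < l) {ν C₁ : ℝ} (hν : 0 < ν) {z : ℝ → Mode → ℂ}
    {M : ℝ≥0∞} (hM : M < ∞)
    (hzm : ∀ i, AEStronglyMeasurable (fun t => z t i) (volume.restrict (Ioi (0 : ℝ))))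
    (hzM : ∀ᵐ t ∂(volume.restrict (Ioi (0 : ℝ))), l2sq (fun i => ‖z t i‖ₑ) ≤ M)
    {t : ℝ} (ht : 0 ≤ t) (i : Mode) :
    IntervalIntegrable
      (fun τ => Complex.exp ((t - τ : ℝ) * sym l ν C₁ i) * bil l (z τ) (z τ) i) volume 0 t := by
  rw [intervalIntegrable_iff_integrableOn_Ioc_of_le ht]
  have hsub : Ioc (0 : ℝ) t ⊆ Ioi 0 := fun τ h => h.1
  have hmono : volume.restrict (Ioc (0 : ℝ) t) ≤ volume.restrict (Ioi (0 : ℝ)) :=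
    Measure.restrict_mono hsub le_rfl
  have hfin : ∀ᵐ τ ∂(volume.restrict (Ioi (0 : ℝ))), l2sq (fun i => ‖z τ i‖ₑ) < ∞ := by
    filter_upwards [hzM] with τ h using h.trans_lt hM
  have hm : AEStronglyMeasurable (fun τ => bil l (z τ) (z τ) i) (volume.restrict (Ioc 0 t)) :=
    (aestronglyMeasurable_bil hl hzm hfin i).mono_measure hmono
  have hc : bilConst l * (4 * (M * M)) ^ (1 / 2 : ℝ) ≠ ∞ :=
    ENNReal.mul_ne_top (bilConst_ne_top l) (ENNReal.rpow_ne_top_of_nonneg (by norm_num)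
      (ENNReal.mul_ne_top (by norm_num) (ENNReal.mul_ne_top hM.ne hM.ne)))
  have hcont : Continuous fun τ : ℝ => Complex.exp ((t - τ : ℝ) * sym l ν C₁ i) := by fun_prop
  refine Integrable.of_bound (hcont.aestronglyMeasurable.mul hm)
    ((bilConst l * (4 * (M * M)) ^ (1 / 2 : ℝ)).toReal * (1 + modeSq l i) ^ (1 / 2 : ℝ)) ?_
  filter_upwards [hmono.absolutelyContinuous.ae_le hzM, ae_restrict_mem measurableSet_Ioc]
    with τ hτ hmem
  rw [norm_mul, norm_exp_sym_eq]
  have h1 : Real.exp (-(t - τ) * (ν * modeSq l i)) ≤ 1 := by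
    rw [Real.exp_le_one_iff]
    have := mul_nonneg (sub_nonneg.2 hmem.2) (mul_nonneg hν.le (modeSq_nonneg (l := l) i))
    linarith
  have h2 := norm_le_of_enorm_le_wt hc (i := i) (p := 1 / 2) (x := bil l (z τ) (z τ) i)
    ((enorm_bil_le_l2sq hl (z τ) (z τ) i).trans (by gcongr))
  calc _ ≤ 1 * ‖bil l (z τ) (z τ) i‖ := by gcongr
    _ ≤ _ := by rw [one_mul]; exact h2

/-- Two solutions of the Duhamel formula that are bounded in `ℓ²` agree. -/
theorem duhamel_unique (hl : 0 < l) {ν C₁ : ℝ} (hν : 0 < ν) {z₀ : Mode → ℂ}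
    {z w : ℝ → Mode → ℂ} {M : ℝ≥0∞} (hM : M < ∞)
    (hzm : ∀ i, AEStronglyMeasurable (fun t => z t i) (volume.restrict (Ioi (0 : ℝ))))
    (hwm : ∀ i, AEStronglyMeasurable (fun t => w t i) (volume.restrict (Ioi (0 : ℝ))))
    (hzM : ∀ᵐ t ∂(volume.restrict (Ioi (0 : ℝ))), l2sq (fun i => ‖z t i‖ₑ) ≤ M)
    (hwM : ∀ᵐ t ∂(volume.restrict (Ioi (0 : ℝ))), l2sq (fun i => ‖w t i‖ₑ) ≤ M)
    (hz : ∀ᵐ t ∂(volume.restrict (Ioi (0 : ℝ))), Duhamel l ν C₁ z₀ z t)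
    (hw : ∀ᵐ t ∂(volume.restrict (Ioi (0 : ℝ))), Duhamel l ν C₁ z₀ w t) :
    ∀ᵐ t ∂(volume.restrict (Ioi (0 : ℝ))), z t = w t := by
  let Kc : ℝ≥0∞ := 2 * bilConst l * (decayConst l * M) ^ (1 / 2 : ℝ)
  have hKc : Kc ≠ ∞ := ENNReal.mul_ne_top (ENNReal.mul_ne_top (by norm_num) (bilConst_ne_top l))
    (ENNReal.rpow_ne_top_of_nonneg (by norm_num)
      (ENNReal.mul_ne_top (decayConst_lt_top hl).ne hM.ne))
  let D : ℝ := Kc.toReal + 1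
  have hD1 : 1 ≤ D := by simp [D]
  -- A nonlinearity of size (1 + |κ|²)^(1/2) becomes, after integration in time, a difference of
  -- size (1 + |κ|²)^(1/2 - 7/8), and 1/2 - 7/8 = -3/8 closes the loop. The factor 2 in 2D is what
  -- halves the norm.
  obtain ⟨μ, hμ, hμD⟩ := exists_const_mul_rpow_le hν (D := 2 * D) (by linarith)
  -- propagation of a bound of the nonlinearity
  have prop : ∀ B : ℝ, 0 ≤ B →
      (∀ᵐ τ ∂(volume.restrict (Ioi (0 : ℝ))), ∀ i,
        ‖bil l (z τ) (z τ) i - bil l (w τ) (w τ) i‖ ≤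
          B * (1 + modeSq l i) ^ (1 / 2 : ℝ) * Real.exp (μ * τ)) →
      ∀ᵐ t ∂(volume.restrict (Ioi (0 : ℝ))), ∀ i,
        ‖z t i - w t i‖ ≤ B / (2 * D) * Real.exp (μ * t) * (1 + modeSq l i) ^ (-(3 / 8) : ℝ) := by
    intro B hB hbil
    rw [ae_restrict_iff' measurableSet_Ioi] at hbil
    filter_upwards [hz, hw, ae_restrict_mem measurableSet_Ioi] with t hzt hwt ht i
    have ht0 : 0 ≤ t := le_of_lt ht
    have hx := modeSq_nonneg (l := l) i
    have hx1 : 0 < 1 + modeSq l i := by linarith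
    rw [hzt i, hwt i, add_sub_add_left_eq_sub,
      ← intervalIntegral.integral_sub
        (intervalIntegrable_duhamel hl hν hM hzm hzM ht0 i)
        (intervalIntegrable_duhamel hl hν hM hwm hwM ht0 i)]
    simp_rw [← mul_sub]
    have hpos : 0 < μ + ν * modeSq l i := by nlinarith
    have h1 := norm_duhamel_le (r := ν * modeSq l i) (μ := μ)
      (b := B * (1 + modeSq l i) ^ (1 / 2 : ℝ)) (t := t)
      (g := fun τ => bil l (z τ) (z τ) i - bil l (w τ) (w τ) i)
      (E := fun τ => Complex.exp ((t - τ : ℝ) * sym l ν C₁ i)) ht0 hpos (by positivity)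
      (fun τ => norm_exp_sym_eq ν C₁ t τ i)
      (by filter_upwards [hbil] with τ hτ hmem using hτ hmem.1 i)
    refine h1.trans ?_
    rw [div_le_iff₀ hpos]
    have h2 := hμD _ hx
    have e : (1 + modeSq l i) ^ (1 / 2 : ℝ) =
        (1 + modeSq l i) ^ (-(3 / 8) : ℝ) * (1 + modeSq l i) ^ (7 / 8 : ℝ) := by
      rw [← Real.rpow_add hx1]; norm_num
    rw [e]
    calc B * ((1 + modeSq l i) ^ (-(3 / 8) : ℝ) * (1 + modeSq l i) ^ (7 / 8 : ℝ)) *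
          Real.exp (μ * t)
        = B / (2 * D) * Real.exp (μ * t) * (1 + modeSq l i) ^ (-(3 / 8) : ℝ) *
          (2 * D * (1 + modeSq l i) ^ (7 / 8 : ℝ)) := by field_simp
      _ ≤ _ := by gcongr
  -- halving
  have halve : ∀ β : ℝ, 0 ≤ β →
      (∀ᵐ t ∂(volume.restrict (Ioi (0 : ℝ))), ∀ i,
        ‖z t i - w t i‖ ≤ β * Real.exp (μ * t) * (1 + modeSq l i) ^ (-(3 / 8) : ℝ)) →
      ∀ᵐ t ∂(volume.restrict (Ioi (0 : ℝ))), ∀ i,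
        ‖z t i - w t i‖ ≤ β / 2 * Real.exp (μ * t) * (1 + modeSq l i) ^ (-(3 / 8) : ℝ) := by
    intro β hβ h
    have hD0 : D ≠ 0 := by positivity
    have e : β / 2 = D * β / (2 * D) := by field_simp
    rw [e]
    apply prop _ (by positivity)
    filter_upwards [h, hzM, hwM] with τ hτ hz1 hw1 i
    have h3 := enorm_bil_sub_bil_le hl hM hz1 hw1
      (fun i => enorm_le_wt_of_norm_le (by positivity) (hτ i)) i
    have h4 := norm_le_of_enorm_le_wt (ENNReal.mul_ne_top ENNReal.ofReal_ne_top hKc) h3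
    refine h4.trans ?_
    rw [ENNReal.toReal_mul, ENNReal.toReal_ofReal (by positivity)]
    have hx1 : 0 ≤ 1 + modeSq l i := by linarith [modeSq_nonneg (l := l) i]
    calc β * Real.exp (μ * τ) * Kc.toReal * (1 + modeSq l i) ^ (1 / 2 : ℝ)
        ≤ β * Real.exp (μ * τ) * D * (1 + modeSq l i) ^ (1 / 2 : ℝ) := by
          gcongr; simp [D]
      _ = _ := by ring
  -- the first bound
  let c₀ : ℝ≥0∞ := bilConst l * (4 * (M * M)) ^ (1 / 2 : ℝ)
  have hc₀ : c₀ ≠ ∞ := ENNReal.mul_ne_top (bilConst_ne_top l)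
    (ENNReal.rpow_ne_top_of_nonneg (by norm_num)
      (ENNReal.mul_ne_top (by norm_num) (ENNReal.mul_ne_top hM.ne hM.ne)))
  let β₀ : ℝ := 2 * c₀.toReal / (2 * D)
  have start : ∀ᵐ t ∂(volume.restrict (Ioi (0 : ℝ))), ∀ i,
      ‖z t i - w t i‖ ≤ β₀ * Real.exp (μ * t) * (1 + modeSq l i) ^ (-(3 / 8) : ℝ) := by
    apply prop _ (by positivity)
    filter_upwards [hzM, hwM, ae_restrict_mem measurableSet_Ioi] with τ hz1 hw1 hτ i
    have hx1 : 0 ≤ 1 + modeSq l i := by linarith [modeSq_nonneg (l := l) i]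
    have hb : ∀ v : Mode → ℂ, l2sq (fun i => ‖v i‖ₑ) ≤ M →
        ‖bil l v v i‖ ≤ c₀.toReal * (1 + modeSq l i) ^ (1 / 2 : ℝ) := fun v hv =>
      norm_le_of_enorm_le_wt hc₀ ((enorm_bil_le_l2sq hl v v i).trans (by simp only [c₀]; gcongr))
    have h1 : 1 ≤ Real.exp (μ * τ) := Real.one_le_exp (mul_nonneg hμ.le (le_of_lt hτ))
    calc _ ≤ 2 * c₀.toReal * (1 + modeSq l i) ^ (1 / 2 : ℝ) * 1 := by
          refine (norm_sub_le _ _).trans ?_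
          linarith [hb _ hz1, hb _ hw1]
      _ ≤ _ := by gcongr
  have all : ∀ n : ℕ, ∀ᵐ t ∂(volume.restrict (Ioi (0 : ℝ))), ∀ i,
      ‖z t i - w t i‖ ≤ β₀ / 2 ^ n * Real.exp (μ * t) * (1 + modeSq l i) ^ (-(3 / 8) : ℝ) := by
    intro n
    induction n with
    | zero => simpa using start
    | succ n ih =>
      have := halve _ (by positivity) ih
      rwa [div_div, ← pow_succ] at this
  -- Each halving discards a null set of times, and there are only countably many of them.
  filter_upwards [ae_all_iff.2 all] with t ht
  funext i
  rw [← sub_eq_zero, ← norm_le_zero_iff]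
  have hlim : Tendsto (fun n : ℕ => β₀ / 2 ^ n * Real.exp (μ * t) *
      (1 + modeSq l i) ^ (-(3 / 8) : ℝ)) atTop (𝓝 0) := by
    have h0 : Tendsto (fun n : ℕ => β₀ / 2 ^ n) atTop (𝓝 0) :=
      tendsto_const_nhds.div_atTop (tendsto_pow_atTop_atTop_of_one_lt (by norm_num))
    simpa using (h0.mul_const (Real.exp (μ * t))).mul_const ((1 + modeSq l i) ^ (-(3 / 8) : ℝ))
  exact ge_of_tendsto' hlim fun n => ht n i

end Uniqueness

/-! ### Time-independent majorants and the gain of regularity -/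

section Smoothing

variable {l : ℝ}

/-- The square of the `H^r` norm of a sequence of coefficients. -/
def hsq (l r : ℝ) (a : Mode → ℝ≥0∞) : ℝ≥0∞ :=
  (∑' n, wt1 l n ^ r * a (.inl n) ^ 2) + ∑' k, wt2 l k ^ r * a (.inr k) ^ 2

/-- The square of a weak norm, with a weight decaying in the zonal direction. -/
def weakSq (l : ℝ) (f : ℤ × ℤ → ℝ≥0∞) : ℝ≥0∞ :=
  ∑' m : ℤ × ℤ, wt1 l m.1 ^ (-(1 / 8) : ℝ) * f m ^ 2

/-- The sum of squares which controls the majorant at `k` through the second factor. -/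
def localSq (l : ℝ) (f : ℤ × ℤ → ℝ≥0∞) (k : ℤ × ℤ) : ℝ≥0∞ :=
  (∑' h, wt2 l h ^ (-1 : ℝ) * f (k - h) ^ 2) + ∑' n, f (k.1, n) ^ 2

/-- The constant in the smoothing estimate. -/
def smoothConst (l : ℝ) : ℝ≥0∞ := 4 * sum2 l (3 / 2) + sum1 l (3 / 4)

theorem smoothConst_lt_top (hl : 0 < l) : smoothConst l < ∞ :=
  ENNReal.add_lt_top.2 ⟨ENNReal.mul_lt_top (by norm_num) (sum2_lt_top hl (by norm_num)),
    sum1_lt_top hl (by norm_num)⟩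

theorem tsum_localSq_le (f : ℤ × ℤ → ℝ≥0∞) :
    ∑' k, wt2 l k ^ (-(7 / 8) : ℝ) * localSq l f k ≤ smoothConst l * weakSq l f := by
  simp only [localSq, mul_add]
  rw [ENNReal.tsum_add, smoothConst, add_mul]
  exact add_le_add (tsum_wt2_mul_conv_le l fun m => f m ^ 2)
    (tsum_wt2_mul_fiber_le l fun m => f m ^ 2)

theorem sq_maj_inr_le (a b : Mode → ℝ≥0∞) (k : ℤ × ℤ) :
    maj l a b (.inr k) ^ 2 ≤ 2 * (l2sq a * localSq l (fun h => b (.inr h)) k) := by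
  simp only [maj]
  refine (enorm_add_sq_le _ _).trans ?_
  gcongr
  rw [localSq, mul_add]
  gcongr
  · refine (sq_conv_le l (fun h => a (.inr h)) (fun h => b (.inr h)) k).trans ?_
    gcongr
    exact le_add_self
  · refine (sq_fiber_conv_le (fun n => a (.inl n)) (fun h => b (.inr h)) k).trans ?_
    gcongr
    exact le_self_add

/-- The mean component of the majorant sees the eddy coefficients only. This is why a bound on the
enstrophy alone controls u. -/
theorem sq_maj_inl_le (a b : Mode → ℝ≥0∞) (n : ℤ) :
    maj l a b (.inl n) ^ 2 ≤ (∑' k, a (.inr k) ^ 2) * ∑' k, b (.inr k) ^ 2 := by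
  simp only [maj]
  refine (sq_conv_le l (fun h => a (.inr h)) (fun h => b (.inr h)) (0, n)).trans ?_
  refine mul_le_mul' le_rfl ?_
  calc _ ≤ ∑' h, 1 * b (.inr ((0, n) - h)) ^ 2 := by
        gcongr with h; exact wt2_rpow_le_one l h zero_lt_one
    _ = ∑' h, b (.inr h) ^ 2 := by
        simp_rw [one_mul]; exact tsum_sub_left (fun h => b (.inr h) ^ 2) (0, n)

theorem wt1_rpow_neg_le_one (n : ℤ) {a : ℝ} (ha : 0 < a) : wt1 l n ^ (-a) ≤ 1 := by
  rw [← wt2_zonal]; exact wt2_rpow_le_one l _ ha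

theorem weakSq_le (f : ℤ × ℤ → ℝ≥0∞) : weakSq l f ≤ ∑' k, f k ^ 2 := by
  refine ENNReal.tsum_le_tsum fun m => ?_
  calc _ ≤ 1 * f m ^ 2 := by gcongr; exact wt1_rpow_neg_le_one _ (by norm_num)
    _ = _ := one_mul _

/-- Square summability holds already with the weight exponent -7/8, whereas integration in time
supplies -1 for the squares. The difference 1/8 is the gain of regularity. -/
theorem tsum_inr_maj_le (a b : Mode → ℝ≥0∞) :
    ∑' k, wt2 l k ^ (-(7 / 8) : ℝ) * maj l a b (.inr k) ^ 2 ≤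
      2 * (l2sq a * (smoothConst l * l2sq b)) := by
  calc _ ≤ ∑' k, 2 * l2sq a *
        (wt2 l k ^ (-(7 / 8) : ℝ) * localSq l (fun h => b (.inr h)) k) := by
        refine ENNReal.tsum_le_tsum fun k => ?_
        calc _ ≤ wt2 l k ^ (-(7 / 8) : ℝ) *
              (2 * (l2sq a * localSq l (fun h => b (.inr h)) k)) := by
              gcongr; exact sq_maj_inr_le a b k
          _ = _ := by ring
    _ ≤ _ := by
        rw [ENNReal.tsum_mul_left, mul_assoc]
        gcongr
        refine (tsum_localSq_le _).trans ?_
        gcongr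
        exact (weakSq_le _).trans le_add_self

theorem tsum_inl_maj_le (a b : Mode → ℝ≥0∞) :
    ∑' n, wt1 l n ^ (-(7 / 8) : ℝ) * maj l a b (.inl n) ^ 2 ≤
      sum1 l (7 / 8) * (l2sq a * l2sq b) := by
  calc _ ≤ ∑' n, wt1 l n ^ (-(7 / 8) : ℝ) * (l2sq a * l2sq b) := by
        gcongr with n
        refine (sq_maj_inl_le a b n).trans ?_
        gcongr <;> exact le_add_self
    _ = _ := by rw [ENNReal.tsum_mul_right, sum1]

/-- Fractional Leibniz rule for the majorant: the weight of the output falls on one of the two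
factors. -/
theorem wt_rpow_mul_maj_le (a : Mode → ℝ≥0∞) {r : ℝ} (hr : 0 ≤ r) (i : Mode) :
    wt l i ^ r * maj l a a i ≤
      4 ^ r * (maj l (fun j => wt l j ^ r * a j) a i + maj l a (fun j => wt l j ^ r * a j) i) := by
  have conv : ∀ k, wt2 l k ^ r *
      (∑' h, a (.inr h) * wt2 l h ^ (-(1 / 2) : ℝ) * a (.inr (k - h))) ≤
      4 ^ r * ((∑' h, wt2 l h ^ r * a (.inr h) * wt2 l h ^ (-(1 / 2) : ℝ) * a (.inr (k - h))) +
        ∑' h, a (.inr h) * wt2 l h ^ (-(1 / 2) : ℝ) * (wt2 l (k - h) ^ r * a (.inr (k - h)))) := by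
    intro k
    rw [← ENNReal.tsum_add, ← ENNReal.tsum_mul_left, ← ENNReal.tsum_mul_left]
    refine ENNReal.tsum_le_tsum fun h => ?_
    calc _ ≤ (4 ^ r * (wt2 l h ^ r + wt2 l (k - h) ^ r)) *
          (a (.inr h) * wt2 l h ^ (-(1 / 2) : ℝ) * a (.inr (k - h))) := by
          gcongr; exact wt2_rpow_le l k h hr
      _ = _ := by ring
  rcases i with n | k
  · simp only [maj, wt, Sum.elim_inl, Sum.elim_inr]
    rw [← wt2_zonal]
    exact conv (0, n)
  · simp only [maj, wt, Sum.elim_inl, Sum.elim_inr]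
    have fib : wt2 l k ^ r * ∑' n, a (.inl n) * a (.inr (k - (0, n))) ≤
        4 ^ r * ((∑' n, wt1 l n ^ r * a (.inl n) * a (.inr (k - (0, n)))) +
          ∑' n, a (.inl n) * (wt2 l (k - (0, n)) ^ r * a (.inr (k - (0, n))))) := by
      rw [← ENNReal.tsum_add, ← ENNReal.tsum_mul_left, ← ENNReal.tsum_mul_left]
      refine ENNReal.tsum_le_tsum fun n => ?_
      calc _ ≤ (4 ^ r * (wt2 l (0, n) ^ r + wt2 l (k - (0, n)) ^ r)) *
            (a (.inl n) * a (.inr (k - (0, n)))) := by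
            gcongr; exact wt2_rpow_le l k (0, n) hr
        _ = _ := by rw [wt2_zonal]; ring
    rw [mul_add]
    refine (add_le_add (conv k) fib).trans (le_of_eq ?_)
    ring

theorem l2sq_wt_rpow_mul (a : Mode → ℝ≥0∞) (r : ℝ) :
    l2sq (fun j => wt l j ^ (r / 2) * a j) = hsq l r a := by
  simp only [l2sq, hsq, wt, Sum.elim_inl, Sum.elim_inr, mul_pow]
  have e : ∀ x : ℝ≥0∞, (x ^ (r / 2)) ^ 2 = x ^ r := fun x => by
    rw [← ENNReal.rpow_natCast, ← ENNReal.rpow_mul]; congr 1; push_cast; ring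
  simp_rw [e]

theorem hsq_mono {a b : Mode → ℝ≥0∞} {r r' : ℝ} (hr : r ≤ r') (h : ∀ i, a i ≤ b i) :
    hsq l r a ≤ hsq l r' b := by
  unfold hsq
  refine add_le_add (ENNReal.tsum_le_tsum fun n => ?_) (ENNReal.tsum_le_tsum fun k => ?_)
  · exact mul_le_mul' (ENNReal.rpow_le_rpow_of_exponent_le (one_le_wt1 l n) hr)
      (pow_le_pow_left' (h _) 2)
  · exact mul_le_mul' (ENNReal.rpow_le_rpow_of_exponent_le (one_le_wt2 l k) hr)
      (pow_le_pow_left' (h _) 2)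

theorem hsq_zero (a : Mode → ℝ≥0∞) : hsq l 0 a = l2sq a := by simp [hsq, l2sq]

theorem hsq_add_le (a b : Mode → ℝ≥0∞) (r : ℝ) :
    hsq l r (fun i => a i + b i) ≤ 2 * (hsq l r a + hsq l r b) := by
  have key : ∀ {ι : Type} (c x y : ι → ℝ≥0∞),
      ∑' n, c n * (x n + y n) ^ 2 ≤ 2 * (∑' n, c n * x n ^ 2 + ∑' n, c n * y n ^ 2) := by
    intro ι c x y
    rw [← ENNReal.tsum_add, ← ENNReal.tsum_mul_left]
    refine ENNReal.tsum_le_tsum fun n => ?_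
    calc _ ≤ c n * (2 * (x n ^ 2 + y n ^ 2)) := by gcongr; exact enorm_add_sq_le _ _
      _ = _ := by ring
  unfold hsq
  refine (add_le_add (key _ _ _) (key _ _ _)).trans (le_of_eq ?_)
  ring

theorem hsq_const_mul (c : ℝ≥0∞) (a : Mode → ℝ≥0∞) (r : ℝ) :
    hsq l r (fun i => c * a i) = c ^ 2 * hsq l r a := by
  unfold hsq
  simp_rw [mul_pow, mul_left_comm _ (c ^ 2), ENNReal.tsum_mul_left]
  ring

/-- The nonlinearity followed by the time integration gains regularity. -/
theorem hsq_maj_lt_top (hl : 0 < l) {a : Mode → ℝ≥0∞} {r : ℝ} (hr : 0 ≤ r)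
    (ha : hsq l r a < ∞) :
    hsq l (r + 1 / 8) (fun i => wt l i ^ (-(1 / 2) : ℝ) * maj l a a i) < ∞ := by
  have ha0 : l2sq a < ∞ := by
    rw [← hsq_zero (l := l)]; exact (hsq_mono hr fun _ => le_rfl).trans_lt ha
  let y : Mode → ℝ≥0∞ := fun j => wt l j ^ (r / 2) * a j
  have hy : l2sq y < ∞ := by simp only [y]; rw [l2sq_wt_rpow_mul]; exact ha
  have e : ∀ i, wt l i ^ (r + 1 / 8) * (wt l i ^ (-(1 / 2) : ℝ) * maj l a a i) ^ 2 ≤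
      2 * (4 ^ (r / 2)) ^ 2 * (wt l i ^ (-(7 / 8) : ℝ) * maj l y a i ^ 2 +
        wt l i ^ (-(7 / 8) : ℝ) * maj l a y i ^ 2) := by
    intro i
    -- The exponents balance as r + 1/8 - 1 = r - 7/8.
    have e1 : wt l i ^ (r + 1 / 8) * (wt l i ^ (-(1 / 2) : ℝ) * maj l a a i) ^ 2 =
        wt l i ^ (-(7 / 8) : ℝ) * (wt l i ^ (r / 2) * maj l a a i) ^ 2 := by
      rw [mul_pow, mul_pow, ← mul_assoc, ← mul_assoc, ← ENNReal.rpow_natCast (wt l i ^ _),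
        ← ENNReal.rpow_natCast (wt l i ^ (r / 2)), ← ENNReal.rpow_mul, ← ENNReal.rpow_mul,
        ← wt_rpow_add, ← wt_rpow_add]
      congr 2; push_cast; ring
    rw [e1]
    calc _ ≤ wt l i ^ (-(7 / 8) : ℝ) * (4 ^ (r / 2) * (maj l y a i + maj l a y i)) ^ 2 := 
          mul_le_mul' le_rfl (pow_le_pow_left' (wt_rpow_mul_maj_le a (by linarith) i) 2)
      _ = wt l i ^ (-(7 / 8) : ℝ) * (4 ^ (r / 2)) ^ 2 * (maj l y a i + maj l a y i) ^ 2 := by ring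
      _ ≤ wt l i ^ (-(7 / 8) : ℝ) * (4 ^ (r / 2)) ^ 2 *
          (2 * (maj l y a i ^ 2 + maj l a y i ^ 2)) := by gcongr; exact enorm_add_sq_le _ _
      _ = _ := by ring
  have hc : (2 * (4 ^ (r / 2)) ^ 2 : ℝ≥0∞) < ∞ := by
    refine ENNReal.mul_lt_top (by norm_num) (ENNReal.pow_lt_top ?_)
    exact ENNReal.rpow_lt_top_of_nonneg (by linarith) (by norm_num)
  unfold hsq
  refine ENNReal.add_lt_top.2 ⟨?_, ?_⟩
  · refine (ENNReal.tsum_le_tsum fun n => e (.inl n)).trans_lt ?_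
    rw [ENNReal.tsum_mul_left, ENNReal.tsum_add]
    have h1 := sum1_lt_top hl (p := 7 / 8) (by norm_num)
    refine ENNReal.mul_lt_top hc (ENNReal.add_lt_top.2
      ⟨(tsum_inl_maj_le y a).trans_lt ?_, (tsum_inl_maj_le a y).trans_lt ?_⟩)
    · exact ENNReal.mul_lt_top h1 (ENNReal.mul_lt_top hy ha0)
    · exact ENNReal.mul_lt_top h1 (ENNReal.mul_lt_top ha0 hy)
  · refine (ENNReal.tsum_le_tsum fun k => e (.inr k)).trans_lt ?_
    rw [ENNReal.tsum_mul_left, ENNReal.tsum_add]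
    have h1 := smoothConst_lt_top hl
    refine ENNReal.mul_lt_top hc (ENNReal.add_lt_top.2
      ⟨(tsum_inr_maj_le y a).trans_lt ?_, (tsum_inr_maj_le a y).trans_lt ?_⟩)
    · exact ENNReal.mul_lt_top (by norm_num) (ENNReal.mul_lt_top hy (ENNReal.mul_lt_top h1 ha0))
    · exact ENNReal.mul_lt_top (by norm_num) (ENNReal.mul_lt_top ha0 (ENNReal.mul_lt_top h1 hy))

/-- Square summable sequences that satisfy the integrated inequality inherit the regularity of the
data. -/
theorem hsq_lt_top_of_le (hl : 0 < l) {A Z : Mode → ℝ≥0∞} {C : ℝ≥0∞} (hC : C < ∞) {s : ℝ}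
    (hs : 0 ≤ s) (hA : hsq l s A < ∞) (hZ : l2sq Z < ∞)
    (h : ∀ i, Z i ≤ A i + C * (wt l i ^ (-(1 / 2) : ℝ) * maj l Z Z i)) : hsq l s Z < ∞ := by
  -- Bootstrap in steps of 1/8, capped at the regularity s of the data, so that finitely many passes
  -- suffice.
  have step : ∀ j : ℕ, hsq l (min s (j / 8)) Z < ∞ := by
    intro j
    induction j with
    | zero => simpa [hs, hsq_zero] using hZ
    | succ j ih =>
      have h1 := hsq_maj_lt_top hl (le_min hs (by positivity)) ih
      have h2 : min s (((j + 1 : ℕ) : ℝ) / 8) ≤ min s (j / 8) + 1 / 8 := by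
        push_cast
        rcases le_total s (j / 8) with h3 | h3
        · rw [min_eq_left h3]
          exact (min_le_left _ _).trans (by linarith)
        · rw [min_eq_right h3]
          exact (min_le_right _ _).trans (by linarith)
      refine (hsq_mono le_rfl h).trans_lt ((hsq_add_le _ _ _).trans_lt ?_)
      refine ENNReal.mul_lt_top (by norm_num) (ENNReal.add_lt_top.2
        ⟨(hsq_mono (min_le_left _ _) fun _ => le_rfl).trans_lt hA, ?_⟩)
      rw [hsq_const_mul]
      exact ENNReal.mul_lt_top (ENNReal.pow_lt_top hC)
        ((hsq_mono h2 fun _ => le_rfl).trans_lt h1)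
  obtain ⟨j, hj⟩ := exists_nat_ge (8 * s)
  have := step j
  rwa [min_eq_left (by linarith)] at this

/-- The sum of `wt2`⁻¹ over the plane lattice diverges logarithmically. The additional decay in
`m.1` restores convergence, since 1 splits as 7/16 + 9/16 and 1/8 + 7/16 = 9/16 > 1/2. This is the
reason for working with `weakSq`. -/
theorem tsum_zonal_mul_wt2_lt_top (hl : 0 < l) :
    ∑' m : ℤ × ℤ, wt1 l m.1 ^ (-(1 / 8) : ℝ) * wt2 l m ^ (-1 : ℝ) < ∞ := by
  have h : ∑' m : ℤ × ℤ, wt1 l m.1 ^ (-(1 / 8) : ℝ) * wt2 l m ^ (-1 : ℝ) ≤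
      sum1 l (9 / 16) * sum1 l (9 / 16) := by
    rw [sum1, ← tsum_mul_prod]
    refine ENNReal.tsum_le_tsum fun m => ?_
    have h1 := wt2_rpow_neg_le l m (a := 7 / 16) (b := 9 / 16) (by norm_num) (by norm_num)
    norm_num at h1
    calc _ ≤ wt1 l m.1 ^ (-(1 / 8) : ℝ) *
          (wt1 l m.1 ^ (-(7 / 16) : ℝ) * wt1 l m.2 ^ (-(9 / 16) : ℝ)) := by gcongr
      _ = _ := by rw [← mul_assoc, ← wt1_rpow_add]; norm_num
  have h1 := sum1_lt_top hl (p := 9 / 16) (by norm_num)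
  exact h.trans_lt (ENNReal.mul_lt_top h1 h1)

theorem tsum_mul_add_sq_lt_top {ι : Type*} {c x y : ι → ℝ≥0∞} (hx : ∑' n, c n * x n ^ 2 < ∞)
    (hy : ∑' n, c n * y n ^ 2 < ∞) : ∑' n, c n * (x n + y n) ^ 2 < ∞ := by
  have : ∑' n, c n * (x n + y n) ^ 2 ≤ 2 * (∑' n, c n * x n ^ 2 + ∑' n, c n * y n ^ 2) := by
    rw [← ENNReal.tsum_add, ← ENNReal.tsum_mul_left]
    refine ENNReal.tsum_le_tsum fun n => ?_
    calc _ ≤ c n * (2 * (x n ^ 2 + y n ^ 2)) := by gcongr; exact enorm_add_sq_le _ _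
      _ = _ := by ring
  exact this.trans_lt (ENNReal.mul_lt_top (by norm_num) (ENNReal.add_lt_top.2 ⟨hx, hy⟩))

theorem rpow_neg_half_sq (x : ℝ≥0∞) : (x ^ (-(1 / 2) : ℝ)) ^ 2 = x ^ (-1 : ℝ) := by
  rw [← ENNReal.rpow_natCast, ← ENNReal.rpow_mul]; norm_num

theorem rpow_half_sq (x : ℝ≥0∞) : (x ^ (1 / 2 : ℝ)) ^ 2 = x := by
  rw [← ENNReal.rpow_natCast, ← ENNReal.rpow_mul]; norm_num

/-- Trajectories with a bound on the enstrophy that satisfy the integrated inequality have a common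
square summable majorant. -/
theorem exists_majorant (hl : 0 < l) {A : Mode → ℝ≥0∞} {C M : ℝ≥0∞} (hA : l2sq A < ∞)
    (hC : C < ∞) (hM : M < ∞) :
    ∃ Z : Mode → ℝ≥0∞, l2sq Z < ∞ ∧ ∀ a : ℝ → Mode → ℝ≥0∞,
      (∀ t, ∑' k, a t (.inr k) ^ 2 ≤ M) →
      (∀ i b, (∀ τ, maj l (a τ) (a τ) i ≤ b) →
        ∀ t, a t i ≤ A i + C * (wt l i ^ (-(1 / 2) : ℝ) * b)) →
      ∀ t i, a t i ≤ Z i := by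
  have hA1 : ∑' n, A (.inl n) ^ 2 < ∞ := lt_of_le_of_lt le_self_add hA
  have hA2 : ∑' k, A (.inr k) ^ 2 < ∞ := lt_of_le_of_lt le_add_self hA
  -- First substitution: the mean flow is forced by ζ alone, so the bound M on the enstrophy
  -- controls it, and `wt1`⁻¹ is summable in one dimension.
  let U : ℤ → ℝ≥0∞ := fun n => A (.inl n) + C * (wt1 l n ^ (-(1 / 2) : ℝ) * (M * M) ^ (1 / 2 : ℝ))
  have hU : ∑' n, U n ^ 2 < ∞ := by
    have := tsum_mul_add_sq_lt_top (c := fun _ : ℤ => 1) (x := fun n => A (.inl n))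
      (y := fun n => C * (wt1 l n ^ (-(1 / 2) : ℝ) * (M * M) ^ (1 / 2 : ℝ))) (by simpa using hA1) ?_
    · simpa [U] using this
    · simp_rw [one_mul, mul_pow, rpow_neg_half_sq, rpow_half_sq]
      rw [ENNReal.tsum_mul_left, ENNReal.tsum_mul_right]
      exact ENNReal.mul_lt_top (ENNReal.pow_lt_top hC)
        (ENNReal.mul_lt_top (sum1_lt_top hl (by norm_num)) (ENNReal.mul_lt_top hM hM))
  let N : ℝ≥0∞ := ∑' n, U n ^ 2 + M
  have hN : N < ∞ := ENNReal.add_lt_top.2 ⟨hU, hM⟩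
  -- Second substitution: bounded majorants give eddy coefficients of order `wt2`^(-1/2) beyond the
  -- data. This narrowly fails to be in ℓ² but is finite in the weak norm.
  let Y : ℤ × ℤ → ℝ≥0∞ := fun k =>
    A (.inr k) + C * (wt2 l k ^ (-(1 / 2) : ℝ) * (4 * (N * N)) ^ (1 / 2 : ℝ))
  have hY : weakSq l Y < ∞ := by
    refine tsum_mul_add_sq_lt_top ?_ ?_
    · exact (weakSq_le fun k => A (.inr k)).trans_lt hA2
    · simp_rw [mul_pow, rpow_neg_half_sq, rpow_half_sq]
      have e : ∀ m : ℤ × ℤ, wt1 l m.1 ^ (-(1 / 8) : ℝ) *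
          (C ^ 2 * (wt2 l m ^ (-1 : ℝ) * (4 * (N * N)))) =
          (C ^ 2 * (4 * (N * N))) * (wt1 l m.1 ^ (-(1 / 8) : ℝ) * wt2 l m ^ (-1 : ℝ)) :=
        fun m => by ring
      simp_rw [e]
      rw [ENNReal.tsum_mul_left]
      exact ENNReal.mul_lt_top (ENNReal.mul_lt_top (ENNReal.pow_lt_top hC)
        (ENNReal.mul_lt_top (by norm_num) (ENNReal.mul_lt_top hN hN)))
        (tsum_zonal_mul_wt2_lt_top hl)
  -- Third substitution: the first factor is bounded in ℓ² by N at each time, and the second one by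
  -- Y at all times. The smoothing estimate turns the weak norm of Y into square summability.
  let V : ℤ × ℤ → ℝ≥0∞ := fun k =>
    A (.inr k) + C * (wt2 l k ^ (-(1 / 2) : ℝ) * (2 * (N * localSq l Y k)) ^ (1 / 2 : ℝ))
  have hV : ∑' k, V k ^ 2 < ∞ := by
    have := tsum_mul_add_sq_lt_top (c := fun _ : ℤ × ℤ => 1) (x := fun k => A (.inr k))
      (y := fun k => C * (wt2 l k ^ (-(1 / 2) : ℝ) * (2 * (N * localSq l Y k)) ^ (1 / 2 : ℝ)))
      (by simpa using hA2) ?_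
    · simpa [V] using this
    · simp_rw [one_mul, mul_pow, rpow_neg_half_sq, rpow_half_sq]
      have e : ∀ k, C ^ 2 * (wt2 l k ^ (-1 : ℝ) * (2 * (N * localSq l Y k))) ≤
          C ^ 2 * (2 * N) * (wt2 l k ^ (-(7 / 8) : ℝ) * localSq l Y k) := by
        intro k
        calc _ = C ^ 2 * (2 * N) * (wt2 l k ^ (-1 : ℝ) * localSq l Y k) := by ring
          _ ≤ _ := by
            gcongr C ^ 2 * (2 * N) * (?_ * localSq l Y k)
            exact ENNReal.rpow_le_rpow_of_exponent_le (one_le_wt2 l k) (by norm_num)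
      refine (ENNReal.tsum_le_tsum e).trans_lt ?_
      rw [ENNReal.tsum_mul_left]
      exact ENNReal.mul_lt_top (ENNReal.mul_lt_top (ENNReal.pow_lt_top hC)
        (ENNReal.mul_lt_top (by norm_num) hN)) ((tsum_localSq_le Y).trans_lt
        (ENNReal.mul_lt_top (smoothConst_lt_top hl) hY))
  refine ⟨Sum.elim U V, ?_, fun a ha hineq => ?_⟩
  · simp only [l2sq, Sum.elim_inl, Sum.elim_inr]
    exact ENNReal.add_lt_top.2 ⟨hU, hV⟩
  have h1 : ∀ t n, a t (.inl n) ≤ U n := fun t n => by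
    refine hineq (.inl n) _ (fun τ => le_rpow_half_of_sq_le ?_) t
    exact (sq_maj_inl_le _ _ n).trans (mul_le_mul' (ha τ) (ha τ))
  have h2 : ∀ t, l2sq (a t) ≤ N := fun t => by
    refine add_le_add (ENNReal.tsum_le_tsum fun n => ?_) (ha t)
    gcongr
    exact h1 t n
  have h3 : ∀ t k, a t (.inr k) ≤ Y k := fun t k => by
    refine hineq (.inr k) _ (fun τ => le_rpow_half_of_sq_le ?_) t
    refine (sq_maj_le l _ _ _).trans ?_
    gcongr <;> exact h2 τ
  have h4 : ∀ t k, a t (.inr k) ≤ V k := fun t k => by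
    refine hineq (.inr k) _ (fun τ => le_rpow_half_of_sq_le ?_) t
    refine (sq_maj_inr_le _ _ k).trans ?_
    gcongr 2 * (?_ * ?_)
    · exact h2 τ
    · unfold localSq
      gcongr <;> exact h3 τ _
  intro t i
  rcases i with n | k
  · exact h1 t n
  · exact h4 t k

end Smoothing

/-! ### The integrated inequality -/

section Integrated

variable {l : ℝ}

/-- The nonlinearity never excites an undamped mode: the mean of u is not forced because of the
outer derivative, and the zonal modes of ζ are not forced at all. Therefore the time integrals are
bounded uniformly in t. -/
theorem bil_eq_zero_or_gap (hl : 0 < l) (i : Mode) :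
    (∀ z w, bil l z w i = 0) ∨ 1 + modeSq l i ≤ gapConst l * modeSq l i := by
  rcases i with n | k
  · by_cases hn : n = 0
    · left; intro z w; simp [bil, hn, freq_zero]
    · right; exact one_add_freq_sq_le hl hn
  · by_cases hk : k.1 = 0
    · left; intro z w; simp [bil, hk]
    · right; exact one_add_freqSq_le hl fun h => hk (by simp [h])

/-- The constant in the integrated inequality. -/
def duhConst (l ν : ℝ) : ℝ≥0∞ := bilConst l * ENNReal.ofReal (gapConst l / ν)

theorem duhConst_lt_top (l ν : ℝ) : duhConst l ν < ∞ :=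
  ENNReal.mul_lt_top (bilConst_ne_top l).lt_top ENNReal.ofReal_lt_top

theorem duhConst_ne_zero (l : ℝ) {ν : ℝ} (hν : 0 < ν) : duhConst l ν ≠ 0 := by
  refine mul_ne_zero (zero_lt_one.trans_le (one_le_bilConst l)).ne' ?_
  have := one_le_gapConst l
  simp only [ne_eq, ENNReal.ofReal_eq_zero, not_le]
  positivity

theorem enorm_exp_mul_sym_le_one {ν C₁ t : ℝ} (hν : 0 < ν) (ht : 0 ≤ t) (i : Mode) :
    ‖Complex.exp (t * sym l ν C₁ i)‖ₑ ≤ 1 := by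
  rw [← ofReal_norm, norm_exp_mul_sym, ENNReal.ofReal_le_one, Real.exp_le_one_iff]
  have := mul_nonneg ht (mul_nonneg hν.le (modeSq_nonneg (l := l) i))
  linarith

/-- The forcing has size `wt`^(1/2) times the majorant, and by the spectral gap the damping
contributes a constant times `wt`^(-1). The net power is -1/2, with a constant independent of t. -/
theorem enorm_duhamel_le (hl : 0 < l) {ν C₁ : ℝ} (hν : 0 < ν) {c : ℂ} {z : ℝ → Mode → ℂ}
    {t : ℝ} (ht : 0 ≤ t) {i : Mode} {b : ℝ≥0∞}
    (hb : ∀ τ ∈ Ioc 0 t, maj l (fun j => ‖z τ j‖ₑ) (fun j => ‖z τ j‖ₑ) i ≤ b) :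
    ‖Complex.exp (t * sym l ν C₁ i) * c +
      ∫ τ in (0 : ℝ)..t, Complex.exp ((t - τ : ℝ) * sym l ν C₁ i) * bil l (z τ) (z τ) i‖ₑ ≤
    ‖c‖ₑ + duhConst l ν * (wt l i ^ (-(1 / 2) : ℝ) * b) := by
  have hg := one_le_gapConst l
  refine (enorm_add_le _ _).trans (add_le_add ?_ ?_)
  · rw [enorm_mul]
    calc _ ≤ 1 * ‖c‖ₑ := by gcongr; exact enorm_exp_mul_sym_le_one hν ht i
      _ = _ := one_mul _
  rcases bil_eq_zero_or_gap hl i with h0 | hgap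
  · simp [h0]
  by_cases hbt : b = ∞
  · have : duhConst l ν * (wt l i ^ (-(1 / 2) : ℝ) * b) = ∞ := by
      rw [hbt, ENNReal.mul_top, ENNReal.mul_top (duhConst_ne_zero l hν)]
      rw [ne_eq, ENNReal.rpow_eq_zero_iff]
      simp [wt_ne_zero, wt_ne_top]
    rw [this]; exact le_top
  have hm0 := modeSq_nonneg (l := l) i
  have hx1 : 0 < 1 + modeSq l i := by linarith
  have hmpos : 0 < modeSq l i := by
    rcases hm0.eq_or_lt with h | h
    · rw [← h] at hgap; linarith
    · exact h
  have hcb : bilConst l * b ≠ ∞ := ENNReal.mul_ne_top (bilConst_ne_top l) hbt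
  have h1 := norm_duhamel_le (r := ν * modeSq l i) (μ := 0)
    (b := (bilConst l * b).toReal * (1 + modeSq l i) ^ (1 / 2 : ℝ)) (t := t)
    (g := fun τ => bil l (z τ) (z τ) i)
    (E := fun τ => Complex.exp ((t - τ : ℝ) * sym l ν C₁ i)) ht (by positivity) (by positivity)
    (fun τ => norm_exp_sym_eq ν C₁ t τ i) (by
      refine Eventually.of_forall fun τ hτ => ?_
      rw [zero_mul, Real.exp_zero, mul_one]
      apply norm_le_of_enorm_le_wt hcb
      refine (enorm_bil_le hl _ _ i).trans ?_
      rw [mul_right_comm]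
      gcongr
      exact hb τ hτ)
  have h2 := enorm_le_wt_of_norm_le (l := l) (i := i) (p := -(1 / 2))
    (c := (bilConst l * b).toReal * (gapConst l / ν)) (by positivity) (h1.trans ?_)
  · refine h2.trans (le_of_eq ?_)
    rw [ENNReal.ofReal_mul ENNReal.toReal_nonneg, ENNReal.ofReal_toReal hcb, duhConst]
    ring
  · rw [zero_mul, Real.exp_zero, mul_one, zero_add, div_le_iff₀ (by positivity)]
    have e : (1 + modeSq l i) ^ (1 / 2 : ℝ) =
        (1 + modeSq l i) ^ (-(1 / 2) : ℝ) * (1 + modeSq l i) := by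
      rw [← Real.rpow_add_one hx1.ne']; norm_num
    rw [e]
    calc _ ≤ (bilConst l * b).toReal * ((1 + modeSq l i) ^ (-(1 / 2) : ℝ) *
          (gapConst l * modeSq l i)) := by gcongr
      _ = _ := by field_simp

end Integrated

/-! ### Passage to the limit in approximations -/

section Limit

/-- Tychonoff's theorem over the countably many pairs of an index and a rational time yields one
subsequence for all of them. The Lipschitz bound then carries the Cauchy property to real times. -/
theorem exists_subseq_tendsto {ι : Type*} [Countable ι] {Z L : ι → ℝ} {z : ℕ → ℝ → ι → ℂ}
    (hb : ∀ N t i, ‖z N t i‖ ≤ Z i)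
    (hL : ∀ N i s t, ‖z N s i - z N t i‖ ≤ L i * |s - t|) :
    ∃ φ : ℕ → ℕ, StrictMono φ ∧ ∃ w : ℝ → ι → ℂ,
      ∀ t i, Tendsto (fun N => z (φ N) t i) atTop (𝓝 (w t i)) := by
  have hK : IsCompact (Set.pi univ fun p : ι × ℚ => Metric.closedBall (0 : ℂ) (Z p.1)) :=
    isCompact_univ_pi fun p => isCompact_closedBall 0 (Z p.1)
  obtain ⟨a, -, φ, hφ, ha⟩ := hK.tendsto_subseq (x := fun N p => z N p.2 p.1)
    (fun N p _ => by simpa using hb N p.2 p.1)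
  rw [tendsto_pi_nhds] at ha
  have hc : ∀ t i, ∃ c, Tendsto (fun N => z (φ N) t i) atTop (𝓝 c) := by
    intro t i
    apply cauchySeq_tendsto_of_complete
    rw [Metric.cauchySeq_iff]
    intro ε hε
    have hL0 : 0 < |L i| + 1 := by positivity
    obtain ⟨q, hq1, hq2⟩ := exists_rat_btwn (show t < t + ε / 4 / (|L i| + 1) by
      linarith [show 0 < ε / 4 / (|L i| + 1) by positivity])
    have hnear : ∀ N, ‖z N t i - z N q i‖ ≤ ε / 4 := by
      intro N
      have habs : |t - q| ≤ ε / 4 / (|L i| + 1) := by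
        rw [abs_sub_comm, abs_of_pos (by linarith)]; linarith
      calc _ ≤ L i * |t - q| := hL N i t q
        _ ≤ (|L i| + 1) * (ε / 4 / (|L i| + 1)) := by
            gcongr
            linarith [le_abs_self (L i)]
        _ = ε / 4 := by field_simp
    obtain ⟨N₀, hN₀⟩ := Metric.cauchySeq_iff.1 (ha (i, q)).cauchySeq (ε / 4) (by positivity)
    refine ⟨N₀, fun m hm n hn => ?_⟩
    have h1 := hN₀ m hm n hn
    simp only [Function.comp_apply, dist_eq_norm] at h1
    have h2 := hnear (φ m)
    have h3 := hnear (φ n)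
    rw [norm_sub_rev] at h3
    rw [dist_eq_norm]
    calc ‖z (φ m) t i - z (φ n) t i‖
        = ‖(z (φ m) t i - z (φ m) q i) + (z (φ m) q i - z (φ n) q i) +
          (z (φ n) q i - z (φ n) t i)‖ := by congr 1; ring
      _ ≤ ‖z (φ m) t i - z (φ m) q i‖ + ‖z (φ m) q i - z (φ n) q i‖ +
          ‖z (φ n) q i - z (φ n) t i‖ := norm_add₃_le
      _ < ε := by linarith
  choose w hw using hc
  exact ⟨φ, hφ, w, hw⟩

theorem lt_top_of_l2sq_lt_top {Z : Mode → ℝ≥0∞} (hZ : l2sq Z < ∞) (i : Mode) : Z i < ∞ := by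
  have h : Z i ^ 2 ≤ l2sq Z := by
    rcases i with n | k
    · exact (ENNReal.le_tsum (f := fun n => Z (.inl n) ^ 2) n).trans le_self_add
    · exact (ENNReal.le_tsum (f := fun k => Z (.inr k) ^ 2) k).trans le_add_self
  by_contra h'
  rw [not_lt_top_iff] at h'
  rw [h'] at h
  simp at h
  exact hZ.ne h

variable {l : ℝ}

theorem norm_bil_le_of_majorant (hl : 0 < l) {Z : Mode → ℝ≥0∞} (hZ : l2sq Z < ∞) (i : Mode) :
    ∃ c : ℝ, 0 ≤ c ∧ ∀ v : Mode → ℂ, (∀ j, ‖v j‖ₑ ≤ Z j) → ‖bil l v v i‖ ≤ c := by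
  have hc : bilConst l * (4 * (l2sq Z * l2sq Z)) ^ (1 / 2 : ℝ) ≠ ∞ :=
    ENNReal.mul_ne_top (bilConst_ne_top l) (ENNReal.rpow_ne_top_of_nonneg (by norm_num)
      (ENNReal.mul_ne_top (by norm_num) (ENNReal.mul_ne_top hZ.ne hZ.ne)))
  have hx := modeSq_nonneg (l := l) i
  refine ⟨_, ?_, fun v hv => norm_le_of_enorm_le_wt (l := l) (i := i)
    (p := 1 / 2) hc ((enorm_bil_le_l2sq hl v v i).trans ?_)⟩
  · positivity
  · have := l2sq_mono hv
    gcongr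

/-- Uniformly dominated and equi-Lipschitz approximate solutions have a limit which solves the
Duhamel formula. -/
theorem exists_duhamel_of_approx (hl : 0 < l) {ν C₁ : ℝ} (hν : 0 < ν) {z₀ : Mode → ℂ}
    {Z : Mode → ℝ≥0∞} (hZ : l2sq Z < ∞) {z : ℕ → ℝ → Mode → ℂ} {L : Mode → ℝ}
    (hb : ∀ N t i, ‖z N t i‖ₑ ≤ Z i)
    (hL : ∀ N i s t, ‖z N s i - z N t i‖ ≤ L i * |s - t|)
    (hD : ∀ i t, 0 ≤ t → ∀ᶠ N in atTop, z N t i = Complex.exp (t * sym l ν C₁ i) * z₀ i +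
      ∫ τ in (0 : ℝ)..t,
        Complex.exp ((t - τ : ℝ) * sym l ν C₁ i) * bil l (z N τ) (z N τ) i) :
    ∃ φ : ℕ → ℕ, StrictMono φ ∧ ∃ w : ℝ → Mode → ℂ,
      (∀ t i, Tendsto (fun N => z (φ N) t i) atTop (𝓝 (w t i))) ∧
      (∀ i, Continuous fun t => w t i) ∧ (∀ t i, ‖w t i‖ₑ ≤ Z i) ∧
      ∀ t, 0 ≤ t → Duhamel l ν C₁ z₀ w t := by
  have hb' : ∀ N t i, ‖z N t i‖ ≤ (Z i).toReal := fun N t i => by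
    have := ENNReal.toReal_mono (lt_top_of_l2sq_lt_top hZ i).ne (hb N t i)
    simpa using this
  obtain ⟨φ, hφ, w, hw⟩ := exists_subseq_tendsto hb' hL
  have hwL : ∀ i s t, ‖w s i - w t i‖ ≤ L i * |s - t| := fun i s t =>
    le_of_tendsto' ((hw s i).sub (hw t i)).norm fun N => hL (φ N) i s t
  have cont_of_lip : ∀ {v : ℝ → Mode → ℂ} (i : Mode),
      (∀ s t, ‖v s i - v t i‖ ≤ L i * |s - t|) → Continuous fun t => v t i := by
    intro v i h
    refine (LipschitzWith.of_dist_le_mul (K := (L i).toNNReal) fun s t => ?_).continuous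
    rw [dist_eq_norm, Real.dist_eq]
    exact (h s t).trans (by gcongr; exact Real.le_coe_toNNReal _)
  have hwc : ∀ i, Continuous fun t => w t i := fun i => cont_of_lip i (hwL i)
  have hzc : ∀ N i, Continuous fun t => z N t i := fun N i => cont_of_lip i (hL N i)
  have hwb : ∀ t i, ‖w t i‖ₑ ≤ Z i := fun t i =>
    le_of_tendsto' ((continuous_enorm.tendsto _).comp (hw t i)) fun N => hb (φ N) t i
  refine ⟨φ, hφ, w, hw, hwc, hwb, fun t ht i => ?_⟩
  obtain ⟨c, hc0, hc⟩ := norm_bil_le_of_majorant hl hZ i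
  have hexp : Continuous fun τ : ℝ => Complex.exp ((t - τ : ℝ) * sym l ν C₁ i) := by fun_prop
  have hlim : Tendsto (fun N => ∫ τ in (0 : ℝ)..t,
      Complex.exp ((t - τ : ℝ) * sym l ν C₁ i) * bil l (z (φ N) τ) (z (φ N) τ) i) atTop
      (𝓝 (∫ τ in (0 : ℝ)..t,
        Complex.exp ((t - τ : ℝ) * sym l ν C₁ i) * bil l (w τ) (w τ) i)) := by
    refine intervalIntegral.tendsto_integral_filter_of_dominated_convergence (fun _ => c)
      (Eventually.of_forall fun N => ?_) (Eventually.of_forall fun N => ?_)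
      intervalIntegrable_const (Eventually.of_forall fun τ _ => ?_)
    · exact (hexp.mul (continuous_bil hl hZ (hzc (φ N)) (hb (φ N)) i)).aestronglyMeasurable
    · refine Eventually.of_forall fun τ hτ => ?_
      rw [uIoc_of_le ht] at hτ
      rw [norm_mul, norm_exp_sym_eq]
      have h1 : Real.exp (-(t - τ) * (ν * modeSq l i)) ≤ 1 := by
        rw [Real.exp_le_one_iff]
        have := mul_nonneg (sub_nonneg.2 hτ.2) (mul_nonneg hν.le (modeSq_nonneg (l := l) i))
        linarith
      calc _ ≤ 1 * c := by gcongr; exact hc _ (hb (φ N) τ)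
        _ = c := one_mul c
    · exact tendsto_const_nhds.mul (tendsto_bil hl hZ (fun j => hw τ j) (fun N j => hb (φ N) τ j) i)
  have hev := hφ.tendsto_atTop.eventually (hD i t ht)
  refine tendsto_nhds_unique (hw t i) ?_
  refine (hlim.const_add _).congr' ?_
  filter_upwards [hev] with N hN
  exact hN.symm

end Limit

/-! ### Cancellations for trigonometric polynomials -/

section Enstrophy

variable {l : ℝ}

/-- The frequencies of the mean flow kept in the truncation. -/
def box1 (N : ℕ) : Finset ℤ := Finset.Icc (-N : ℤ) N

/-- The frequencies of the eddies kept in the truncation. -/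
def box2 (N : ℕ) : Finset (ℤ × ℤ) := box1 N ×ˢ box1 N

theorem neg_mem_box1 {N : ℕ} {n : ℤ} : -n ∈ box1 N ↔ n ∈ box1 N := by
  simp only [box1, Finset.mem_Icc]; omega

theorem neg_mem_box2 {N : ℕ} {k : ℤ × ℤ} : -k ∈ box2 N ↔ k ∈ box2 N := by
  simp only [box2, Finset.mem_product, Prod.fst_neg, Prod.snd_neg, neg_mem_box1]

/-- Sequences supported in the truncation. -/
def InBox (N : ℕ) (z : Mode → ℂ) : Prop :=
  (∀ n ∉ box1 N, z (.inl n) = 0) ∧ ∀ k ∉ box2 N, z (.inr k) = 0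

/-- The transport term before the zonal correction. -/
def transport (l : ℝ) (N : ℕ) (z : Mode → ℂ) (k : ℤ × ℤ) : ℂ :=
  ∑ h ∈ box2 N, (kerF l k h : ℂ) * (z (.inr h) * z (.inr (k - h))) -
    Complex.I * freq l k.1 * ∑ n ∈ box1 N, z (.inl n) * z (.inr (k - (0, n)))

theorem bil_inr_eq {N : ℕ} {z : Mode → ℂ} (hz : InBox N z) (k : ℤ × ℤ) :
    bil l z z (.inr k) = if k.1 = 0 then 0 else transport l N z k := by
  simp only [bil, transport]
  rw [tsum_eq_sum (s := box2 N), tsum_eq_sum (s := box1 N)]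
  · intro n hn; rw [hz.1 n hn, zero_mul]
  · intro h hh; rw [hz.2 h hh, zero_mul, mul_zero]

theorem bil_inl_eq {N : ℕ} {z : Mode → ℂ} (hz : InBox N z) (n : ℤ) :
    bil l z z (.inl n) = -(Complex.I * freq l n) *
      ∑ h ∈ box2 N, (kerG l n h : ℂ) * (z (.inr h) * z (.inr ((0, n) - h))) := by
  simp only [bil]
  rw [tsum_eq_sum (s := box2 N)]
  intro h hh; rw [hz.2 h hh, zero_mul, mul_zero]

theorem tsum_eq_zero_of_antisymm {f : ℤ × ℤ → ℂ} (h : ℤ × ℤ) (hf : ∀ k, f (h - k) = -f k) :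
    ∑' k, f k = 0 := by
  have h1 := (Equiv.subLeft h).tsum_eq f
  simp only [Equiv.subLeft_apply, hf, tsum_neg] at h1
  exact self_eq_neg.1 h1.symm

/-- Incompressibility on the Fourier side: the involution k ↦ h - k exchanges the two vorticity
factors, while `kerF` is linear in k and vanishes at k = h, hence changes sign. The sum may be
extended to the whole lattice because the last factor is supported in the box. `sum_freq_cancel` is
the same argument for the mean flow. -/
theorem sum_kerF_cancel {N : ℕ} {z : Mode → ℂ} (hz : InBox N z) (h : ℤ × ℤ) :
    ∑ k ∈ box2 N, (kerF l k h : ℂ) * (z (.inr (k - h)) * z (.inr (-k))) = 0 := by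
  refine (tsum_eq_sum (L := SummationFilter.unconditional _) ?_).symm.trans ?_
  rotate_left
  · apply tsum_eq_zero_of_antisymm h
    intro k
    have e1 : h - k - h = -k := by abel
    have e2 : -(h - k) = k - h := by abel
    have e3 : kerF l (h - k) h = -kerF l k h := by
      simp only [kerF, Prod.fst_sub, Prod.snd_sub, freq_sub]; ring
    rw [e1, e2, e3]
    push_cast
    ring
  · intro k hk
    rw [hz.2 (-k) (by rwa [neg_mem_box2]), mul_zero, mul_zero]

theorem sum_freq_cancel {N : ℕ} {z : Mode → ℂ} (hz : InBox N z) (n : ℤ) :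
    ∑ k ∈ box2 N, (freq l k.1 : ℂ) * (z (.inr (k - (0, n))) * z (.inr (-k))) = 0 := by
  refine (tsum_eq_sum (L := SummationFilter.unconditional _) ?_).symm.trans ?_
  rotate_left
  · apply tsum_eq_zero_of_antisymm (0, n)
    intro k
    have e1 : (0, n) - k - (0, n) = -k := by abel
    have e2 : -((0, n) - k) = k - (0, n) := by abel
    have e3 : freq l ((0, n) - k).1 = -freq l k.1 := by
      simp [freq_neg]
    rw [e1, e2, e3]
    push_cast
    ring
  · intro k hk
    rw [hz.2 (-k) (by rwa [neg_mem_box2]), mul_zero, mul_zero]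

/-- The transport term is orthogonal to the vorticity. -/
theorem sum_conj_mul_transport {N : ℕ} {z : Mode → ℂ} (hz : InBox N z)
    (hherm : ∀ k, z (.inr (-k)) = conj (z (.inr k))) :
    ∑ k ∈ box2 N, conj (z (.inr k)) * transport l N z k = 0 := by
  simp only [transport, mul_sub, Finset.sum_sub_distrib, ← hherm]
  have h1 : ∑ k ∈ box2 N, z (.inr (-k)) *
      ∑ h ∈ box2 N, (kerF l k h : ℂ) * (z (.inr h) * z (.inr (k - h))) = 0 := by
    simp_rw [Finset.mul_sum]
    rw [Finset.sum_comm]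
    refine Finset.sum_eq_zero fun h _ => ?_
    calc _ = z (.inr h) *
          ∑ k ∈ box2 N, (kerF l k h : ℂ) * (z (.inr (k - h)) * z (.inr (-k))) := by
          rw [Finset.mul_sum]
          exact Finset.sum_congr rfl fun k _ => by ring
      _ = 0 := by rw [sum_kerF_cancel hz, mul_zero]
  have h2 : ∑ k ∈ box2 N, z (.inr (-k)) * (Complex.I * freq l k.1 *
      ∑ n ∈ box1 N, z (.inl n) * z (.inr (k - (0, n)))) = 0 := by
    simp_rw [Finset.mul_sum]
    rw [Finset.sum_comm]
    refine Finset.sum_eq_zero fun n _ => ?_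
    calc _ = Complex.I * z (.inl n) *
          ∑ k ∈ box2 N, (freq l k.1 : ℂ) * (z (.inr (k - (0, n))) * z (.inr (-k))) := by
          rw [Finset.mul_sum]
          exact Finset.sum_congr rfl fun k _ => by ring
      _ = 0 := by rw [sum_freq_cancel hz, mul_zero]
  rw [h1, h2, sub_zero]

/-- Enstrophy of the zonal part. -/
def zonalEnergy (N : ℕ) (z : Mode → ℂ) : ℝ :=
  ∑ k ∈ box2 N, if k.1 = 0 then ‖z (.inr k)‖ ^ 2 else 0

/-- Enstrophy of the eddies. -/
def eddyEnergy (N : ℕ) (z : Mode → ℂ) : ℝ :=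
  ∑ k ∈ box2 N, if k.1 = 0 then 0 else ‖z (.inr k)‖ ^ 2

/-- Dissipation of the zonal part. -/
def zonalGrad (l : ℝ) (N : ℕ) (z : Mode → ℂ) : ℝ :=
  ∑ k ∈ box2 N, if k.1 = 0 then freq l k.2 ^ 2 * ‖z (.inr k)‖ ^ 2 else 0

theorem tsum_zonal_eq (g : ℤ × ℤ → ℝ≥0∞) :
    ∑' n, g (0, n) = ∑' k : ℤ × ℤ, if k.1 = 0 then g k else 0 := by
  have hinj : Function.Injective (fun n : ℤ => ((0 : ℤ), n)) := Prod.mk_right_injective 0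
  rw [← hinj.tsum_eq]
  · simp
  · intro k hk
    refine ⟨k.2, Prod.ext ?_ rfl⟩
    by_contra hne
    exact hk (if_neg (Ne.symm hne))

/-- After Cauchy–Schwarz in n and h, the sum over n of the last factor depends on `h.1` only.
Keeping just the weight in `h.2` separates the two sums, and `sum1 l 1` is finite. -/
theorem tsum_zonal_triple_le (a : ℤ → ℝ≥0∞) (η : ℤ × ℤ → ℝ≥0∞) :
    (∑' n, a n * ∑' h, η h * wt2 l h ^ (-(1 / 2) : ℝ) * η ((0, n) - h)) ^ 2 ≤
      (∑' n, a n ^ 2) * (sum1 l 1 * (∑' k, η k ^ 2) ^ 2) := by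
  refine (sq_tsum_mul_le _ _).trans (mul_le_mul' le_rfl ?_)
  calc ∑' n, (∑' h, η h * wt2 l h ^ (-(1 / 2) : ℝ) * η ((0, n) - h)) ^ 2
      ≤ ∑' n, (∑' k, η k ^ 2) * ∑' h, wt2 l h ^ (-1 : ℝ) * η ((0, n) - h) ^ 2 :=
        ENNReal.tsum_le_tsum fun n => sq_conv_le l η η (0, n)
    _ = (∑' k, η k ^ 2) * ∑' h, wt2 l h ^ (-1 : ℝ) * ∑' n, η ((0, n) - h) ^ 2 := by
        rw [ENNReal.tsum_mul_left, ENNReal.tsum_comm]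
        simp_rw [ENNReal.tsum_mul_left]
    _ ≤ (∑' k, η k ^ 2) * ∑' h : ℤ × ℤ, (∑' n, η (-h.1, n) ^ 2) * wt1 l h.2 ^ (-1 : ℝ) := by
        refine mul_le_mul' le_rfl (ENNReal.tsum_le_tsum fun h => ?_)
        have e : ∑' n, η ((0, n) - h) ^ 2 = ∑' n, η (-h.1, n) ^ 2 := by
          rw [← (Equiv.subRight h.2).tsum_eq (fun n => η (-h.1, n) ^ 2)]
          refine tsum_congr fun n => ?_
          congr 2
          ext <;> simp
        rw [e, mul_comm]
        exact mul_le_mul' le_rfl (rpow_neg_anti zero_le_one (wt1_snd_le l h))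
    _ = (∑' k, η k ^ 2) * ((∑' k, η k ^ 2) * sum1 l 1) := by
        have e := (Equiv.neg ℤ).tsum_eq (fun j => ∑' n, η (j, n) ^ 2)
        simp only [Equiv.neg_apply] at e
        rw [tsum_mul_prod (fun j => ∑' n, η (-j, n) ^ 2) (fun n => wt1 l n ^ (-1 : ℝ)), e,
          ← ENNReal.tsum_prod (f := fun j n => η (j, n) ^ 2), sum1]
    _ = _ := by ring

theorem ofReal_sum_eq_tsum {s : Finset (ℤ × ℤ)} {f : ℤ × ℤ → ℝ} (hf : ∀ k, 0 ≤ f k)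
    (h0 : ∀ k ∉ s, f k = 0) : ∑' k, ENNReal.ofReal (f k) = ENNReal.ofReal (∑ k ∈ s, f k) := by
  rw [tsum_eq_sum (s := s) fun k hk => by rw [h0 k hk, ENNReal.ofReal_zero],
    ENNReal.ofReal_sum_of_nonneg fun k _ => hf k]

/-- The constant in the enstrophy estimate. -/
def enstrophyConst (l : ℝ) : ℝ := gapConst l * (sum1 l 1).toReal ^ (1 / 2 : ℝ)

theorem zonalGrad_nonneg (N : ℕ) (z : Mode → ℂ) : 0 ≤ zonalGrad l N z :=
  Finset.sum_nonneg fun k _ => by split_ifs <;> positivity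

theorem eddyEnergy_nonneg (N : ℕ) (z : Mode → ℂ) : 0 ≤ eddyEnergy N z :=
  Finset.sum_nonneg fun k _ => by split_ifs <;> positivity

theorem zonalEnergy_nonneg (N : ℕ) (z : Mode → ℂ) : 0 ≤ zonalEnergy N z :=
  Finset.sum_nonneg fun k _ => by split_ifs <;> positivity

/-- For zonal output the kernel is proportional to `freq l h.1`, so zonal h do not contribute. The
factor `freq l n` is kept apart because the dissipation of the zonal part will pay for it. -/
theorem enorm_kerF_zonal_le (hl : 0 < l) (n : ℤ) (h : ℤ × ℤ) :
    ‖(kerF l (0, n) h : ℂ)‖ₑ ≤ ‖freq l n‖ₑ * (if h.1 = 0 then 0 else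
      ENNReal.ofReal (gapConst l) * wt2 l h ^ (-(1 / 2) : ℝ)) := by
  have e : (kerF l (0, n) h : ℂ) = -(freq l n : ℂ) * ((freq l h.1 / freqSq l h : ℝ) : ℂ) := by
    simp only [kerF, freq_zero]; push_cast; ring
  rw [e, enorm_mul, enorm_neg]
  have e2 : ‖(freq l n : ℂ)‖ₑ = ‖freq l n‖ₑ := by
    rw [← ofReal_norm, ← ofReal_norm, Complex.norm_real]
  rw [e2]
  gcongr
  split_ifs with h1
  · simp [h1, freq_zero]
  have hh : h ≠ 0 := fun h0 => h1 (by simp [h0])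
  have hg := one_le_gapConst l
  have hp := freqSq_pos hl hh
  have h2 := one_add_freqSq_le hl hh
  have key := enorm_ofReal_le_wt2 (l := l) (x := freq l h.1 / freqSq l h) (c := gapConst l)
    (by positivity) (k := 0) (h := h)
  have hw : wt2 l 0 = 1 := by simp [wt2, freqSq_zero]
  rw [hw, ENNReal.one_rpow, mul_one] at key
  apply key
  rw [freqSq_zero, div_pow, div_mul_eq_mul_div, div_le_iff₀ (by positivity)]
  have e1 : freq l h.1 ^ 2 ≤ freqSq l h := by unfold freqSq; nlinarith [sq_nonneg (freq l h.2)]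
  calc freq l h.1 ^ 2 * (1 + freqSq l h) ≤ freqSq l h * (gapConst l * freqSq l h) := by gcongr
    _ = gapConst l * freqSq l h ^ 2 := by ring
    _ ≤ gapConst l ^ 2 * freqSq l h ^ 2 := by gcongr; exact le_self_pow₀ hg (by norm_num)
    _ = _ := by ring

/-- The only source of eddy enstrophy is the zonal part of the vorticity. -/
theorem abs_sum_re_conj_mul_bil_le (hl : 0 < l) {N : ℕ} {z : Mode → ℂ} (hz : InBox N z)
    (hherm : ∀ k, z (.inr (-k)) = conj (z (.inr k))) :
    |∑ k ∈ box2 N, (conj (z (.inr k)) * bil l z z (.inr k)).re| ≤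
      enstrophyConst l * Real.sqrt (zonalGrad l N z) * eddyEnergy N z := by
  let X : ℂ := ∑ k ∈ box2 N, conj (z (.inr k)) * bil l z z (.inr k)
  -- The full transport does no work. What is left in X is minus its work on the zonal modes, where
  -- `bil` omits it.
  have hX : X = -∑ k ∈ box2 N, if k.1 = 0 then conj (z (.inr k)) * transport l N z k else 0 := by
    rw [eq_neg_iff_add_eq_zero, ← Finset.sum_add_distrib]
    refine Eq.trans ?_ (sum_conj_mul_transport (l := l) hz hherm)
    refine Finset.sum_congr rfl fun k _ => ?_
    rw [bil_inr_eq hz]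
    split_ifs <;> simp
  let a : ℤ → ℝ≥0∞ := fun n => ‖z (.inr (0, n))‖ₑ * ‖freq l n‖ₑ
  let η : ℤ × ℤ → ℝ≥0∞ := fun k => if k.1 = 0 then 0 else ‖z (.inr k)‖ₑ
  have hT : ∀ n, ‖transport l N z (0, n)‖ₑ ≤ ENNReal.ofReal (gapConst l) * ‖freq l n‖ₑ *
      ∑' h, η h * wt2 l h ^ (-(1 / 2) : ℝ) * η ((0, n) - h) := by
    intro n
    simp only [transport, freq_zero, Complex.ofReal_zero, mul_zero, zero_mul, sub_zero]
    calc _ ≤ ∑ h ∈ box2 N, ‖(kerF l (0, n) h : ℂ) * (z (.inr h) * z (.inr ((0, n) - h)))‖ₑ :=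
          enorm_sum_le _ _
      _ ≤ ∑ h ∈ box2 N, ENNReal.ofReal (gapConst l) * ‖freq l n‖ₑ *
          (η h * wt2 l h ^ (-(1 / 2) : ℝ) * η ((0, n) - h)) := by
          refine Finset.sum_le_sum fun h _ => ?_
          rw [enorm_mul, enorm_mul]
          refine (mul_le_mul' (enorm_kerF_zonal_le hl n h) le_rfl).trans ?_
          by_cases h1 : h.1 = 0
          · simp [h1]
          -- For zonal output the two interacting frequencies have opposite first components, so
          -- both are eddies.
          · have h2 : ((0, n) - h).1 ≠ 0 := by simpa using h1
            simp only [η, if_neg h1, if_neg h2]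
            exact le_of_eq (by ring)
      _ ≤ _ := by
          rw [← Finset.mul_sum]
          gcongr
          exact ENNReal.sum_le_tsum _
  have hXle : ‖X‖ₑ ≤ ENNReal.ofReal (gapConst l) *
      ∑' n, a n * ∑' h, η h * wt2 l h ^ (-(1 / 2) : ℝ) * η ((0, n) - h) := by
    rw [hX, enorm_neg]
    calc _ ≤ ∑ k ∈ box2 N,
          ‖if k.1 = 0 then conj (z (.inr k)) * transport l N z k else 0‖ₑ := enorm_sum_le _ _
      _ ≤ ∑' k : ℤ × ℤ, if k.1 = 0 then ‖conj (z (.inr k)) * transport l N z k‖ₑ else 0 := by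
          refine (ENNReal.sum_le_tsum _).trans (le_of_eq (tsum_congr fun k => ?_))
          split_ifs <;> simp
      _ = ∑' n, ‖conj (z (.inr (0, n))) * transport l N z (0, n)‖ₑ :=
          (tsum_zonal_eq fun k => ‖conj (z (.inr k)) * transport l N z k‖ₑ).symm
      _ ≤ ∑' n, ENNReal.ofReal (gapConst l) *
          (a n * ∑' h, η h * wt2 l h ^ (-(1 / 2) : ℝ) * η ((0, n) - h)) := by
          refine ENNReal.tsum_le_tsum fun n => ?_
          rw [enorm_mul, RCLike.enorm_conj]
          refine (mul_le_mul' le_rfl (hT n)).trans (le_of_eq ?_)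
          simp only [a]
          ring
      _ = _ := ENNReal.tsum_mul_left
  have ha : ∑' n, a n ^ 2 = ENNReal.ofReal (zonalGrad l N z) := by
    rw [zonalGrad, ← ofReal_sum_eq_tsum]
    · calc ∑' n, a n ^ 2 = ∑' n, (fun k : ℤ × ℤ =>
            ENNReal.ofReal (freq l k.2 ^ 2 * ‖z (.inr k)‖ ^ 2)) (0, n) := by
            refine tsum_congr fun n => ?_
            simp only [a]
            rw [← ofReal_norm, ← ofReal_norm, ← ENNReal.ofReal_mul (norm_nonneg _),
              ← ENNReal.ofReal_pow (by positivity), mul_pow, Real.norm_eq_abs, sq_abs, mul_comm]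
        _ = _ := by
            rw [tsum_zonal_eq fun k : ℤ × ℤ =>
              ENNReal.ofReal (freq l k.2 ^ 2 * ‖z (.inr k)‖ ^ 2)]
            refine tsum_congr fun k => ?_
            split_ifs <;> simp
    · intro k; split_ifs <;> positivity
    · intro k hk; rw [hz.2 k hk]; simp
  have hη : ∑' k, η k ^ 2 = ENNReal.ofReal (eddyEnergy N z) := by
    rw [eddyEnergy, ← ofReal_sum_eq_tsum]
    · refine tsum_congr fun k => ?_
      simp only [η]
      split_ifs
      · simp
      · rw [← ofReal_norm, ENNReal.ofReal_pow (norm_nonneg _)]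
    · intro k; split_ifs <;> positivity
    · intro k hk; rw [hz.2 k hk]; simp
  have hS := (sum1_lt_top hl (p := 1) (by norm_num)).ne
  have hg := one_le_gapConst l
  have hsq : ‖X‖ₑ ^ 2 ≤ ENNReal.ofReal
      ((enstrophyConst l * Real.sqrt (zonalGrad l N z) * eddyEnergy N z) ^ 2) := by
    calc ‖X‖ₑ ^ 2 ≤ (ENNReal.ofReal (gapConst l) *
          ∑' n, a n * ∑' h, η h * wt2 l h ^ (-(1 / 2) : ℝ) * η ((0, n) - h)) ^ 2 := by
          gcongr
      _ ≤ ENNReal.ofReal (gapConst l) ^ 2 *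
          ((∑' n, a n ^ 2) * (sum1 l 1 * (∑' k, η k ^ 2) ^ 2)) := by
          rw [mul_pow]; gcongr; exact tsum_zonal_triple_le a η
      _ = _ := by
          rw [ha, hη, ← ENNReal.ofReal_toReal hS, ← ENNReal.ofReal_pow (by positivity),
            ← ENNReal.ofReal_pow (eddyEnergy_nonneg _ _),
            ← ENNReal.ofReal_mul ENNReal.toReal_nonneg,
            ← ENNReal.ofReal_mul (zonalGrad_nonneg _ _), ← ENNReal.ofReal_mul (by positivity)]
          congr 1
          have e1 : ((sum1 l 1).toReal ^ (1 / 2 : ℝ)) ^ 2 = (sum1 l 1).toReal := by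
            rw [← Real.rpow_natCast, ← Real.rpow_mul ENNReal.toReal_nonneg]; norm_num
          rw [enstrophyConst, mul_pow, mul_pow, mul_pow, e1, Real.sq_sqrt (zonalGrad_nonneg _ _)]
          ring
  have hre : ∑ k ∈ box2 N, (conj (z (.inr k)) * bil l z z (.inr k)).re = X.re := by
    simp [X]
  rw [hre]
  refine (Complex.abs_re_le_norm X).trans ?_
  have hpos : 0 ≤ enstrophyConst l * Real.sqrt (zonalGrad l N z) * eddyEnergy N z := by
    have := eddyEnergy_nonneg N z
    unfold enstrophyConst
    positivity
  rw [← ofReal_norm, ← ENNReal.ofReal_pow (norm_nonneg _),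
    ENNReal.ofReal_le_ofReal_iff (by positivity)] at hsq
  exact le_of_sq_le_sq hsq hpos

end Enstrophy

/-! ### Ordinary differential equations with a cutoff -/

section CutoffODE

variable {ι : Type*} [Fintype ι]

/-- A smooth cutoff which is one where the energy is at most `R`. -/
def cutoff (R : ℝ) (y : ι → ℂ) : ℝ := Real.smoothTransition (R + 1 - ∑ i, ‖y i‖ ^ 2)

theorem cutoff_nonneg (R : ℝ) (y : ι → ℂ) : 0 ≤ cutoff R y := Real.smoothTransition.nonneg _

theorem cutoff_le_one (R : ℝ) (y : ι → ℂ) : cutoff R y ≤ 1 := Real.smoothTransition.le_one _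

theorem cutoff_eq_one {R : ℝ} {y : ι → ℂ} (h : ∑ i, ‖y i‖ ^ 2 ≤ R) : cutoff R y = 1 :=
  Real.smoothTransition.one_of_one_le (by linarith)

theorem contDiff_cutoff (R : ℝ) : ContDiff ℝ 1 (cutoff R : (ι → ℂ) → ℝ) := by
  refine Real.smoothTransition.contDiff.comp (contDiff_const.sub (ContDiff.sum fun i _ => ?_))
  exact (contDiff_apply ℝ ℂ i).norm_sq ℝ

theorem hasCompactSupport_cutoff_smul (R : ℝ) (f : (ι → ℂ) → (ι → ℂ)) :
    HasCompactSupport fun y => cutoff R y • f y := by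
  refine HasCompactSupport.intro (isCompact_closedBall (0 : ι → ℂ) (Real.sqrt (R + 1)))
    fun y hy => ?_
  suffices h : cutoff R y = 0 by rw [h, zero_smul]
  apply Real.smoothTransition.zero_of_nonpos
  by_contra hlt
  push Not at hlt
  apply hy
  rw [mem_closedBall_zero_iff, pi_norm_le_iff_of_nonneg (Real.sqrt_nonneg _)]
  intro i
  apply Real.le_sqrt_of_sq_le
  have : ‖y i‖ ^ 2 ≤ ∑ i, ‖y i‖ ^ 2 :=
    Finset.single_le_sum (f := fun i => ‖y i‖ ^ 2) (fun i _ => by positivity) (Finset.mem_univ i)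
  linarith

/-- The equation with cutoff has a solution on every time interval, which inherits the symmetries
of the equation. -/
theorem exists_cutoff_solution {f : (ι → ℂ) → (ι → ℂ)} (hf : ContDiff ℝ 1 f) (R : ℝ) {T : ℝ}
    (hT : 0 ≤ T) (x₀ : ι → ℂ) :
    ∃ x : ℝ → ι → ℂ, x 0 = x₀ ∧
      (∀ t ∈ Icc 0 T, HasDerivWithinAt x (cutoff R (x t) • f (x t)) (Icc 0 T) t) ∧
      ∀ σ : (ι → ℂ) →L[ℝ] (ι → ℂ), (∀ y, ∑ i, ‖σ y i‖ ^ 2 = ∑ i, ‖y i‖ ^ 2) →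
        (∀ y, f (σ y) = σ (f y)) → σ x₀ = x₀ → ∀ t ∈ Icc 0 T, σ (x t) = x t := by
  let g : (ι → ℂ) → (ι → ℂ) := fun y => cutoff R y • f y
  have hg : ContDiff ℝ 1 g := (contDiff_cutoff R).smul hf
  have hgs : HasCompactSupport g := hasCompactSupport_cutoff_smul R f
  obtain ⟨K, hK⟩ := ContDiff.lipschitzWith_of_hasCompactSupport hgs hg one_ne_zero
  obtain ⟨B, hB⟩ := hgs.exists_bound_of_continuous hg.continuous
  have hB0 : 0 ≤ B := (norm_nonneg _).trans (hB 0)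
  let L : ℝ≥0 := ⟨B, hB0⟩
  let a : ℝ≥0 := L * ⟨T, hT⟩
  -- The field is globally bounded and Lipschitz. A ball of radius bound times T cannot be left
  -- before time T, so one application of Picard–Lindelöf covers the whole interval.
  have hpl : IsPicardLindelof (fun _ => g) (⟨0, ⟨le_rfl, hT⟩⟩ : Icc (0 : ℝ) T) x₀ a 0 L K :=
    IsPicardLindelof.of_time_independent (fun x _ => hB x) hK.lipschitzOnWith (by
      simp only [sub_zero, sub_self, max_eq_left hT, NNReal.coe_zero, a]
      exact le_rfl)
  obtain ⟨x, hx0, hx⟩ := hpl.exists_eq_forall_mem_Icc_hasDerivWithinAt₀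
  refine ⟨x, hx0, hx, fun σ hσ hfσ hσ0 => ?_⟩
  have hgσ : ∀ y, g (σ y) = σ (g y) := fun y => by
    simp only [g, cutoff, hσ, hfσ, map_smul]
  have hxc : ContinuousOn x (Icc 0 T) := fun t ht => (hx t ht).continuousWithinAt
  have hnhds : ∀ t ∈ Ico 0 T, Icc 0 T ∈ 𝓝[≥] t := fun t ht =>
    mem_nhdsWithin.2 ⟨Iio T, isOpen_Iio, ht.2, fun s hs => ⟨ht.1.trans hs.2, le_of_lt hs.1⟩⟩
  have hx' : ∀ t ∈ Ico 0 T, HasDerivWithinAt x (g (x t)) (Ici t) t := fun t ht =>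
    (hx t ⟨ht.1, ht.2.le⟩).mono_of_mem_nhdsWithin (hnhds t ht)
  refine ODE_solution_unique (v := fun _ => g) (K := K) (fun _ => hK)
    (σ.continuous.comp_continuousOn hxc) (fun t ht => ?_) hxc hx' ?_
  · have := σ.hasFDerivAt.comp_hasDerivWithinAt t (hx' t ht)
    simp only [hgσ]
    exact this
  · have e : x 0 = x₀ := hx0
    rw [e, hσ0]

end CutoffODE

/-! ### Reflection symmetry -/

section Reflection

variable {l : ℝ}

/-- The opposite frequency. -/
def flip : Mode → Mode := Sum.map Neg.neg Neg.neg

/-- Complex conjugation in physical space. -/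
def reflect (z : Mode → ℂ) : Mode → ℂ := fun i => conj (z (flip i))

theorem flip_flip (i : Mode) : flip (flip i) = i := by
  rcases i with n | k <;> simp [flip]

theorem sym_flip (ν C₁ : ℝ) (i : Mode) : sym l ν C₁ (flip i) = conj (sym l ν C₁ i) := by
  rcases i with n | k
  · simp [sym, flip, freq_neg]
  · simp only [sym, flip, Sum.map_inr, Sum.elim_inr, symbol2, dx, invLap_eq]
    simp [freqSq, freq_neg, sub_eq_add_neg]

theorem conj_tsum' {ι : Type*} (f : ι → ℂ) : conj (∑' i, f i) = ∑' i, conj (f i) :=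
  Complex.conjCLE.map_tsum

/-- The equation is real: the kernels are even under simultaneous reversal of both frequencies, and
the derivative symbols are unchanged by reversal followed by conjugation. -/
theorem bil_reflect (z : Mode → ℂ) (i : Mode) :
    bil l (reflect z) (reflect z) i = conj (bil l z z (flip i)) := by
  have hker : ∀ k h : ℤ × ℤ, kerF l (-k) (-h) = kerF l k h := fun k h => by
    simp [kerF, freqSq, freq_neg]
  have hkerG : ∀ (n : ℤ) (h : ℤ × ℤ), kerG l (-n) (-h) = kerG l n h := fun n h => by
    simp only [kerG, freqSq, Prod.fst_neg, Prod.snd_neg, Prod.fst_sub, Prod.snd_sub, freq_neg,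
      freq_sub, freq_zero]
    ring
  rcases i with n | k
  · simp only [bil, flip, reflect, Sum.map_inl, Sum.map_inr, map_mul, map_neg, conj_tsum',
      Complex.conj_I, Complex.conj_ofReal, freq_neg]
    rw [← (Equiv.neg (ℤ × ℤ)).tsum_eq (fun h => (kerG l (-n) h : ℂ) *
      (conj (z (.inr h)) * conj (z (.inr ((0, -n) - h)))))]
    congr 1
    · push_cast; ring
    · refine tsum_congr fun h => ?_
      have e2 : ((0, -n) : ℤ × ℤ) - -h = -((0, n) - h) := by ext <;> simp; ring
      simp only [Equiv.neg_apply, hkerG, e2]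
  · simp only [bil, flip, reflect, Sum.map_inl, Sum.map_inr, Prod.fst_neg, neg_eq_zero]
    split_ifs
    · simp
    simp only [map_sub, map_mul, conj_tsum', Complex.conj_I, Complex.conj_ofReal, freq_neg]
    rw [← (Equiv.neg (ℤ × ℤ)).tsum_eq (fun h => (kerF l (-k) h : ℂ) *
      (conj (z (.inr h)) * conj (z (.inr (-k - h))))),
      ← (Equiv.neg ℤ).tsum_eq (fun n => conj (z (.inl n)) * conj (z (.inr (-k - (0, n)))))]
    congr 1
    · refine tsum_congr fun h => ?_
      have e2 : -k - -h = -(k - h) := by abel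
      simp only [Equiv.neg_apply, hker, e2]
    · congr 1
      · push_cast; ring
      · refine tsum_congr fun n => ?_
        have e2 : -k - (0, -n) = -(k - (0, n)) := by ext <;> simp; ring
        simp only [Equiv.neg_apply, e2]

end Reflection

/-! ### The Duhamel formula of an ordinary differential equation -/

section DuhamelODE

theorem duhamel_of_hasDerivWithinAt {T : ℝ} {y g : ℝ → ℂ} {a : ℂ}
    (hg : ContinuousOn g (Icc 0 T))
    (hy : ∀ t ∈ Icc 0 T, HasDerivWithinAt y (a * y t + g t) (Icc 0 T) t) {t : ℝ}
    (ht : t ∈ Icc 0 T) :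
    y t = Complex.exp (t * a) * y 0 +
      ∫ τ in (0 : ℝ)..t, Complex.exp ((t - τ : ℝ) * a) * g τ := by
  have hE : ∀ τ : ℝ, HasDerivAt (fun τ : ℝ => Complex.exp ((t - τ : ℝ) * a))
      (-(a * Complex.exp ((t - τ : ℝ) * a))) τ := by
    intro τ
    have h1 : HasDerivAt (fun τ : ℝ => ((t - τ : ℝ) : ℂ) * a) (-a) τ := by
      have h2 : HasDerivAt (fun τ : ℝ => ((t - τ : ℝ) : ℂ)) (-1) τ := by
        have := ((hasDerivAt_id τ).const_sub t).ofReal_comp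
        simpa using this
      simpa using h2.mul_const a
    convert h1.cexp using 1
    ring
  have hcE : Continuous fun τ : ℝ => Complex.exp ((t - τ : ℝ) * a) := by fun_prop
  have hsub : Icc 0 t ⊆ Icc 0 T := Icc_subset_Icc le_rfl ht.2
  have hyc : ContinuousOn y (Icc 0 T) := fun s hs => (hy s hs).continuousWithinAt
  have hftc := intervalIntegral.integral_eq_sub_of_hasDerivAt_of_le ht.1
    (f := fun τ => Complex.exp ((t - τ : ℝ) * a) * y τ)
    (f' := fun τ => Complex.exp ((t - τ : ℝ) * a) * g τ)
    (hcE.continuousOn.mul (hyc.mono hsub)) (fun τ hτ => ?_)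
    ((hcE.continuousOn.mul (hg.mono hsub)).intervalIntegrable_of_Icc ht.1)
  · rw [hftc]
    simp
  · have h1 := (hy τ ⟨hτ.1.le, hτ.2.le.trans ht.2⟩).hasDerivAt
      (Icc_mem_nhds hτ.1 (hτ.2.trans_le ht.2))
    exact ((hE τ).mul h1).congr_deriv (by ring)

end DuhamelODE

/-! ### Differential inequalities -/

section DifferentialInequality

theorem antitoneOn_Icc_of_hasDerivWithinAt {T : ℝ} {f f' : ℝ → ℝ}
    (hf : ∀ t ∈ Icc 0 T, HasDerivWithinAt f (f' t) (Icc 0 T) t) (hf' : ∀ t ∈ Icc 0 T, f' t ≤ 0) :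
    AntitoneOn f (Icc 0 T) :=
  antitoneOn_of_hasDerivWithinAt_nonpos (convex_Icc 0 T)
    (fun t ht => (hf t ht).continuousWithinAt)
    (fun t ht => (hf t (interior_subset ht)).mono interior_subset)
    fun t ht => hf' t (interior_subset ht)

/-- The eddy enstrophy is controlled by means of the dissipation of the zonal enstrophy. -/
theorem add_le_of_enstrophy_inequalities {T ν c C : ℝ} (hν : 0 < ν) (hc : 0 < c)
    {E₁ E₂ E₁' E₂' G θ : ℝ → ℝ}
    (h₁ : ∀ t ∈ Icc 0 T, HasDerivWithinAt E₁ (E₁' t) (Icc 0 T) t)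
    (h₂ : ∀ t ∈ Icc 0 T, HasDerivWithinAt E₂ (E₂' t) (Icc 0 T) t)
    (hE₁ : ∀ t, 0 ≤ E₁ t) (hE₂ : ∀ t, 0 ≤ E₂ t) (hG : ∀ t, 0 ≤ G t) (hθ : ∀ t, 0 ≤ θ t)
    (h₁' : ∀ t ∈ Icc 0 T, E₁' t ≤ θ t * (-(2 * ν * G t)))
    (h₂' : ∀ t ∈ Icc 0 T, E₂' t ≤ θ t * (-(2 * ν * c * E₂ t) + 2 * (C * √(G t) * E₂ t)))
    {t : ℝ} (ht : t ∈ Icc 0 T) :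
    E₁ t + E₂ t ≤ E₁ 0 + E₂ 0 * Real.exp (C ^ 2 / (4 * ν ^ 2 * c) * E₁ 0) := by
  -- This g is the value that completes the square: νc + νgG - C√G = νc(1 - C√G / (2νc))². So E₂
  -- exp(g E₁) decreases, the zonal dissipation absorbing the growth of the eddies. The common
  -- factor θ ≥ 0, later the cutoff, does not affect the sign.
  set g := C ^ 2 / (4 * ν ^ 2 * c) with hg
  have hg0 : 0 ≤ g := by positivity
  have h0 : (0 : ℝ) ∈ Icc 0 T := ⟨le_rfl, ht.1.trans ht.2⟩
  have a₁ : AntitoneOn E₁ (Icc 0 T) := antitoneOn_Icc_of_hasDerivWithinAt h₁ fun t ht =>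
    (h₁' t ht).trans (mul_nonpos_of_nonneg_of_nonpos (hθ t)
      (neg_nonpos.2 (mul_nonneg (by positivity) (hG t))))
  have a₂ : AntitoneOn (fun t => E₂ t * Real.exp (g * E₁ t)) (Icc 0 T) := by
    refine antitoneOn_Icc_of_hasDerivWithinAt
      (fun t ht => (h₂ t ht).mul ((h₁ t ht).const_mul g).exp) fun t ht => ?_
    have e : E₂' t * Real.exp (g * E₁ t) + E₂ t * (Real.exp (g * E₁ t) * (g * E₁' t)) =
        Real.exp (g * E₁ t) * (E₂' t + E₂ t * g * E₁' t) := by ring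
    refine e.trans_le (mul_nonpos_of_nonneg_of_nonpos (Real.exp_pos _).le ?_)
    have hx : E₂ t * g * E₁' t ≤ E₂ t * g * (θ t * (-(2 * ν * G t))) :=
      mul_le_mul_of_nonneg_left (h₁' t ht) (mul_nonneg (hE₂ t) hg0)
    have hr : G t = √(G t) ^ 2 := (Real.sq_sqrt (hG t)).symm
    have hsq : ν * c + ν * g * G t - C * √(G t) = ν * c * (1 - C * √(G t) / (2 * ν * c)) ^ 2 := by
      rw [hg]
      nth_rewrite 1 [hr]
      field_simp
      ring
    have hnn : 0 ≤ ν * c + ν * g * G t - C * √(G t) := by rw [hsq]; positivity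
    have hy := h₂' t ht
    have hz : 0 ≤ θ t * E₂ t * (2 * (ν * c + ν * g * G t - C * √(G t))) :=
      mul_nonneg (mul_nonneg (hθ t) (hE₂ t)) (by linarith)
    nlinarith
  have b₁ := a₁ h0 ht ht.1
  have b₂ := a₂ h0 ht ht.1
  have b₃ : E₂ t ≤ E₂ t * Real.exp (g * E₁ t) :=
    le_mul_of_one_le_right (hE₂ t) (Real.one_le_exp (mul_nonneg hg0 (hE₁ t)))
  simp only at b₂
  linarith

theorem le_exp_of_deriv_le_add {T K : ℝ} {U U' : ℝ → ℝ}
    (h : ∀ t ∈ Icc 0 T, HasDerivWithinAt U (U' t) (Icc 0 T) t)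
    (h' : ∀ t ∈ Icc 0 T, U' t ≤ U t + K) (hUK : 0 ≤ U 0 + K) {t : ℝ} (ht : t ∈ Icc 0 T) :
    U t + K ≤ (U 0 + K) * Real.exp T := by
  have h0 : (0 : ℝ) ∈ Icc 0 T := ⟨le_rfl, ht.1.trans ht.2⟩
  have a : AntitoneOn (fun t => (U t + K) * Real.exp (-t)) (Icc 0 T) := by
    refine antitoneOn_Icc_of_hasDerivWithinAt
      (fun t ht => ((h t ht).add_const K).mul (hasDerivWithinAt_id t _).neg.exp) fun t ht => ?_
    have e : U' t * Real.exp (-t) + (U t + K) * (Real.exp (-t) * -1) =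
        Real.exp (-t) * (U' t - (U t + K)) := by ring
    exact e.trans_le (mul_nonpos_of_nonneg_of_nonpos (Real.exp_pos _).le
      (sub_nonpos.2 (h' t ht)))
  have b := a h0 ht ht.1
  simp only [neg_zero, Real.exp_zero, mul_one] at b
  calc U t + K = (U t + K) * Real.exp (-t) * Real.exp t := by
        rw [mul_assoc, ← Real.exp_add, neg_add_cancel, Real.exp_zero, mul_one]
    _ ≤ (U 0 + K) * Real.exp t := mul_le_mul_of_nonneg_right b (Real.exp_pos _).le
    _ ≤ (U 0 + K) * Real.exp T := mul_le_mul_of_nonneg_left (Real.exp_le_exp.2 ht.2) hUK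

end DifferentialInequality

/-! ### Galerkin approximations -/

section Galerkin

variable {l : ℝ}

/-- The modes kept in the truncation. -/
def trunc (N : ℕ) : Finset Mode := (box1 N).disjSum (box2 N)

theorem inl_mem_trunc {N : ℕ} {n : ℤ} : .inl n ∈ trunc N ↔ n ∈ box1 N := Finset.inl_mem_disjSum

theorem inr_mem_trunc {N : ℕ} {k : ℤ × ℤ} : .inr k ∈ trunc N ↔ k ∈ box2 N :=
  Finset.inr_mem_disjSum

theorem flip_mem_trunc {N : ℕ} {i : Mode} : flip i ∈ trunc N ↔ i ∈ trunc N := by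
  rcases i with n | k
  · exact (inl_mem_trunc.trans neg_mem_box1).trans inl_mem_trunc.symm
  · exact (inr_mem_trunc.trans neg_mem_box2).trans inr_mem_trunc.symm

/-- Extension by zero. -/
def extend {N : ℕ} (y : trunc N → ℂ) : Mode → ℂ := fun i => if h : i ∈ trunc N then y ⟨i, h⟩ else 0

theorem extend_of_mem {N : ℕ} (y : trunc N → ℂ) {i : Mode} (h : i ∈ trunc N) :
    extend y i = y ⟨i, h⟩ := dif_pos h

theorem extend_of_notMem {N : ℕ} (y : trunc N → ℂ) {i : Mode} (h : i ∉ trunc N) :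
    extend y i = 0 := dif_neg h

theorem inBox_extend {N : ℕ} (y : trunc N → ℂ) : InBox N (extend y) :=
  ⟨fun _ hn => extend_of_notMem y fun h => hn (inl_mem_trunc.1 h),
    fun _ hk => extend_of_notMem y fun h => hk (inr_mem_trunc.1 h)⟩

theorem contDiff_extend {N : ℕ} (i : Mode) :
    ContDiff ℝ 1 fun y : trunc N → ℂ => extend y i := by
  by_cases h : i ∈ trunc N
  · simp only [extend_of_mem _ h]
    exact contDiff_apply ℝ ℂ _
  · simp only [extend_of_notMem _ h]
    exact contDiff_const

/-- The vector field of the Galerkin approximation. -/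
def galerkinField (l ν C₁ : ℝ) (N : ℕ) (y : trunc N → ℂ) : trunc N → ℂ :=
  fun i => sym l ν C₁ i * y i + bil l (extend y) (extend y) i

theorem contDiff_galerkinField (ν C₁ : ℝ) (N : ℕ) : ContDiff ℝ 1 (galerkinField l ν C₁ N) := by
  refine contDiff_pi.2 fun i => (contDiff_const.mul (contDiff_apply ℝ ℂ i)).add ?_
  rcases i with ⟨n | k, hi⟩
  · simp only [bil_inl_eq (inBox_extend _)]
    exact contDiff_const.mul (ContDiff.sum fun h _ =>
      contDiff_const.mul ((contDiff_extend _).mul (contDiff_extend _)))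
  · simp only [bil_inr_eq (inBox_extend _), transport]
    split_ifs
    · exact contDiff_const
    · exact (ContDiff.sum fun h _ =>
        contDiff_const.mul ((contDiff_extend _).mul (contDiff_extend _))).sub
        (contDiff_const.mul (ContDiff.sum fun n _ => (contDiff_extend _).mul (contDiff_extend _)))

/-- Complex conjugation in physical space, for the truncated coefficients. -/
def reflectTrunc (N : ℕ) : (trunc N → ℂ) →L[ℝ] (trunc N → ℂ) :=
  ContinuousLinearMap.pi fun i => Complex.conjCLE.toContinuousLinearMap.comp
    (ContinuousLinearMap.proj (⟨flip i, flip_mem_trunc.2 i.2⟩ : trunc N))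

theorem reflectTrunc_apply {N : ℕ} (y : trunc N → ℂ) (i : trunc N) :
    reflectTrunc N y i = conj (y ⟨flip i, flip_mem_trunc.2 i.2⟩) := rfl

theorem extend_reflectTrunc {N : ℕ} (y : trunc N → ℂ) :
    extend (reflectTrunc N y) = reflect (extend y) := by
  funext i
  by_cases h : i ∈ trunc N
  · rw [extend_of_mem _ h, reflect, extend_of_mem _ (flip_mem_trunc.2 h), reflectTrunc_apply]
  · rw [extend_of_notMem _ h, reflect, extend_of_notMem _ (flip_mem_trunc.not.2 h), map_zero]

theorem sum_reflectTrunc {N : ℕ} (y : trunc N → ℂ) :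
    ∑ i, ‖reflectTrunc N y i‖ ^ 2 = ∑ i, ‖y i‖ ^ 2 := by
  let e : trunc N ≃ trunc N :=
    ⟨fun i => ⟨flip i, flip_mem_trunc.2 i.2⟩, fun i => ⟨flip i, flip_mem_trunc.2 i.2⟩,
      fun i => Subtype.ext (flip_flip _), fun i => Subtype.ext (flip_flip _)⟩
  rw [← e.sum_comp fun i => ‖y i‖ ^ 2]
  exact Finset.sum_congr rfl fun i _ => by rw [reflectTrunc_apply, RCLike.norm_conj]; rfl

theorem galerkinField_reflectTrunc (ν C₁ : ℝ) {N : ℕ} (y : trunc N → ℂ) :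
    galerkinField l ν C₁ N (reflectTrunc N y) = reflectTrunc N (galerkinField l ν C₁ N y) := by
  funext i
  rw [reflectTrunc_apply, galerkinField, galerkinField, extend_reflectTrunc, bil_reflect,
    reflectTrunc_apply, map_add, map_mul, ← sym_flip, flip_flip]

theorem zonalEnergy_add_eddyEnergy (N : ℕ) (z : Mode → ℂ) :
    zonalEnergy N z + eddyEnergy N z = ∑ k ∈ box2 N, ‖z (.inr k)‖ ^ 2 := by
  rw [zonalEnergy, eddyEnergy, ← Finset.sum_add_distrib]
  exact Finset.sum_congr rfl fun k _ => by split_ifs <;> simp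

theorem sum_trunc (N : ℕ) (z : Mode → ℂ) :
    ∑ i ∈ trunc N, ‖z i‖ ^ 2 =
      (∑ n ∈ box1 N, ‖z (.inl n)‖ ^ 2) + (zonalEnergy N z + eddyEnergy N z) := by
  rw [trunc, Finset.sum_disjSum, zonalEnergy_add_eddyEnergy]

theorem sum_extend {N : ℕ} (y : trunc N → ℂ) :
    ∑ i, ‖y i‖ ^ 2 = (∑ n ∈ box1 N, ‖extend y (.inl n)‖ ^ 2) +
      (zonalEnergy N (extend y) + eddyEnergy N (extend y)) := by
  rw [← sum_trunc N (extend y)]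
  refine Eq.trans ?_ (Finset.sum_coe_sort (trunc N) fun i => ‖extend y i‖ ^ 2)
  exact Finset.sum_congr rfl fun i _ => by rw [extend_of_mem y i.2]

theorem hasDerivWithinAt_norm_sq {s : Set ℝ} {t : ℝ} {y : ℝ → ℂ} {dy : ℂ}
    (h : HasDerivWithinAt y dy s t) :
    HasDerivWithinAt (fun t => ‖y t‖ ^ 2) (2 * (conj (y t) * dy).re) s t := by
  have := h.norm_sq
  rwa [Complex.inner, mul_comm dy] at this

/-- The energy balance of a single mode. -/
theorem hasDerivWithinAt_norm_sq_extend {ν C₁ : ℝ} {N : ℕ} {s : Set ℝ} {t θ : ℝ}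
    {x : ℝ → trunc N → ℂ}
    (h : HasDerivWithinAt x (θ • galerkinField l ν C₁ N (x t)) s t) (i : Mode) :
    HasDerivWithinAt (fun t => ‖extend (x t) i‖ ^ 2)
      (θ * (-(2 * ν * (modeSq l i * ‖extend (x t) i‖ ^ 2)) +
        2 * (conj (extend (x t) i) * bil l (extend (x t)) (extend (x t)) i).re)) s t := by
  by_cases hi : i ∈ trunc N
  · simp only [extend_of_mem _ hi]
    refine (hasDerivWithinAt_norm_sq (hasDerivWithinAt_pi.1 h ⟨i, hi⟩)).congr_deriv ?_
    generalize hy : x t ⟨i, hi⟩ = y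
    simp only [Pi.smul_apply, galerkinField, hy]
    have e : conj y * (θ • (sym l ν C₁ i * y + bil l (extend (x t)) (extend (x t)) i)) =
        θ • (((‖y‖ ^ 2 : ℝ) : ℂ) * sym l ν C₁ i +
          conj y * bil l (extend (x t)) (extend (x t)) i) := by
      have : ((‖y‖ ^ 2 : ℝ) : ℂ) = conj y * y := by
        rw [Complex.conj_mul']; push_cast; rfl
      rw [this, Complex.real_smul, Complex.real_smul]
      ring
    rw [e, Complex.smul_re, Complex.add_re, Complex.re_ofReal_mul, re_sym, smul_eq_mul]
    ring
  · simp only [extend_of_notMem _ hi]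
    simpa using hasDerivWithinAt_const t s (0 : ℝ)

variable {ν C₁ : ℝ} {N : ℕ} {s : Set ℝ} {t θ : ℝ} {x : ℝ → trunc N → ℂ}

theorem hasDerivWithinAt_zonalEnergy
    (h : HasDerivWithinAt x (θ • galerkinField l ν C₁ N (x t)) s t) :
    HasDerivWithinAt (fun t => zonalEnergy N (extend (x t)))
      (θ * (-(2 * ν * zonalGrad l N (extend (x t))))) s t := by
  have h1 : ∀ k ∈ box2 N, HasDerivWithinAt
      (fun t => if k.1 = 0 then ‖extend (x t) (.inr k)‖ ^ 2 else 0)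
      (θ * (-(2 * ν * if k.1 = 0 then freq l k.2 ^ 2 * ‖extend (x t) (.inr k)‖ ^ 2 else 0)))
      s t := by
    intro k _
    split_ifs with hk
    · refine (hasDerivWithinAt_norm_sq_extend h (.inr k)).congr_deriv ?_
      simp [bil, hk, modeSq, freqSq, freq_zero]
    · simpa using hasDerivWithinAt_const t s (0 : ℝ)
  refine (HasDerivWithinAt.fun_sum h1).congr_deriv ?_
  rw [zonalGrad, ← Finset.mul_sum, Finset.sum_neg_distrib, ← Finset.mul_sum]

theorem hasDerivWithinAt_eddyEnergy
    (h : HasDerivWithinAt x (θ • galerkinField l ν C₁ N (x t)) s t) :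
    HasDerivWithinAt (fun t => eddyEnergy N (extend (x t)))
      (θ * (-(2 * ν * ∑ k ∈ box2 N, if k.1 = 0 then 0 else
          freqSq l k * ‖extend (x t) (.inr k)‖ ^ 2) +
        2 * ∑ k ∈ box2 N, (conj (extend (x t) (.inr k)) *
          bil l (extend (x t)) (extend (x t)) (.inr k)).re)) s t := by
  have h1 : ∀ k ∈ box2 N, HasDerivWithinAt
      (fun t => if k.1 = 0 then 0 else ‖extend (x t) (.inr k)‖ ^ 2)
      (θ * (-(2 * ν * if k.1 = 0 then 0 else freqSq l k * ‖extend (x t) (.inr k)‖ ^ 2) +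
        2 * (conj (extend (x t) (.inr k)) * bil l (extend (x t)) (extend (x t)) (.inr k)).re))
      s t := by
    intro k _
    split_ifs with hk
    · simpa [bil, hk] using hasDerivWithinAt_const t s (0 : ℝ)
    · exact hasDerivWithinAt_norm_sq_extend h (.inr k)
  refine (HasDerivWithinAt.fun_sum h1).congr_deriv ?_
  rw [← Finset.mul_sum, Finset.sum_add_distrib, Finset.sum_neg_distrib, ← Finset.mul_sum,
    ← Finset.mul_sum]

theorem eddyEnergy_le_dissipation (hl : 0 < l) (z : Mode → ℂ) :
    (gapConst l)⁻¹ * eddyEnergy N z ≤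
      ∑ k ∈ box2 N, if k.1 = 0 then 0 else freqSq l k * ‖z (.inr k)‖ ^ 2 := by
  have hg : 0 < gapConst l := zero_lt_one.trans_le (one_le_gapConst l)
  rw [eddyEnergy, Finset.mul_sum]
  refine Finset.sum_le_sum fun k _ => ?_
  split_ifs with hk
  · simp
  · have h1 := one_add_freqSq_le hl (k := k) (fun h => hk (by rw [h]; rfl))
    have h2 : (gapConst l)⁻¹ ≤ freqSq l k := by
      rw [inv_le_iff_one_le_mul₀' hg]
      have := freqSq_nonneg l k
      linarith
    exact mul_le_mul_of_nonneg_right h2 (by positivity)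

/-- A bound for the Reynolds stress of truncated fields. -/
theorem norm_bil_inl_le {z : Mode → ℂ} (hz : InBox N z) {B : ℝ}
    (hB : ∀ k, ‖z (.inr k)‖ ^ 2 ≤ B) (n : ℤ) :
    ‖bil l z z (.inl n)‖ ≤ |freq l n| * ∑ h ∈ box2 N, |kerG l n h| * B := by
  rw [bil_inl_eq hz, norm_mul, norm_neg, norm_mul, Complex.norm_I, one_mul, Complex.norm_real,
    Real.norm_eq_abs]
  refine mul_le_mul_of_nonneg_left ((norm_sum_le _ _).trans (Finset.sum_le_sum fun h _ => ?_))
    (abs_nonneg _)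
  rw [norm_mul, Complex.norm_real, Real.norm_eq_abs, norm_mul]
  refine mul_le_mul_of_nonneg_left ?_ (abs_nonneg _)
  nlinarith [hB h, hB ((0, n) - h), sq_nonneg (‖z (.inr h)‖ - ‖z (.inr ((0, n) - h))‖)]

/-- The bound for the growth of the mean flow of truncated fields. -/
def meanGrowth (l : ℝ) (N : ℕ) (B : ℝ) : ℝ :=
  ∑ n ∈ box1 N, (|freq l n| * ∑ h ∈ box2 N, |kerG l n h| * B) ^ 2

theorem meanGrowth_nonneg (B : ℝ) : 0 ≤ meanGrowth l N B :=
  Finset.sum_nonneg fun _ _ => sq_nonneg _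

/-- A crude bound that depends on the truncation. It only serves to keep the mean flow inside the
region where the cutoff is one; uniform control of u comes from the Duhamel formula. -/
theorem exists_hasDerivWithinAt_mean (hν : 0 < ν) (hθ₀ : 0 ≤ θ) (hθ₁ : θ ≤ 1)
    (h : HasDerivWithinAt x (θ • galerkinField l ν C₁ N (x t)) s t) {B : ℝ}
    (hB : ∀ k, ‖extend (x t) (.inr k)‖ ^ 2 ≤ B) :
    ∃ U' ≤ (∑ n ∈ box1 N, ‖extend (x t) (.inl n)‖ ^ 2) + meanGrowth l N B,
      HasDerivWithinAt (fun t => ∑ n ∈ box1 N, ‖extend (x t) (.inl n)‖ ^ 2) U' s t := by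
  refine ⟨_, ?_, HasDerivWithinAt.fun_sum fun n _ => hasDerivWithinAt_norm_sq_extend h (.inl n)⟩
  rw [meanGrowth, ← Finset.sum_add_distrib]
  refine Finset.sum_le_sum fun n _ => ?_
  set z := extend (x t)
  have h1 : (conj (z (.inl n)) * bil l z z (.inl n)).re ≤ ‖z (.inl n)‖ * ‖bil l z z (.inl n)‖ :=
    (Complex.re_le_norm _).trans_eq (by rw [norm_mul, RCLike.norm_conj])
  have h2 := norm_bil_inl_le (l := l) (inBox_extend (x t)) hB n
  have h3 : 0 ≤ ν * (modeSq l (.inl n) * ‖z (.inl n)‖ ^ 2) :=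
    mul_nonneg hν.le (mul_nonneg (modeSq_nonneg _) (by positivity))
  have h4 : ‖bil l z z (.inl n)‖ ^ 2 ≤ (|freq l n| * ∑ h ∈ box2 N, |kerG l n h| * B) ^ 2 :=
    pow_le_pow_left₀ (norm_nonneg _) h2 2
  have h5 : -(2 * ν * (modeSq l (.inl n) * ‖z (.inl n)‖ ^ 2)) +
      2 * (conj (z (.inl n)) * bil l z z (.inl n)).re ≤
      ‖z (.inl n)‖ ^ 2 + ‖bil l z z (.inl n)‖ ^ 2 := by
    nlinarith [sq_nonneg (‖z (.inl n)‖ - ‖bil l z z (.inl n)‖)]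
  calc _ ≤ θ * (‖z (.inl n)‖ ^ 2 + ‖bil l z z (.inl n)‖ ^ 2) :=
        mul_le_mul_of_nonneg_left h5 hθ₀
    _ ≤ 1 * (‖z (.inl n)‖ ^ 2 + ‖bil l z z (.inl n)‖ ^ 2) :=
        mul_le_mul_of_nonneg_right hθ₁ (by positivity)
    _ ≤ _ := by rw [one_mul]; linarith

theorem norm_sq_le_energy {z : Mode → ℂ} (hz : InBox N z) (k : ℤ × ℤ) :
    ‖z (.inr k)‖ ^ 2 ≤ zonalEnergy N z + eddyEnergy N z := by
  rw [zonalEnergy_add_eddyEnergy]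
  by_cases hk : k ∈ box2 N
  · exact Finset.single_le_sum (f := fun k => ‖z (.inr k)‖ ^ 2) (fun _ _ => by positivity) hk
  · rw [hz.2 k hk, norm_zero, zero_pow two_ne_zero]
    exact Finset.sum_nonneg fun _ _ => by positivity

/-- The bound for the enstrophy of the Galerkin approximations. -/
def enstrophyBound (l ν m : ℝ) : ℝ :=
  m + m * Real.exp (enstrophyConst l ^ 2 / (4 * ν ^ 2 * (gapConst l)⁻¹) * m)

/-- The Galerkin approximations exist on every time interval, with a bound for the enstrophy that
does not depend on the truncation. -/
theorem exists_galerkin (hl : 0 < l) (hν : 0 < ν) (C₁ : ℝ) {z₀ : Mode → ℂ}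
    (hz₀ : reflect z₀ = z₀) (N : ℕ) {m : ℝ}
    (hm : ∑ k ∈ box2 N, ‖z₀ (.inr k)‖ ^ 2 ≤ m) {T : ℝ} (hT : 0 ≤ T) :
    ∃ x : ℝ → trunc N → ℂ, (∀ i, x 0 i = z₀ i) ∧
      (∀ t ∈ Icc 0 T, HasDerivWithinAt x (galerkinField l ν C₁ N (x t)) (Icc 0 T) t) ∧
      (∀ t ∈ Icc 0 T, reflect (extend (x t)) = extend (x t)) ∧
      ∀ t ∈ Icc 0 T, ∑ k ∈ box2 N, ‖extend (x t) (.inr k)‖ ^ 2 ≤ enstrophyBound l ν m := by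
  have hg : 0 < (gapConst l)⁻¹ := inv_pos.2 (zero_lt_one.trans_le (one_le_gapConst l))
  let x₀ : trunc N → ℂ := fun i => z₀ i
  let B := enstrophyBound l ν m
  let U₀ := ∑ n ∈ box1 N, ‖z₀ (.inl n)‖ ^ 2
  -- R is an a priori bound for the equation with cutoff itself: Grönwall for the mean flow plus the
  -- enstrophy bound B. Hence the cutoff is identically one along the solution and can be removed.
  let R := (U₀ + meanGrowth l N B) * Real.exp T + B
  obtain ⟨x, hx0, hx, hxσ⟩ :=
    exists_cutoff_solution (contDiff_galerkinField (l := l) ν C₁ N) R hT x₀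
  have hx0' : ∀ i ∈ trunc N, extend (x 0) i = z₀ i := fun i hi => by
    rw [extend_of_mem _ hi, hx0]
  have hrefl : ∀ t ∈ Icc 0 T, reflect (extend (x t)) = extend (x t) := fun t ht => by
    rw [← extend_reflectTrunc, hxσ (reflectTrunc N) sum_reflectTrunc
      (galerkinField_reflectTrunc ν C₁) _ t ht]
    funext i
    rw [reflectTrunc_apply]
    exact congrFun hz₀ i
  have h0 : zonalEnergy N (extend (x 0)) + eddyEnergy N (extend (x 0)) ≤ m := by
    rw [zonalEnergy_add_eddyEnergy]
    refine le_trans (le_of_eq (Finset.sum_congr rfl fun k hk => ?_)) hm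
    rw [hx0' _ (inr_mem_trunc.2 hk)]
  have hB : ∀ t ∈ Icc 0 T, zonalEnergy N (extend (x t)) + eddyEnergy N (extend (x t)) ≤ B := by
    intro t ht
    have h1 := zonalEnergy_nonneg N (extend (x 0))
    have h2 := eddyEnergy_nonneg N (extend (x 0))
    refine (add_le_of_enstrophy_inequalities (C := enstrophyConst l) hν hg
      (fun t ht => hasDerivWithinAt_zonalEnergy (hx t ht))
      (fun t ht => hasDerivWithinAt_eddyEnergy (hx t ht))
      (fun t => zonalEnergy_nonneg _ _) (fun t => eddyEnergy_nonneg _ _)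
      (fun t => zonalGrad_nonneg (l := l) N (extend (x t))) (fun t => cutoff_nonneg R (x t))
      (fun t ht => le_rfl) (fun t ht => ?_) ht).trans ?_
    · refine mul_le_mul_of_nonneg_left (add_le_add ?_ ?_) (cutoff_nonneg _ _)
      · have := mul_le_mul_of_nonneg_left (eddyEnergy_le_dissipation (N := N) hl (extend (x t)))
          (mul_nonneg zero_le_two hν.le)
        rw [mul_assoc (2 * ν)]
        exact neg_le_neg this
      · exact mul_le_mul_of_nonneg_left ((le_abs_self _).trans (abs_sum_re_conj_mul_bil_le hl
          (inBox_extend _) fun k => (congrFun (hrefl t ht) (.inr (-k))).symm.trans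
            (by simp [reflect, flip]))) zero_le_two
    · have h3 : zonalEnergy N (extend (x 0)) ≤ m := by linarith
      have h4 : eddyEnergy N (extend (x 0)) ≤ m := by linarith
      refine add_le_add h3 (mul_le_mul h4 (Real.exp_le_exp.2 (mul_le_mul_of_nonneg_left h3
        (by positivity))) (Real.exp_pos _).le (h1.trans h3))
  have hθ : ∀ t ∈ Icc 0 T, cutoff R (x t) = 1 := by
    intro t ht
    apply cutoff_eq_one
    rw [sum_extend]
    refine add_le_add ?_ (hB t ht)
    have hd := fun t ht => exists_hasDerivWithinAt_mean hν (cutoff_nonneg R (x t))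
      (cutoff_le_one R (x t)) (hx t ht)
      fun k => (norm_sq_le_energy (inBox_extend _) k).trans (hB t ht)
    choose! U' hU' hU using hd
    have hU0 : ∑ n ∈ box1 N, ‖extend (x 0) (.inl n)‖ ^ 2 = U₀ :=
      Finset.sum_congr rfl fun n hn => by rw [hx0' _ (inl_mem_trunc.2 hn)]
    have hK : 0 ≤ meanGrowth l N B := meanGrowth_nonneg B
    have hU₀ : 0 ≤ U₀ := Finset.sum_nonneg fun _ _ => by positivity
    have := le_exp_of_deriv_le_add hU hU' (by rw [hU0]; positivity) ht
    rw [hU0] at this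
    linarith
  refine ⟨x, fun i => by rw [hx0], fun t ht => ?_, hrefl,
    fun t ht => (zonalEnergy_add_eddyEnergy _ _).symm.trans_le (hB t ht)⟩
  have := hx t ht
  rwa [hθ t ht, one_smul] at this

end Galerkin

/-! ### Existence of solutions on the Fourier side -/

section Existence

variable {l : ℝ}

/-- The Galerkin approximations, frozen outside of the time interval `[0, N]`. -/
theorem exists_galerkin_trajectory (hl : 0 < l) {ν : ℝ} (hν : 0 < ν) (C₁ : ℝ) {z₀ : Mode → ℂ}
    (hz₀ : reflect z₀ = z₀) (N : ℕ) {m : ℝ} (hm : ∑ k ∈ box2 N, ‖z₀ (.inr k)‖ ^ 2 ≤ m) :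
    ∃ z : ℝ → Mode → ℂ,
      (∀ t, ∑' k, ‖z t (.inr k)‖ₑ ^ 2 ≤ ENNReal.ofReal (enstrophyBound l ν m)) ∧
      (∀ t, reflect (z t) = z t) ∧
      (∀ i ∉ trunc N, ∀ t, z t i = 0) ∧
      (∀ i ∈ trunc N, ∀ t ∈ Icc (0 : ℝ) N, z t i = Complex.exp (t * sym l ν C₁ i) * z₀ i +
        ∫ τ in (0 : ℝ)..t, Complex.exp ((t - τ : ℝ) * sym l ν C₁ i) * bil l (z τ) (z τ) i) ∧
      (∀ t, ∃ r ∈ Icc (0 : ℝ) N, z t = z r) ∧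
      ∀ i c, 0 ≤ c → (∀ t, ‖sym l ν C₁ i * z t i + bil l (z t) (z t) i‖ ≤ c) →
        ∀ s t, ‖z s i - z t i‖ ≤ c * |s - t| := by
  have hN : (0 : ℝ) ≤ N := N.cast_nonneg
  -- The truncation index is also the time horizon, so every fixed time is eventually covered.
  obtain ⟨x, hx0, hx, hrefl, hB⟩ := exists_galerkin hl hν C₁ hz₀ N hm hN
  let p : ℝ → ℝ := fun t => projIcc 0 (N : ℝ) hN t
  have hp : ∀ t, p t ∈ Icc (0 : ℝ) N := fun t => (projIcc 0 (N : ℝ) hN t).2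
  have hpe : ∀ t ∈ Icc (0 : ℝ) N, p t = t := fun t ht => by simp only [p, projIcc_of_mem hN ht]
  have hd : ∀ i (hi : i ∈ trunc N), ∀ t ∈ Icc (0 : ℝ) N, HasDerivWithinAt (fun t => x t ⟨i, hi⟩)
      (sym l ν C₁ i * x t ⟨i, hi⟩ + bil l (extend (x t)) (extend (x t)) i) (Icc 0 (N : ℝ)) t :=
    fun i hi t ht => hasDerivWithinAt_pi.1 (hx t ht) ⟨i, hi⟩
  have hxc : ContinuousOn x (Icc 0 (N : ℝ)) := fun t ht => (hx t ht).continuousWithinAt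
  refine ⟨fun t => extend (x (p t)), fun t => ?_, fun t => hrefl _ (hp t),
    fun i hi t => extend_of_notMem _ hi, fun i hi t ht => ?_,
    fun t => ⟨p t, hp t, by simp only [hpe _ (hp t)]⟩, fun i c hc0 hc s t => ?_⟩
  · have h1 := hB (p t) (hp t)
    rw [tsum_eq_sum (s := box2 N) fun k hk => by simp [(inBox_extend (x (p t))).2 k hk]]
    refine le_trans (le_of_eq ?_) (ENNReal.ofReal_le_ofReal h1)
    rw [ENNReal.ofReal_sum_of_nonneg fun _ _ => by positivity]
    refine Finset.sum_congr rfl fun k _ => ?_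
    rw [ENNReal.ofReal_pow (norm_nonneg _), ofReal_norm]
  · have hg : ContinuousOn (fun t => bil l (extend (x t)) (extend (x t)) i) (Icc 0 (N : ℝ)) := by
      have h1 : ContinuousOn (fun t => galerkinField l ν C₁ N (x t) ⟨i, hi⟩) (Icc 0 (N : ℝ)) :=
        ((continuous_apply (⟨i, hi⟩ : trunc N)).comp
          (contDiff_galerkinField ν C₁ N).continuous).comp_continuousOn hxc
      have h2 : ContinuousOn (fun t => sym l ν C₁ i * x t ⟨i, hi⟩) (Icc 0 (N : ℝ)) :=
        continuousOn_const.mul ((continuous_apply (⟨i, hi⟩ : trunc N)).comp_continuousOn hxc)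
      refine (h1.sub h2).congr fun t _ => ?_
      exact (add_sub_cancel_left _ _).symm
    have h := duhamel_of_hasDerivWithinAt (y := fun t => x t ⟨i, hi⟩) hg (hd i hi) ht
    have e : ∫ τ in (0 : ℝ)..t, Complex.exp ((t - τ : ℝ) * sym l ν C₁ i) *
          bil l (extend (x (p τ))) (extend (x (p τ))) i =
        ∫ τ in (0 : ℝ)..t, Complex.exp ((t - τ : ℝ) * sym l ν C₁ i) *
          bil l (extend (x τ)) (extend (x τ)) i := by
      refine intervalIntegral.integral_congr fun τ hτ => ?_
      rw [uIcc_of_le ht.1] at hτ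
      simp only [hpe τ ⟨hτ.1, hτ.2.trans ht.2⟩]
    rw [e]
    change extend (x (p t)) i = _
    rw [hpe t ht, extend_of_mem _ hi, h, hx0]
  · by_cases hi : i ∈ trunc N
    · simp only [extend_of_mem _ hi] at hc ⊢
      have h1 := (convex_Icc 0 (N : ℝ)).norm_image_sub_le_of_norm_hasDerivWithin_le
        (hd i hi) (C := c) (fun r hr => by simpa only [hpe r hr] using hc r) (hp t) (hp s)
      refine h1.trans (mul_le_mul_of_nonneg_left ?_ hc0)
      have h2 := (LipschitzWith.projIcc hN).dist_le_mul s t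
      rw [NNReal.coe_one, one_mul] at h2
      exact h2
    · simp only [extend_of_notMem _ hi, sub_zero, norm_zero]
      positivity

/-- Global solutions of the Duhamel formula for the Fourier coefficients. -/
theorem exists_duhamel_solution (hl : 0 < l) {ν : ℝ} (hν : 0 < ν) (C₁ : ℝ) {s : ℝ} (hs : 0 ≤ s)
    {z₀ : Mode → ℂ} (hrefl : reflect z₀ = z₀) (hz₀ : hsq l s (fun i => ‖z₀ i‖ₑ) < ∞) :
    ∃ (w : ℝ → Mode → ℂ) (Z : Mode → ℝ≥0∞), hsq l s Z < ∞ ∧ (∀ i, Continuous fun t => w t i) ∧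
      (∀ t i, ‖w t i‖ₑ ≤ Z i) ∧ (∀ t, reflect (w t) = w t) ∧
      ∀ t, 0 ≤ t → Duhamel l ν C₁ z₀ w t := by
  have hA : l2sq (fun i => ‖z₀ i‖ₑ) < ∞ := by
    rw [← hsq_zero (l := l)]
    exact (hsq_mono hs fun _ => le_rfl).trans_lt hz₀
  have hA2 : ∑' k, ‖z₀ (.inr k)‖ₑ ^ 2 < ∞ := lt_of_le_of_lt le_add_self hA
  have hm : ∀ N : ℕ, ∑ k ∈ box2 N, ‖z₀ (.inr k)‖ ^ 2 ≤ (∑' k, ‖z₀ (.inr k)‖ₑ ^ 2).toReal := by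
    intro N
    refine (ENNReal.ofReal_le_iff_le_toReal hA2.ne).1 ?_
    rw [ENNReal.ofReal_sum_of_nonneg fun _ _ => by positivity]
    refine le_trans (le_of_eq (Finset.sum_congr rfl fun k _ => ?_)) (ENNReal.sum_le_tsum (box2 N))
    rw [ENNReal.ofReal_pow (norm_nonneg _), ofReal_norm]
  choose z hzM hzr hz0 hzD hzp hzL using
    fun N : ℕ => exists_galerkin_trajectory hl hν C₁ hrefl N (hm N)
  obtain ⟨Z, hZ, hmaj⟩ := exists_majorant hl hA (duhConst_lt_top l ν)
    (M := ENNReal.ofReal (enstrophyBound l ν (∑' k, ‖z₀ (.inr k)‖ₑ ^ 2).toReal))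
    ENNReal.ofReal_lt_top
  have hb : ∀ N t i, ‖z N t i‖ₑ ≤ Z i := by
    intro N
    refine hmaj (fun t i => ‖z N t i‖ₑ) (hzM N) fun i b hb t => ?_
    by_cases hi : i ∈ trunc N
    · obtain ⟨r, hr, hzr⟩ := hzp N t
      simp only [hzr]
      rw [hzD N i hi r hr]
      exact enorm_duhamel_le hl hν hr.1 fun τ _ => hb τ
    · simp [hz0 N i hi]
  choose c hc0 hc using norm_bil_le_of_majorant hl hZ
  have hlip : ∀ N i s t, ‖z N s i - z N t i‖ ≤
      (‖sym l ν C₁ i‖ * (Z i).toReal + c i) * |s - t| := by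
    refine fun N i => hzL N i _ (add_nonneg (by positivity) (hc0 i)) fun t => ?_
    refine (norm_add_le _ _).trans (add_le_add ?_ (hc i _ (hb N t)))
    rw [norm_mul]
    refine mul_le_mul_of_nonneg_left ?_ (norm_nonneg _)
    simpa using ENNReal.toReal_mono (lt_top_of_l2sq_lt_top hZ i).ne (hb N t i)
  have hev : ∀ i t, 0 ≤ t → ∀ᶠ N in atTop, z N t i = Complex.exp (t * sym l ν C₁ i) * z₀ i +
      ∫ τ in (0 : ℝ)..t,
        Complex.exp ((t - τ : ℝ) * sym l ν C₁ i) * bil l (z N τ) (z N τ) i := by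
    intro i t ht
    have h1 : ∀ᶠ N : ℕ in atTop, i ∈ trunc N := by
      rcases i with n | k
      · filter_upwards [eventually_ge_atTop n.natAbs] with N hN
        rw [inl_mem_trunc, box1, Finset.mem_Icc]
        omega
      · filter_upwards [eventually_ge_atTop (max k.1.natAbs k.2.natAbs)] with N hN
        have := (le_max_left _ _).trans hN
        have := (le_max_right _ _).trans hN
        rw [inr_mem_trunc, box2, Finset.mem_product, box1, Finset.mem_Icc, Finset.mem_Icc]
        omega
    filter_upwards [h1, eventually_ge_atTop ⌈t⌉₊] with N hi hN
    exact hzD N i hi t ⟨ht, Nat.ceil_le.1 hN⟩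
  obtain ⟨φ, hφ, v, hv, hvc, hvb, hvD⟩ := exists_duhamel_of_approx hl hν (C₁ := C₁) (z₀ := z₀) hZ
    (L := fun i => ‖sym l ν C₁ i‖ * (Z i).toReal + c i) hb hlip hev
  have hvr : ∀ t, reflect (v t) = v t := fun t => by
    funext i
    refine tendsto_nhds_unique ?_ (hv t i)
    have h1 := (Complex.continuous_conj.tendsto _).comp (hv t (flip i))
    refine h1.congr fun N => ?_
    exact congrFun (hzr (φ N) t) i
  -- Freezing negative times makes every value of w a value at a nonnegative time, where the Duhamel
  -- formula is available.
  let w : ℝ → Mode → ℂ := fun t => v (max t 0)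
  have hwD : ∀ t, 0 ≤ t → Duhamel l ν C₁ z₀ w t := fun t ht i => by
    simp only [w, max_eq_left ht]
    rw [hvD t ht i]
    congr 1
    refine intervalIntegral.integral_congr fun τ hτ => ?_
    rw [uIcc_of_le ht] at hτ
    simp only [max_eq_left hτ.1]
  -- The exact supremum in time satisfies the integrated inequality with itself on the right, as the
  -- bootstrap requires. The majorant Z is only known to be square summable.
  let Y : Mode → ℝ≥0∞ := fun i => ⨆ t, ‖w t i‖ₑ
  have hY : ∀ t i, ‖w t i‖ₑ ≤ Y i := fun t i => le_iSup (fun t => ‖w t i‖ₑ) t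
  have hYZ : l2sq Y < ∞ := (l2sq_mono fun i => iSup_le fun t => hvb _ i).trans_lt hZ
  refine ⟨w, Y, hsq_lt_top_of_le hl (duhConst_lt_top l ν) hs hz₀ hYZ fun i => iSup_le fun t => ?_,
    fun i => (hvc i).comp (continuous_id.max continuous_const), hY, fun t => hvr _, hwD⟩
  have e : w t = w (max t 0) := by simp only [w, max_eq_left (le_max_right t 0)]
  rw [e, hwD _ (le_max_right t 0) i]
  exact enorm_duhamel_le hl hν (le_max_right t 0) fun τ _ => maj_mono _ (hY τ) (hY τ) i

end Existence

/-! ### Well-posedness -/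

section WellPosed

variable {l : ℝ} [hl : Fact (0 < l)]

theorem sobolevSq1_eq (s : ℝ) (f : L2y l) :
    sobolevSq1 s f = ∑' n, wt1 l n ^ s * ‖hat1 f n‖ₑ ^ 2 := by
  refine tsum_congr fun n => ?_
  have h : 0 < 1 + freq l n ^ 2 := by positivity
  rw [ENNReal.ofReal_mul (by positivity), ← ENNReal.ofReal_rpow_of_pos h,
    ENNReal.ofReal_pow (norm_nonneg _), ofReal_norm, wt1]

theorem sobolevSq2_eq (s : ℝ) (f : L2xy l) :
    sobolevSq2 s f = ∑' k, wt2 l k ^ s * ‖hat2 f k‖ₑ ^ 2 := by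
  refine tsum_congr fun k => ?_
  have h : 0 < 1 + freqSq l k := by have := freqSq_nonneg l k; positivity
  rw [ENNReal.ofReal_mul (by positivity), ← ENNReal.ofReal_rpow_of_pos h,
    ENNReal.ofReal_pow (norm_nonneg _), ofReal_norm, wt2]

theorem hsq_coef (s : ℝ) (u : L2y l) (ζ : L2xy l) :
    hsq l s (fun i => ‖coef u ζ i‖ₑ) = sobolevSq1 s u + sobolevSq2 s ζ := by
  rw [sobolevSq1_eq, sobolevSq2_eq]
  rfl

theorem reflect_coef (u : L2y l) (ζ : L2xy l) : reflect (coef u ζ) = coef u ζ := by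
  funext i
  rcases i with n | k
  · simp [reflect, flip, coef, hat1_neg]
  · simp [reflect, flip, coef, hat2_neg]

theorem coef_injective {u v : L2y l} {ζ η : L2xy l} (h : coef u ζ = coef v η) :
    u = v ∧ ζ = η :=
  ⟨hat1_injective fun n => congrFun h (.inl n), hat2_injective fun k => congrFun h (.inr k)⟩

/-- Hermitian sequences depending continuously on time are the coefficients of a measurable family
of functions. -/
theorem exists_stronglyMeasurable_coef_eq {w : ℝ → Mode → ℂ} (hw : ∀ i, Continuous fun t => w t i)
    (hw2 : ∀ t, l2sq (fun i => ‖w t i‖ₑ) < ∞) (hrefl : ∀ t, reflect (w t) = w t) :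
    ∃ (u : ℝ → L2y l) (ζ : ℝ → L2xy l), StronglyMeasurable u ∧ StronglyMeasurable ζ ∧
      ∀ t, coef (u t) (ζ t) = w t := by
  obtain ⟨u, hu, hcu⟩ := exists_stronglyMeasurable_repr_eq (conjSymm_fourierBasis (l := l))
    (c := fun t n => w t (.inl n)) (fun n => hw _)
    (fun t => lt_of_le_of_lt le_self_add (hw2 t))
    fun t n => (congrFun (hrefl t) (.inl (-n))).symm.trans (by simp [reflect, flip])
  obtain ⟨ζ, hζ, hcζ⟩ := exists_stronglyMeasurable_repr_eq (conjSymm_fourier2Basis (l := l))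
    (c := fun t k => w t (.inr k)) (fun k => hw _)
    (fun t => lt_of_le_of_lt le_add_self (hw2 t))
    fun t k => (congrFun (hrefl t) (.inr (-k))).symm.trans (by simp [reflect, flip])
  refine ⟨u, ζ, hu, hζ, fun t => ?_⟩
  funext i
  rcases i with n | k
  · exact (hat1_eq_repr _ _).trans (hcu t n)
  · exact (hat2_eq_repr _ _).trans (hcζ t k)

theorem aestronglyMeasurable_coef {μ : Measure ℝ} {u : ℝ → L2y l} {ζ : ℝ → L2xy l}
    (hu : AEStronglyMeasurable u μ) (hζ : AEStronglyMeasurable ζ μ) (i : Mode) :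
    AEStronglyMeasurable (fun t => coef (u t) (ζ t) i) μ := by
  rcases i with n | k
  · exact (continuous_hat1 n).comp_aestronglyMeasurable hu
  · exact (continuous_hat2 k).comp_aestronglyMeasurable hζ

/-- For s ≥ 0 the H^s bound contains an ℓ² bound, and this is all that uniqueness needs. -/
theorem MemLinftyHs.exists_l2sq_le {s : ℝ} (hs : 0 ≤ s) {u : ℝ → L2y l} {ζ : ℝ → L2xy l}
    (h : MemLinftyHs s u ζ) : ∃ M < ∞, ∀ᵐ t ∂(volume.restrict (Ioi (0 : ℝ))),
      l2sq (fun i => ‖coef (u t) (ζ t) i‖ₑ) ≤ M := by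
  refine ⟨_, ENNReal.add_lt_top.2 ⟨h.bdd_u, h.bdd_ζ⟩, ?_⟩
  filter_upwards [ENNReal.ae_le_essSup fun t => sobolevSq1 s (u t),
    ENNReal.ae_le_essSup fun t => sobolevSq2 s (ζ t)] with t h1 h2
  rw [← hsq_zero (l := l)]
  refine (hsq_mono hs fun _ => le_rfl).trans ?_
  rw [hsq_coef]
  exact add_le_add h1 h2

theorem IsMildSolution.ae_eq {ν C₁ s : ℝ} (hν : 0 < ν) (hs : 0 ≤ s) {u₀ : L2y l} {ζ₀ : L2xy l}
    {u v : ℝ → L2y l} {ζ η : ℝ → L2xy l} (h : IsMildSolution ν C₁ s u₀ ζ₀ u ζ)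
    (h' : IsMildSolution ν C₁ s u₀ ζ₀ v η) :
    ∀ᵐ t ∂(volume.restrict (Ioi (0 : ℝ))), v t = u t ∧ η t = ζ t := by
  obtain ⟨M, hM, hMu⟩ := h.mem.exists_l2sq_le hs
  obtain ⟨M', hM', hMv⟩ := h'.mem.exists_l2sq_le hs
  have := duhamel_unique hl.out hν (C₁ := C₁) (z₀ := coef u₀ ζ₀) (max_lt hM' hM)
    (aestronglyMeasurable_coef h'.mem.meas_u h'.mem.meas_ζ)
    (aestronglyMeasurable_coef h.mem.meas_u h.mem.meas_ζ)
    (hMv.mono fun t ht => ht.trans (le_max_left _ _))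
    (hMu.mono fun t ht => ht.trans (le_max_right _ _))
    (h'.duhamel.mono fun t ht => duhamelAt_iff.1 ht)
    (h.duhamel.mono fun t ht => duhamelAt_iff.1 ht)
  exact this.mono fun t ht => coef_injective ht

theorem exists_isMildSolution {ν : ℝ} (hν : 0 < ν) (C₁ : ℝ) {s : ℝ} (hs : 0 ≤ s) {u₀ : L2y l}
    (hu₀ : MemHs1 s u₀) {ζ₀ : L2xy l} (hζ₀ : MemHs2 s ζ₀) :
    ∃ (u : ℝ → L2y l) (ζ : ℝ → L2xy l), IsMildSolution ν C₁ s u₀ ζ₀ u ζ ∧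
      ∀ t, 0 ≤ t → DuhamelAt ν C₁ u₀ ζ₀ u ζ t := by
  obtain ⟨w, Z, hZ, hwc, hwZ, hwr, hwD⟩ := exists_duhamel_solution hl.out hν C₁ hs
    (reflect_coef u₀ ζ₀) (by rw [hsq_coef]; exact ENNReal.add_lt_top.2 ⟨hu₀, hζ₀⟩)
  have hsq_le : ∀ t, hsq l s (fun i => ‖w t i‖ₑ) ≤ hsq l s Z := fun t => hsq_mono le_rfl (hwZ t)
  have hw2 : ∀ t, l2sq (fun i => ‖w t i‖ₑ) < ∞ := fun t => by
    rw [← hsq_zero (l := l)]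
    exact ((hsq_mono hs fun _ => le_rfl).trans (hsq_le t)).trans_lt hZ
  obtain ⟨u, ζ, hu, hζ, hc⟩ := exists_stronglyMeasurable_coef_eq (l := l) hwc hw2 hwr
  have hbd : ∀ t, sobolevSq1 s (u t) + sobolevSq2 s (ζ t) ≤ hsq l s Z := fun t => by
    rw [← hsq_coef, hc]
    exact hsq_le t
  have hD : ∀ t, 0 ≤ t → DuhamelAt ν C₁ u₀ ζ₀ u ζ t := fun t ht => by
    rw [duhamelAt_iff]
    simp only [hc]
    exact hwD t ht
  refine ⟨u, ζ, ⟨⟨hu.aestronglyMeasurable, hζ.aestronglyMeasurable, ?_, ?_⟩, ?_⟩, hD⟩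
  · exact (essSup_le_of_ae_le _ (Eventually.of_forall fun t =>
      le_self_add.trans (hbd t))).trans_lt hZ
  · exact (essSup_le_of_ae_le _ (Eventually.of_forall fun t =>
      le_add_self.trans (hbd t))).trans_lt hZ
  · filter_upwards [ae_restrict_mem measurableSet_Ioi] with t ht
    exact hD t (le_of_lt ht)

end WellPosed

end EddyMean

end

theorem theorem1 (l : ℝ) [Fact (0 < l)] (ν : ℝ) (hν : 0 < ν) (C₁ : ℝ) (s : ℝ) (hs : 0 ≤ s)
    (u₀ : EddyMean.L2y l) (hu₀ : EddyMean.MemHs1 s u₀)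
    (ζ₀ : EddyMean.L2xy l) (hζ₀ : EddyMean.MemHs2 s ζ₀) :
    ∃ (u : ℝ → EddyMean.L2y l) (ζ : ℝ → EddyMean.L2xy l),
      EddyMean.IsMildSolution ν C₁ s u₀ ζ₀ u ζ ∧
      (∀ t : ℝ, 0 ≤ t → EddyMean.DuhamelAt ν C₁ u₀ ζ₀ u ζ t) ∧
      ∀ (v : ℝ → EddyMean.L2y l) (η : ℝ → EddyMean.L2xy l),
        EddyMean.IsMildSolution ν C₁ s u₀ ζ₀ v η →
          ∀ᵐ t ∂(MeasureTheory.volume.restrict (Set.Ioi (0 : ℝ))), v t = u t ∧ η t = ζ t := by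
  obtain ⟨u, ζ, h, hD⟩ := EddyMean.exists_isMildSolution hν C₁ hs hu₀ hζ₀
  exact ⟨u, ζ, h, hD, fun v η h' => h.ae_eq hν hs h'⟩
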